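/- **Setting.** An instance $I$ of the robust shortest path problem consists of a finite simple undirected graph $G$ on $n$ vertices, an origin $s$ and a destination $t$ that are joined by a path in $G$, and for every vertex $i$ a finite nonempty set $\mathcal U_i$ of possible positions in a metric space $(\mathcal M,d)$; the distances between all pairs of points of $\bigcup_i\mathcal U_i$ are given explicitly in the input. Write $\mathcal U=\prod_i\mathcal U_i$ and $\sigma=\max_i|\mathcal U_i|$. The cost of a simple $s$–$t$ path $P$ is $$c(P)=\max_{u\in\mathcal U}\ \sum_{\{i,j\}\in E[P]} d(u_i,u_j),$$ and $\mathrm{opt}(I)$ is the minimum of $c(P)$ over all simple $s$–$t$ paths $P$. Time is counted as the number of elementary operations of a random access machine. The machine has registers and arrays for natural numbers ("words"), with arithmetic, comparison and indirect addressing, and registers and arrays for real numbers, which can only be copied, added, subtracted and compared. **Theorem.** For fixed $\sigma$, the robust shortest path problem admits an FPTAS. More precisely, there is an algorithm (one program) such that for every $\sigma$ there is a constant $C_\sigma$ with the following property. For every instance $I$ with $\max_i|\mathcal U_i|=\sigma$ and every real $\varepsilon>0$, the algorithm on input $(I,\varepsilon)$ outputs a simple $s$–$t$ path $P$ with $c(P)\le(1+\varepsilon)\,\mathrm{opt}(I)$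 after at most $$C_\sigma\, n^3\sigma^2\,\max\{1,\,n^2/\varepsilon\}^{\sigma}$$ steps, and all words that occur in the computation have size at most this number. In particular, for $\varepsilon\le n^2$ the running time is $O\!\left(n^3\sigma^2\left(\frac{n^2}{\varepsilon}\right)^{\sigma}\right)$. -/

import Mathlib

/-! # The robust shortest path problem -/

namespace RobustSP

/-- An instance of the robust shortest path problem in a metric space `M`: a simple undirected
graph on `n` vertices, an origin `s` and a destination `t`, and for each vertex `i` a finite
nonempty uncertainty set `{loc i 0, …, loc i (size i - 1)}` of `size i` distinct points of `M`. -/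
structure Instance (M : Type*) [MetricSpace M] where
  n : ℕ
  G : SimpleGraph (Fin n)
  s : Fin n
  t : Fin n
  size : Fin n → ℕ
  size_pos : ∀ i, 0 < size i
  loc : (i : Fin n) → Fin (size i) → M
  loc_injective : ∀ i, Function.Injective (loc i)

namespace Instance

variable {M : Type*} [MetricSpace M] (I : Instance M)

/-- The largest cardinality of an uncertainty set. -/
def sigma : ℕ := Finset.univ.sup I.size

/-- An element `u` of the product of all the uncertainty sets; the position of the vertex `i`
is `I.loc i (u i)`. -/
abbrev Scenario : Type := (i : Fin I.n) → Fin (I.size i)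

instance : Nonempty I.Scenario := ⟨fun i => ⟨0, I.size_pos i⟩⟩

/-- The weight `d(u_i, u_j)` of the edge `{i, j}` in the scenario `u`. -/
noncomputable def edgeCost (u : I.Scenario) : Sym2 (Fin I.n) → ℝ :=
  Sym2.lift ⟨fun i j => dist (I.loc i (u i)) (I.loc j (u j)), fun _ _ => dist_comm _ _⟩

/-- The cost `c(u, P)`: the sum of the weights of the edges of `P` in the scenario `u`. -/
noncomputable def costIn (u : I.Scenario) {i j : Fin I.n} (P : I.G.Walk i j) : ℝ :=
  (P.edges.map (I.edgeCost u)).sum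

/-- The robust cost `c(P)`, the maximum of `c(u, P)` over all scenarios `u`. -/
noncomputable def cost {i j : Fin I.n} (P : I.G.Walk i j) : ℝ :=
  Finset.univ.sup' Finset.univ_nonempty fun u : I.Scenario => I.costIn u P

/-- `P` is a (simple) `s`-`t` path whose robust cost is at most `α` times that of every
`s`-`t` path. -/
def IsApprox (α : ℝ) (P : I.G.Walk I.s I.t) : Prop :=
  P.IsPath ∧ ∀ Q : I.G.Walk I.s I.t, Q.IsPath → I.cost P ≤ α * I.cost Q

end Instance

/-! # A random access machine

Programs work on finitely many word registers, word arrays, real registers and real arrays. Words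
are natural numbers of size at most `W`, where `W` is a parameter of the machine; a program that
produces a larger word has no execution. Real numbers can only be copied, added, subtracted and
compared; there is no multiplication, no rounding and no conversion of reals into words. Every
operation costs one time unit. -/

/-- The contents of the memory: registers and arrays, the latter given as name, index, content. -/
structure Store where
  word : ℕ → ℕ
  wordArr : ℕ → ℕ → ℕ
  real : ℕ → ℝ
  realArr : ℕ → ℕ → ℝ

/-- Expressions with word values. In `arr a e`, the array name `a` is fixed in the program and
the index `e` is computed. -/
inductive WExpr : Type
  | const (c : ℕ)
  | reg (x : ℕ)
  | arr (a : ℕ) (e : WExpr)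
  | add (e f : WExpr)
  | sub (e f : WExpr)
  | mul (e f : WExpr)
  | div (e f : WExpr)
  | mod (e f : WExpr)

/-- The value of a word expression; subtraction is truncated. -/
def WExpr.eval (m : Store) : WExpr → ℕ
  | const c => c
  | reg x => m.word x
  | arr a e => m.wordArr a (e.eval m)
  | add e f => e.eval m + f.eval m
  | sub e f => e.eval m - f.eval m
  | mul e f => e.eval m * f.eval m
  | div e f => e.eval m / f.eval m
  | mod e f => e.eval m % f.eval m

/-- All the words produced in the evaluation of an expression are at most `W`. -/
def WExpr.Fits (W : ℕ) (m : Store) : WExpr → Prop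
  | const c => c ≤ W
  | reg x => m.word x ≤ W
  | arr a e => e.Fits W m ∧ m.wordArr a (e.eval m) ≤ W
  | add e f => e.Fits W m ∧ f.Fits W m ∧ e.eval m + f.eval m ≤ W
  | sub e f => e.Fits W m ∧ f.Fits W m
  | mul e f => e.Fits W m ∧ f.Fits W m ∧ e.eval m * f.eval m ≤ W
  | div e f => e.Fits W m ∧ f.Fits W m
  | mod e f => e.Fits W m ∧ f.Fits W m

/-- The number of operations in a word expression. -/
def WExpr.time : WExpr → ℕ
  | const _ => 1
  | reg _ => 1
  | arr _ e => e.time + 1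
  | add e f => e.time + f.time + 1
  | sub e f => e.time + f.time + 1
  | mul e f => e.time + f.time + 1
  | div e f => e.time + f.time + 1
  | mod e f => e.time + f.time + 1

/-- Expressions with real values. -/
inductive RExpr : Type
  | zero
  | one
  | reg (x : ℕ)
  | arr (a : ℕ) (e : WExpr)
  | add (e f : RExpr)
  | sub (e f : RExpr)

noncomputable def RExpr.eval (m : Store) : RExpr → ℝ
  | zero => 0
  | one => 1
  | reg x => m.real x
  | arr a e => m.realArr a (e.eval m)
  | add e f => e.eval m + f.eval m
  | sub e f => e.eval m - f.eval m

/-- All the words (array indices) produced in the evaluation are at most `W`. -/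
def RExpr.Fits (W : ℕ) (m : Store) : RExpr → Prop
  | zero => True
  | one => True
  | reg _ => True
  | arr _ e => e.Fits W m
  | add e f => e.Fits W m ∧ f.Fits W m
  | sub e f => e.Fits W m ∧ f.Fits W m

def RExpr.time : RExpr → ℕ
  | zero => 1
  | one => 1
  | reg _ => 1
  | arr _ e => e.time + 1
  | add e f => e.time + f.time + 1
  | sub e f => e.time + f.time + 1

/-- Boolean tests: comparisons of words or of reals, and their Boolean combinations. -/
inductive Test : Type
  | le (e f : WExpr)
  | rle (e f : RExpr)
  | not (b : Test)
  | and (b c : Test)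

def Test.Holds (m : Store) : Test → Prop
  | le e f => e.eval m ≤ f.eval m
  | rle e f => e.eval m ≤ f.eval m
  | not b => ¬ b.Holds m
  | and b c => b.Holds m ∧ c.Holds m

def Test.Fits (W : ℕ) (m : Store) : Test → Prop
  | le e f => e.Fits W m ∧ f.Fits W m
  | rle e f => e.Fits W m ∧ f.Fits W m
  | not b => b.Fits W m
  | and b c => b.Fits W m ∧ c.Fits W m

def Test.time : Test → ℕ
  | le e f => e.time + f.time + 1
  | rle e f => e.time + f.time + 1
  | not b => b.time + 1
  | and b c => b.time + c.time + 1

/-- Programs. -/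
inductive Program : Type
  | skip
  | setWord (x : ℕ) (e : WExpr)
  | setWordArr (a : ℕ) (i e : WExpr)
  | setReal (x : ℕ) (e : RExpr)
  | setRealArr (a : ℕ) (i : WExpr) (e : RExpr)
  | seq (p q : Program)
  | ite (b : Test) (p q : Program)
  | loop (b : Test) (p : Program)

/-- `Exec W p m T m'`: started with memory `m`, the program `p` terminates after exactly `T` time
units with memory `m'`, on a machine with words of size at most `W`. -/
inductive Exec (W : ℕ) : Program → Store → ℕ → Store → Prop
  | skip (m : Store) : Exec W .skip m 1 m
  | setWord (m : Store) (x : ℕ) (e : WExpr) (he : e.Fits W m) :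
      Exec W (.setWord x e) m (e.time + 1)
        { m with word := Function.update m.word x (e.eval m) }
  | setWordArr (m : Store) (a : ℕ) (i e : WExpr) (hi : i.Fits W m) (he : e.Fits W m) :
      Exec W (.setWordArr a i e) m (i.time + e.time + 1)
        { m with wordArr := Function.update m.wordArr a
                   (Function.update (m.wordArr a) (i.eval m) (e.eval m)) }
  | setReal (m : Store) (x : ℕ) (e : RExpr) (he : e.Fits W m) :
      Exec W (.setReal x e) m (e.time + 1)
        { m with real := Function.update m.real x (e.eval m) }
  | setRealArr (m : Store) (a : ℕ) (i : WExpr) (e : RExpr) (hi : i.Fits W m)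
      (he : e.Fits W m) :
      Exec W (.setRealArr a i e) m (i.time + e.time + 1)
        { m with realArr := Function.update m.realArr a
                   (Function.update (m.realArr a) (i.eval m) (e.eval m)) }
  | seq (p q : Program) (m₀ m₁ m₂ : Store) (T₁ T₂ : ℕ)
      (h₁ : Exec W p m₀ T₁ m₁) (h₂ : Exec W q m₁ T₂ m₂) :
      Exec W (.seq p q) m₀ (T₁ + T₂) m₂
  | iteTrue (b : Test) (p q : Program) (m m' : Store) (T : ℕ) (hf : b.Fits W m)
      (hb : b.Holds m) (h : Exec W p m T m') :
      Exec W (.ite b p q) m (b.time + T + 1) m'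
  | iteFalse (b : Test) (p q : Program) (m m' : Store) (T : ℕ) (hf : b.Fits W m)
      (hb : ¬ b.Holds m) (h : Exec W q m T m') :
      Exec W (.ite b p q) m (b.time + T + 1) m'
  | loopTrue (b : Test) (p : Program) (m₀ m₁ m₂ : Store) (T₁ T₂ : ℕ) (hf : b.Fits W m₀)
      (hb : b.Holds m₀) (h₁ : Exec W p m₀ T₁ m₁) (h₂ : Exec W (.loop b p) m₁ T₂ m₂) :
      Exec W (.loop b p) m₀ (b.time + T₁ + T₂ + 1) m₂
  | loopFalse (b : Test) (p : Program) (m : Store) (hf : b.Fits W m) (hb : ¬ b.Holds m) :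
      Exec W (.loop b p) m (b.time + 1) m

/-! # Input and output -/

namespace Instance

variable {M : Type*} [MetricSpace M] (I : Instance M)

/-- The point listed at place `p = i * σ + k`, which is `loc i k` (if `k < size i`). -/
def pointAt (p : ℕ) : Option M :=
  if hi : p / I.sigma < I.n then
    if hk : p % I.sigma < I.size ⟨p / I.sigma, hi⟩ then
      some (I.loc ⟨p / I.sigma, hi⟩ ⟨p % I.sigma, hk⟩)
    else none
  else none

/-- The matrix with the distances of all pairs of points, stored row by row: the distance of
`loc i k` and `loc j l` is at place `(i * σ + k) * (n * σ) + (j * σ + l)`. -/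
noncomputable def distArr (p : ℕ) : ℝ :=
  match I.pointAt (p / (I.n * I.sigma)), I.pointAt (p % (I.n * I.sigma)) with
  | some x, some y => dist x y
  | _, _ => 0

open Classical in
/-- The adjacency matrix, stored row by row. -/
noncomputable def adjArr (p : ℕ) : ℕ :=
  if ∃ i j : Fin I.n, p = i * I.n + j ∧ I.G.Adj i j then 1 else 0

/-- The list of the sizes of the uncertainty sets. -/
def sizeArr (i : ℕ) : ℕ :=
  if hi : i < I.n then I.size ⟨i, hi⟩ else 0

/-- The initial memory for the instance `I` and the accuracy `ε`: the word registers 0, 1, 2, 3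
contain `n`, `s`, `t`, `σ`, the word arrays 0 and 1 the adjacency matrix and the sizes of the
uncertainty sets, the real register 0 contains `ε` and the real array 0 the distance matrix.
Everything else is 0. -/
noncomputable def input (ε : ℝ) : Store where
  word x := match x with
    | 0 => I.n
    | 1 => I.s
    | 2 => I.t
    | 3 => I.sigma
    | _ => 0
  wordArr a := match a with
    | 0 => I.adjArr
    | 1 => I.sizeArr
    | _ => fun _ => 0
  real x := match x with
    | 0 => ε
    | _ => 0
  realArr a := match a with
    | 0 => I.distArr
    | _ => fun _ => 0

/-- The memory `m` contains `P` as output: the number of its edges in the word register 0 and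
its successive vertices in the word array 0. -/
def IsOutput (m : Store) (P : I.G.Walk I.s I.t) : Prop :=
  m.word 0 = P.length ∧ ∀ k ≤ P.length, m.wordArr 0 k = P.getVert k

/-- The quantity `n³ σ² (n² / ε)^σ`, with `n² / ε` replaced by `1` where `ε > n²`. -/
noncomputable def bound (ε : ℝ) : ℝ :=
  (I.n : ℝ) ^ 3 * (I.sigma : ℝ) ^ 2 * (max 1 ((I.n : ℝ) ^ 2 / ε)) ^ I.sigma

end Instance

end RobustSP

/-!
Let `D` be the length of a shortest path from `s` to `t` when each edge has its largest possible
length. Then `opt ≤ D ≤ n * opt`, so rounding all distances down to multiples of `D / N` with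
`N ≈ n² / ε` changes the cost of a path by at most `n * D / N ≤ ε * opt`.

A walk to `t` enters the cost of a longer walk only through its first vertex and the `σ` rounded
worst costs, one for each position of this vertex. These vectors form at most `n * (N + 1) ^ σ`
states, which are explored from the state of the trivial walk at `t` in breadth-first order, with
states coded by numbers in base `N + 1`. Along a path the position of the first vertex can be
chosen independently of the others, so the state of a path consists of costs that are attained;
hence the best state found at `s` is at most as expensive as an optimal path. A walk with this state
is traced back through the predecessors; following the last occurrence of each vertex shortens it to
a path without raising its costs.
-/

namespace RobustSP

/-! # Weights of walks -/

section Weight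

variable {V α : Type*} {G : SimpleGraph V}

/-- The weight of a walk for a weight function `w` on ordered pairs of vertices. -/
def weight [AddCommMonoid α] (w : V → V → α) {a b : V} (P : G.Walk a b) : α :=
  (P.darts.map fun e => w e.fst e.snd).sum

@[simp]
theorem weight_nil [AddCommMonoid α] (w : V → V → α) (a : V) :
    weight w (.nil : G.Walk a a) = 0 := by
  simp [weight]

@[simp]
theorem weight_cons [AddCommMonoid α] (w : V → V → α) {a b c : V} (h : G.Adj a b)
    (P : G.Walk b c) : weight w (.cons h P) = w a b + weight w P := by
  simp [weight]

theorem weight_nonneg {w : V → V → ℝ} (hw : ∀ a b, 0 ≤ w a b) {a b : V} (P : G.Walk a b) :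
    0 ≤ weight w P :=
  List.sum_nonneg fun x hx => by
    obtain ⟨e, -, rfl⟩ := List.mem_map.1 hx
    exact hw _ _

theorem weight_mono {w w' : V → V → ℝ} (h : ∀ a b, w a b ≤ w' a b) {a b : V} (P : G.Walk a b) :
    weight w P ≤ weight w' P :=
  List.sum_le_sum fun _ _ => h _ _

theorem weight_bypass_le [DecidableEq V] {w : V → V → ℝ} (hw : ∀ a b, 0 ≤ w a b) {a b : V}
    (P : G.Walk a b) : weight w P.bypass ≤ weight w P := by
  refine (P.darts_bypass_sublist_darts.map _).sum_le_sum fun x hx => ?_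
  obtain ⟨e, -, rfl⟩ := List.mem_map.1 hx
  exact hw _ _

/-- The weight function in the scenario where each vertex `v` has the position `u v`, when `a` is
given for pairs of a vertex and a position. -/
def inScenario {K : Type*} (a : V → K → V → K → α) (u : V → K) (v w : V) : α :=
  a v (u v) w (u w)

theorem weight_inScenario_congr {K : Type*} [AddCommMonoid α] (a : V → K → V → K → α)
    {u u' : V → K} {v w : V} (P : G.Walk v w) (h : ∀ x ∈ P.support, u x = u' x) :
    weight (inScenario a u) P = weight (inScenario a u') P := by
  refine congrArg List.sum (List.map_congr_left fun e he => ?_)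
  simp only [inScenario, h _ (P.dart_fst_mem_support_of_mem_darts he),
    h _ (P.dart_snd_mem_support_of_mem_darts he)]

end Weight

/-! # Rounding -/

section Rounding

variable {V : Type*} {G : SimpleGraph V} {D : ℝ} {N : ℕ} {w : V → V → ℝ} {r : V → V → ℕ}

/-- The number `x` is rounded down to `k` in units of `D / N`, except that every `k` above `N`
stands for a number too large to matter. The formulation covers `D = 0`. -/
structure Rounded (D : ℝ) (N : ℕ) (x : ℝ) (k : ℕ) : Prop where
  lower : D * k ≤ N * x
  upper : k ≤ N → N * x ≤ D * (k + 1)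
  zero : x = 0 → k = 0
  le : k ≤ N + 1

theorem mul_weight_le_of_rounded (hr : ∀ a b, Rounded D N (w a b) (r a b)) {a b : V}
    (P : G.Walk a b) : D * weight r P ≤ N * weight w P := by
  induction P with
  | nil => simp
  | @cons a b c hadj P ih =>
    simp only [weight_cons, Nat.cast_add, mul_add]
    exact add_le_add (hr a b).lower ih

theorem mul_weight_le_add_length_of_rounded (hr : ∀ a b, Rounded D N (w a b) (r a b)) {a b : V}
    (P : G.Walk a b) (hP : weight r P ≤ N) :
    N * weight w P ≤ D * (weight r P + P.length) := by
  induction P with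
  | nil => simp
  | @cons a b c hadj P ih =>
    rw [weight_cons] at hP
    have hedge := (hr a b).upper (by omega)
    have htail := ih (by omega)
    simp only [weight_cons, SimpleGraph.Walk.length_cons]
    push_cast
    linarith

theorem weight_eq_zero_of_rounded (hw : ∀ a b, 0 ≤ w a b)
    (hr : ∀ a b, Rounded D N (w a b) (r a b)) {a b : V} (P : G.Walk a b) (hP : weight w P ≤ 0) :
    weight r P = 0 := by
  induction P with
  | nil => simp
  | @cons a b c hadj P ih =>
    rw [weight_cons] at hP ⊢
    have hedge := hw a b
    have htail := weight_nonneg hw P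
    rw [ih (by linarith), (hr a b).zero (by linarith)]

theorem weight_le_of_rounded (hD : 0 ≤ D) (hw : ∀ a b, 0 ≤ w a b)
    (hr : ∀ a b, Rounded D N (w a b) (r a b)) {a b : V} (P : G.Walk a b) (hP : weight w P ≤ D) :
    weight r P ≤ N := by
  rcases hD.eq_or_lt with rfl | hpos
  · exact (weight_eq_zero_of_rounded hw hr P hP).trans_le (Nat.zero_le N)
  · have h : D * weight r P ≤ D * N := by
      calc D * weight r P ≤ N * weight w P := mul_weight_le_of_rounded hr P
        _ ≤ N * D := mul_le_mul_of_nonneg_left hP (Nat.cast_nonneg _)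
        _ = D * N := mul_comm _ _
    exact_mod_cast le_of_mul_le_mul_left h hpos

/-- Rounding loses at most `D / N` per edge, hence at most `n D / N ≤ n² c / N ≤ ε c` in total. -/
theorem weight_le_mul_of_rounded {w' : V → V → ℝ} {r' : V → V → ℕ} {n : ℕ} {ε c : ℝ}
    (hr : ∀ a b, Rounded D N (w a b) (r a b)) (hr' : ∀ a b, Rounded D N (w' a b) (r' a b))
    (hD : 0 ≤ D) (hN : 0 < N) (hε : (n : ℝ) ^ 2 ≤ N * ε) (hc : 0 ≤ c) (hDc : D ≤ n * c) {a b : V}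
    {P Q : G.Walk a b} (hlen : P.length ≤ n) (hPN : weight r P ≤ N)
    (hPQ : weight r P ≤ weight r' Q) (hQ : weight w' Q ≤ c) : weight w P ≤ (1 + ε) * c := by
  have hN' : (0 : ℝ) < N := by exact_mod_cast hN
  have hlen' : (P.length : ℝ) ≤ n := by exact_mod_cast hlen
  have hmain : D * weight r P ≤ N * c := by
    calc D * weight r P ≤ D * weight r' Q := by gcongr
      _ ≤ N * weight w' Q := mul_weight_le_of_rounded hr' Q
      _ ≤ N * c := by gcongr
  have hloss : D * P.length ≤ N * ε * c := by
    calc D * P.length ≤ n * c * n := by gcongr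
      _ = (n : ℝ) ^ 2 * c := by ring
      _ ≤ N * ε * c := by gcongr
  refine le_of_mul_le_mul_left ?_ hN'
  calc (N : ℝ) * weight w P ≤ D * (weight r P + P.length) :=
        mul_weight_le_add_length_of_rounded hr P hPN
    _ ≤ N * ((1 + ε) * c) := by linarith

end Rounding

/-! # The dynamic program -/

section States

variable {V K : Type*} [Fintype K] {G : SimpleGraph V} {r : V → K → V → K → ℕ} {N : ℕ}

/-- The worst cost of a walk that starts with an edge from `w` in position `l` to `v`, when `g k`
is the worst cost of the remaining walk if `v` is in position `k`. -/
def extendValue (r : V → K → V → K → ℕ) (v : V) (g : K → ℕ) (w : V) (l : K) : ℕ :=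
  Finset.univ.sup fun k => r w l v k + g k

/-- The transitions of the dynamic program. A state consists of the first vertex of a walk and the
worst costs of the walk for each position of this vertex; costs above `N` are discarded. -/
def Step (G : SimpleGraph V) (r : V → K → V → K → ℕ) (N : ℕ) (x y : V × (K → ℕ)) : Prop :=
  G.Adj y.1 x.1 ∧ y.2 = extendValue r x.1 x.2 y.1 ∧ ∀ l, y.2 l ≤ N

theorem Step.add_le {x y : V × (K → ℕ)} (h : Step G r N x y) (k l : K) :
    r y.1 l x.1 k + x.2 k ≤ y.2 l := by
  rw [h.2.1]
  exact Finset.le_sup (f := fun k => r y.1 l x.1 k + x.2 k) (Finset.mem_univ k)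

/-- The states that belong to walks to `t`. -/
abbrev ReachableState (G : SimpleGraph V) (r : V → K → V → K → ℕ) (N : ℕ) (t : V) :
    V × (K → ℕ) → Prop :=
  Relation.ReflTransGen (Step G r N) (t, 0)

theorem ReachableState.le {t : V} {x : V × (K → ℕ)} (h : ReachableState G r N t x) (k : K) :
    x.2 k ≤ N := by
  cases h with
  | refl => exact Nat.zero_le N
  | tail _ hstep => exact hstep.2.2 k

/-- The values of `g` are costs of `P`. Since `P` is a path, the position of its first vertex can
be chosen independently of a scenario for the others. -/
theorem exists_reachableState_of_isPath [Nonempty K] {v t : V} (P : G.Walk v t)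
    (hP : P.IsPath) (hle : ∀ u, weight (inScenario r u) P ≤ N) :
    ∃ g : K → ℕ, ReachableState G r N t (v, g) ∧
      ∀ l, ∃ u, u v = l ∧ weight (inScenario r u) P = g l := by
  classical
  induction P with
  | nil => exact ⟨0, .refl, fun l => ⟨fun _ => l, rfl, weight_nil _ _⟩⟩
  | @cons v v' t hadj P ih =>
    rw [SimpleGraph.Walk.cons_isPath_iff] at hP
    obtain ⟨g, hg, hattained⟩ := ih hP.1 fun u =>
      (Nat.le_add_left _ _).trans ((weight_cons _ hadj P).symm.trans_le (hle u))
    have hcost : ∀ l, ∃ u, u v = l ∧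
        weight (inScenario r u) (.cons hadj P) = extendValue r v' g v l := fun l => by
      obtain ⟨k, -, hk⟩ := Finset.exists_mem_eq_sup Finset.univ Finset.univ_nonempty
        fun k => r v l v' k + g k
      obtain ⟨u, hu, hweight⟩ := hattained k
      have htail : weight (inScenario r (Function.update u v l)) P = weight (inScenario r u) P :=
        weight_inScenario_congr r P fun x hx =>
          Function.update_of_ne (fun h : x = v => hP.2 (h ▸ hx)) _ _
      exact ⟨Function.update u v l, Function.update_self _ _ _, by
        rw [weight_cons, htail, hweight, extendValue, hk, inScenario, Function.update_self,
          Function.update_of_ne hadj.ne', hu]⟩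
    refine ⟨extendValue r v' g v, hg.tail ⟨hadj, rfl, fun l => ?_⟩, hcost⟩
    obtain ⟨u, -, hu⟩ := hcost l
    exact hu.symm.trans_le (hle u)

end States

/-! # Paths from sequences of vertices -/

section Trace

variable {V : Type*}

theorem exists_last_occurrence (p : ℕ → V) {i L : ℕ} (hi : i ≤ L) :
    ∃ k, i ≤ k ∧ k ≤ L ∧ p k = p i ∧ ∀ j ≤ L, k < j → p j ≠ p i := by
  classical
  have hle : i ≤ Nat.findGreatest (fun k => p k = p i) L := Nat.le_findGreatest hi rfl
  exact ⟨_, hle, Nat.findGreatest_le L, Nat.findGreatest_spec (P := fun k => p k = p i) hi rfl,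
    fun j hj hlt => Nat.findGreatest_is_greatest hlt hj⟩

/-- The relation `next` leads from the last occurrence of each vertex in `p 0, …, p (L - 1)` to the
subsequent vertex. Following it shortcuts the walk `p 0, …, p L` to a path. -/
def FollowsLast (p : ℕ → V) (next : V → V → Prop) (L : ℕ) : Prop :=
  ∀ i < L, (∀ j < L, i < j → p j ≠ p i) → next (p i) (p (i + 1))

theorem FollowsLast.update [DecidableEq V] {p : ℕ → V} {next : V → V} {L : ℕ}
    (h : FollowsLast p (fun v w => next v = w) L) :
    FollowsLast p (fun v w => Function.update next (p L) (p (L + 1)) v = w) (L + 1) :=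
  fun i hi hlast => by
    rcases Nat.lt_succ_iff_lt_or_eq.1 hi with hi | rfl
    · simp only [Function.update_of_ne (hlast L L.lt_succ_self hi).symm]
      exact h i hi fun j hj => hlast j (hj.trans L.lt_succ_self)
    · simp only [Function.update_self]

theorem exists_isPath_of_next {G : SimpleGraph V} {p : ℕ → V} {L : ℕ}
    {next : V → V → Prop} (hadj : ∀ i < L, G.Adj (p i) (p (i + 1)))
    (hnext : FollowsLast p next L) {i : ℕ} (hi : i ≤ L) :
    ∃ P : G.Walk (p i) (p L), P.IsPath ∧ (∀ x ∈ P.support, ∃ j, i ≤ j ∧ j ≤ L ∧ p j = x) ∧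
      (∀ k < P.length, next (P.getVert k) (P.getVert (k + 1))) ∧
      ∀ (w : V → V → ℕ) (φ : ℕ → ℕ), (∀ j < L, w (p j) (p (j + 1)) + φ (j + 1) ≤ φ j) →
        weight w P ≤ φ i := by
  induction hm : L - i using Nat.strong_induction_on generalizing i with
  | h m ih =>
  obtain ⟨k, hik, hkL, hk, hlast⟩ := exists_last_occurrence p hi
  have antitone : ∀ (w : V → V → ℕ) (φ : ℕ → ℕ),
      (∀ j < L, w (p j) (p (j + 1)) + φ (j + 1) ≤ φ j) → φ k ≤ φ i := fun w φ hφ =>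
    Nat.le_induction (P := fun j _ => j ≤ L → φ j ≤ φ i) (fun _ => le_rfl)
      (fun j _ h hj => (le_of_add_le_right (hφ j hj)).trans (h (by omega))) k hik hkL
  rcases hkL.eq_or_lt with rfl | hkL
  · rw [hk]
    exact ⟨.nil, .nil, by simpa using ⟨i, le_rfl, hik, rfl⟩, by simp, by simp⟩
  · obtain ⟨P, hP, hsupport, hfollow, hweight⟩ := ih (L - (k + 1)) (by omega) (i := k + 1) hkL rfl
    have hadj' : G.Adj (p i) (p (k + 1)) := hk ▸ hadj k hkL
    have hnext' : next (p i) (p (k + 1)) :=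
      hk ▸ hnext k hkL fun j hj hkj => hk ▸ hlast j hj.le hkj
    refine ⟨.cons hadj' P, hP.cons fun hmem => ?_, ?_, ?_, fun w φ hφ => ?_⟩
    · obtain ⟨j, hkj, hjL, hj⟩ := hsupport _ hmem
      exact hlast j hjL hkj hj
    · simp only [SimpleGraph.Walk.support_cons, List.mem_cons, forall_eq_or_imp]
      exact ⟨⟨i, le_rfl, hi, rfl⟩, fun x hx =>
        let ⟨j, hkj, hjL, hj⟩ := hsupport x hx
        ⟨j, by omega, hjL, hj⟩⟩
    · rintro (_ | j) hj
      · simpa using hnext'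
      · simpa using hfollow j (by simpa using hj)
    · rw [weight_cons, ← hk]
      exact ((Nat.add_le_add_left (hweight w φ hφ) _).trans (hφ k hkL)).trans (antitone w φ hφ)

theorem exists_isPath_of_step {K : Type*} [Fintype K] {G : SimpleGraph V}
    {r : V → K → V → K → ℕ} {N L : ℕ} {x : ℕ → V × (K → ℕ)} {next : V → V → Prop}
    (hx : ∀ i < L, Step G r N (x (i + 1)) (x i))
    (hnext : FollowsLast (fun i => (x i).1) next L) :
    ∃ P : G.Walk (x 0).1 (x L).1, P.IsPath ∧
      (∀ k < P.length, next (P.getVert k) (P.getVert (k + 1))) ∧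
      ∀ u, weight (inScenario r u) P ≤ (x 0).2 (u (x 0).1) := by
  obtain ⟨P, hP, -, hfollow, hweight⟩ :=
    exists_isPath_of_next (p := fun i => (x i).1) (fun i hi => (hx i hi).1) hnext L.zero_le
  exact ⟨P, hP, hfollow, fun u => hweight _ (fun i => (x i).2 (u (x i).1)) fun i hi =>
    (hx i hi).add_le _ _⟩

end Trace

/-! # Breadth-first search -/

/-- The invariant of a breadth-first search from `x₀` along the relation `R`. The states found so
far are `queue 0, …, queue (size - 1)`, and `seen` marks them; the steps from the first `head` of
them are finished, as well as those from `queue head` to the elements of `done`. -/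
structure Search {S : Type*} (R : S → S → Prop) (x₀ : S) (seen : S → ℕ) (queue : ℕ → S)
    (parent : ℕ → ℕ) (size head : ℕ) (done : S → Prop) : Prop where
  size_pos : 0 < size
  head_le : head ≤ size
  start : queue 0 = x₀
  seen_le : ∀ x, seen x ≤ 1
  seen_iff : ∀ x, seen x ≠ 0 ↔ ∃ k < size, queue k = x
  injOn : Set.InjOn queue (Set.Iio size)
  step : ∀ k < size, k ≠ 0 → parent k < k ∧ R (queue (parent k)) (queue k)
  finished : ∀ k < head, ∀ x, R (queue k) x → seen x ≠ 0
  current : ∀ x, R (queue head) x → done x → seen x ≠ 0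

namespace Search

variable {S : Type*} {R : S → S → Prop} {x₀ : S} {seen : S → ℕ} {queue : ℕ → S} {parent : ℕ → ℕ}
  {size head : ℕ} {done done' : S → Prop}

theorem init [DecidableEq S] (h : queue 0 = x₀) :
    Search R x₀ (Function.update (fun _ => 0) x₀ 1) queue parent 1 0 fun _ => False where
  size_pos := one_pos
  head_le := zero_le_one
  start := h
  seen_le x := by by_cases hx : x = x₀ <;> simp [hx]
  seen_iff x := by simp [Function.update_apply, h, eq_comm]
  injOn k hk l hl _ := by simp_all
  step k hk h0 := by omega
  finished k hk := absurd hk k.not_lt_zero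
  current _ _ := False.elim

theorem skip (h : Search R x₀ seen queue parent size head done)
    (hdone : ∀ x, R (queue head) x → done' x → done x ∨ seen x ≠ 0) :
    Search R x₀ seen queue parent size head done' :=
  { h with current := fun x hx hx' => (hdone x hx hx').elim (h.current x hx) id }

theorem push [DecidableEq S] (h : Search R x₀ seen queue parent size head done)
    (hhead : head < size) {y : S} (hy : R (queue head) y) (hnew : seen y = 0)
    (hdone : ∀ x, R (queue head) x → done' x → done x ∨ x = y) :
    Search R x₀ (Function.update seen y 1) (Function.update queue size y)
      (Function.update parent size head) (size + 1) head done' := by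
  have hold : ∀ k < size, Function.update queue size y k = queue k := fun k hk =>
    Function.update_of_ne hk.ne _ _
  have hseen : ∀ x, Function.update seen y 1 x ≠ 0 ↔ x = y ∨ seen x ≠ 0 := fun x => by
    by_cases hx : x = y <;> simp [hx]
  have hfresh : ∀ k < size, queue k ≠ y := fun k hk e => (h.seen_iff y).2 ⟨k, hk, e⟩ hnew
  refine ⟨by omega, by omega, by rw [hold 0 h.size_pos, h.start], fun x => ?_, fun x => ?_, ?_,
    fun k hk h0 => ?_, fun k hk x hx => ?_, fun x hx hx' => ?_⟩
  · by_cases hx : x = y <;> simp [hx, h.seen_le]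
  · rw [hseen, h.seen_iff, Nat.exists_lt_succ_right, or_comm, Function.update_self, eq_comm]
    exact or_congr_left (exists_congr fun k => and_congr_right fun hk => by rw [hold k hk])
  · intro k hk l hl e
    rcases Nat.lt_succ_iff_lt_or_eq.1 hk with hk | rfl <;>
      rcases Nat.lt_succ_iff_lt_or_eq.1 hl with hl | rfl
    · exact h.injOn hk hl (by rwa [hold k hk, hold l hl] at e)
    · exact absurd (by rwa [hold k hk, Function.update_self] at e) (hfresh k hk)
    · exact absurd (by rw [hold l hl, Function.update_self] at e; exact e.symm) (hfresh l hl)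
    · rfl
  · rcases Nat.lt_succ_iff_lt_or_eq.1 hk with hk | rfl
    · obtain ⟨hlt, hstep⟩ := h.step k hk h0
      rw [Function.update_of_ne hk.ne, hold _ (hlt.trans hk), hold k hk]
      exact ⟨hlt, hstep⟩
    · rw [Function.update_self, Function.update_self, hold _ hhead]
      exact ⟨hhead, hy⟩
  · rw [hold k (by omega)] at hx
    exact (hseen x).2 (.inr (h.finished k hk x hx))
  · rw [hold head hhead] at hx
    exact (hseen x).2 ((hdone x hx hx').symm.imp_right (h.current x hx))

theorem next (h : Search R x₀ seen queue parent size head done) (hhead : head < size)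
    (hdone : ∀ x, R (queue head) x → done x) :
    Search R x₀ seen queue parent size (head + 1) fun _ => False :=
  { h with
    head_le := hhead
    finished := fun k hk x hx => by
      rcases Nat.lt_succ_iff_lt_or_eq.1 hk with hk | rfl
      · exact h.finished k hk x hx
      · exact h.current x hx (hdone x hx)
    current := fun _ _ => False.elim }

theorem reachable (h : Search R x₀ seen queue parent size head done) {k : ℕ} (hk : k < size) :
    Relation.ReflTransGen R x₀ (queue k) := by
  induction k using Nat.strong_induction_on with
  | h k ih =>
    rcases eq_or_ne k 0 with rfl | h0
    · rw [h.start]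
    · obtain ⟨hlt, hstep⟩ := h.step k hk h0
      exact (ih _ hlt (hlt.trans hk)).tail hstep

theorem iterate_parent_lt (h : Search R x₀ seen queue parent size head done) {b L : ℕ}
    (hb : b < size) (hL : ∀ i < L, parent^[i] b ≠ 0) {i : ℕ} (hi : i ≤ L) :
    parent^[i] b < size := by
  induction i with
  | zero => exact hb
  | succ i ih =>
    rw [Function.iterate_succ_apply']
    exact (h.step _ (ih (by omega)) (hL i hi)).1.trans (ih (by omega))

theorem exists_of_reachable (h : Search R x₀ seen queue parent size size done) {x : S}
    (hx : Relation.ReflTransGen R x₀ x) : ∃ k < size, queue k = x := by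
  induction hx with
  | refl => exact ⟨0, h.size_pos, h.start⟩
  | @tail y z _ hyz ih =>
    obtain ⟨k, hk, rfl⟩ := ih
    exact (h.seen_iff z).1 (h.finished k hk z hyz)

theorem size_le_card (h : Search R x₀ seen queue parent size head done) {s : Finset S}
    (hs : ∀ x, Relation.ReflTransGen R x₀ x → x ∈ s) : size ≤ s.card := by
  simpa using Finset.card_le_card_of_injOn (s := Finset.range size) queue
    (fun k hk => hs _ (h.reachable (by simpa using hk))) (by simpa using h.injOn)

end Search

/-! # Linear search -/

/-- The invariant of a linear search for a least value of `f` on the numbers that satisfy `p`, where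
these values are at most `N`. The numbers below `K` are finished, and `value` is `N + 1` if none of
them satisfies `p`. -/
structure MinSearch (p : ℕ → Prop) (f : ℕ → ℕ) (N K value best : ℕ) : Prop where
  value_le : value ≤ N + 1
  le_apply : ∀ k < K, p k → value ≤ f k
  attained : value ≤ N → best < K ∧ p best ∧ f best = value

namespace MinSearch

variable {p : ℕ → Prop} {f : ℕ → ℕ} {N K value best : ℕ}

theorem init (p : ℕ → Prop) (f : ℕ → ℕ) (N best : ℕ) : MinSearch p f N 0 (N + 1) best where
  value_le := le_rfl
  le_apply k hk := absurd hk k.not_lt_zero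
  attained h := absurd h N.not_succ_le_self

theorem skip (h : MinSearch p f N K value best) (hK : p K → value ≤ f K) :
    MinSearch p f N (K + 1) value best where
  value_le := h.value_le
  le_apply k hk hp := by
    rcases Nat.lt_succ_iff_lt_or_eq.1 hk with hk | rfl
    · exact h.le_apply k hk hp
    · exact hK hp
  attained hN := (h.attained hN).imp_left Nat.lt_succ_of_lt

theorem update (h : MinSearch p f N K value best) (hK : p K) (hlt : f K < value) :
    MinSearch p f N (K + 1) (f K) K where
  value_le := hlt.le.trans h.value_le
  le_apply k hk hp := by
    rcases Nat.lt_succ_iff_lt_or_eq.1 hk with hk | rfl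
    · exact hlt.le.trans (h.le_apply k hk hp)
    · exact le_rfl
  attained _ := ⟨K.lt_succ_self, hK, rfl⟩

theorem best_spec (h : MinSearch p f N K value best) {k : ℕ} (hk : k < K) (hp : p k)
    (hN : f k ≤ N) : best < K ∧ p best ∧ ∀ k < K, p k → f best ≤ f k := by
  obtain ⟨hbest, hpbest, hvalue⟩ := h.attained ((h.le_apply k hk hp).trans hN)
  exact ⟨hbest, hpbest, fun k hk hp => hvalue.trans_le (h.le_apply k hk hp)⟩

end MinSearch

/-! # Encodings -/

/-- The place of the pair of the `k`-th position of the vertex `i` and the `l`-th position of the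
vertex `j` in a matrix that is stored row by row. -/
def place (n σ i k j l : ℕ) : ℕ := (i * σ + k) * (n * σ) + (j * σ + l)

theorem mul_add_lt_mul {a b A B : ℕ} (ha : a < A) (hb : b < B) : a * B + b < A * B := by
  calc a * B + b < a * B + B := by omega
    _ = (a + 1) * B := by ring
    _ ≤ A * B := Nat.mul_le_mul_right _ ha

theorem place_lt {n σ i k j l : ℕ} (hi : i < n) (hk : k < σ) (hj : j < n) (hl : l < σ) :
    place n σ i k j l < n * σ * (n * σ) :=
  mul_add_lt_mul (mul_add_lt_mul hi hk) (mul_add_lt_mul hj hl)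

section Codes

variable {n σ B N : ℕ}

/-- The number that represents the state `x` in memory. The costs are its last `σ` digits in
base `B`. -/
def code (B : ℕ) (x : Fin n × (Fin σ → ℕ)) : ℕ := ∑ l, x.2 l * B ^ (l : ℕ) + x.1 * B ^ σ

theorem code_zero (t : Fin n) : code B (t, (0 : Fin σ → ℕ)) = t * B ^ σ := by simp [code]

theorem code_add_single (x : Fin n × (Fin σ → ℕ)) (l : Fin σ) (y : ℕ) :
    code B (x.1, x.2 + Pi.single l y) = code B x + y * B ^ (l : ℕ) := by
  simp only [code, Pi.add_apply, add_mul, Finset.sum_add_distrib, Pi.single_apply, ite_mul,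
    zero_mul, Finset.sum_ite_eq', Finset.mem_univ, if_true]
  ring

theorem sum_mul_pow_lt {g : Fin σ → ℕ} (hg : ∀ l, g l < B) :
    ∑ l, g l * B ^ (l : ℕ) < B ^ σ := by
  simpa only [finFunctionFinEquiv_apply_val] using
    (finFunctionFinEquiv fun l => (⟨g l, hg l⟩ : Fin B)).isLt

theorem sum_mul_pow_div_mod {g : Fin σ → ℕ} (hg : ∀ l, g l < B) (k : Fin σ) :
    (∑ l, g l * B ^ (l : ℕ)) / B ^ (k : ℕ) % B = g k := by
  have h := congrArg (fun f => (f k : ℕ))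
    (finFunctionFinEquiv.symm_apply_apply fun l => (⟨g l, hg l⟩ : Fin B))
  simpa only [finFunctionFinEquiv_symm_apply_val, finFunctionFinEquiv_apply_val] using h

theorem code_div {x : Fin n × (Fin σ → ℕ)} (hx : ∀ l, x.2 l < B) : code B x / B ^ σ = x.1 := by
  have h := sum_mul_pow_lt hx
  rw [code, Nat.add_mul_div_right _ _ (by omega), Nat.div_eq_of_lt h, zero_add]

theorem code_digit {x : Fin n × (Fin σ → ℕ)} (hx : ∀ l, x.2 l < B) (k : Fin σ) :
    code B x / B ^ (k : ℕ) % B = x.2 k := by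
  have hB : 0 < B := (Nat.zero_le _).trans_lt (hx k)
  have hpow : (x.1 : ℕ) * B ^ σ = B ^ (k : ℕ) * (B * (x.1 * B ^ (σ - (k + 1)))) := by
    rw [show B ^ σ = B ^ (k : ℕ) * B * B ^ (σ - (k + 1)) by
      rw [← pow_succ, ← pow_add, Nat.add_sub_cancel' k.isLt]]
    ring
  rw [code, hpow, Nat.add_mul_div_left _ _ (pow_pos hB _), Nat.add_mul_mod_self_left,
    sum_mul_pow_div_mod hx]

theorem code_lt {x : Fin n × (Fin σ → ℕ)} (hx : ∀ l, x.2 l < B) : code B x < n * B ^ σ := by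
  rw [code, add_comm]
  exact mul_add_lt_mul x.1.isLt (sum_mul_pow_lt hx)

theorem code_injective {x y : Fin n × (Fin σ → ℕ)} (hx : ∀ l, x.2 l < B) (hy : ∀ l, y.2 l < B)
    (h : code B x = code B y) : x = y :=
  Prod.ext (Fin.ext (by rw [← code_div hx, h, code_div hy]))
    (funext fun k => by rw [← code_digit hx, h, code_digit hy])

variable {G : SimpleGraph (Fin n)} {r : Fin n → Fin σ → Fin n → Fin σ → ℕ} {t : Fin n} {c : ℕ}

/-- The transitions between codes of states. -/
def CodeStep (G : SimpleGraph (Fin n)) (r : Fin n → Fin σ → Fin n → Fin σ → ℕ) (N c c' : ℕ) :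
    Prop :=
  ∃ x y, (∀ k, x.2 k ≤ N) ∧ Step G r N x y ∧ code (N + 1) x = c ∧ code (N + 1) y = c'

theorem codeStep_code_iff {x : Fin n × (Fin σ → ℕ)} (hx : ∀ k, x.2 k ≤ N) :
    CodeStep G r N (code (N + 1) x) c ↔ ∃ y, Step G r N x y ∧ code (N + 1) y = c := by
  refine ⟨fun ⟨x', y, hx', hstep, he, hc⟩ => ?_, fun ⟨y, hstep, hc⟩ => ⟨x, y, hx, hstep, rfl, hc⟩⟩
  obtain rfl := code_injective (fun k => Nat.lt_succ_of_le (hx' k))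
    (fun k => Nat.lt_succ_of_le (hx k)) he
  exact ⟨y, hstep, hc⟩

theorem CodeStep.div_lt {c' : ℕ} (h : CodeStep G r N c c') : c' / (N + 1) ^ σ < n := by
  obtain ⟨x, y, -, ⟨-, -, hy⟩, -, rfl⟩ := h
  rw [code_div fun k => Nat.lt_succ_of_le (hy k)]
  exact y.1.isLt

theorem codeStep_and_div_eq_iff {x : Fin n × (Fin σ → ℕ)} (hx : ∀ k, x.2 k ≤ N) {w : Fin n} :
    CodeStep G r N (code (N + 1) x) c ∧ c / (N + 1) ^ σ = w ↔
      G.Adj w x.1 ∧ (∀ l, extendValue r x.1 x.2 w l ≤ N) ∧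
        code (N + 1) (w, extendValue r x.1 x.2 w) = c := by
  rw [codeStep_code_iff hx]
  constructor
  · rintro ⟨⟨⟨w', g⟩, ⟨hadj, hg, hle⟩, rfl⟩, hw⟩
    rw [code_div fun l => Nat.lt_succ_of_le (hle l), Fin.val_inj] at hw
    simp only at hg hw
    subst hg hw
    exact ⟨hadj, hle, rfl⟩
  · rintro ⟨hadj, hle, rfl⟩
    exact ⟨⟨_, ⟨hadj, rfl, hle⟩, rfl⟩, code_div fun l => Nat.lt_succ_of_le (hle l)⟩

theorem reflTransGen_codeStep_iff :
    Relation.ReflTransGen (CodeStep G r N) (code (N + 1) (t, (0 : Fin σ → ℕ))) c ↔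
      ∃ x, ReachableState G r N t x ∧ code (N + 1) x = c := by
  constructor
  · intro h
    induction h with
    | refl => exact ⟨_, .refl, rfl⟩
    | @tail c c' _ hstep ih =>
      obtain ⟨x, hx, rfl⟩ := ih
      obtain ⟨y, hxy, hy⟩ := (codeStep_code_iff hx.le).1 hstep
      exact ⟨y, hx.tail hxy, hy⟩
  · rintro ⟨x, hx, rfl⟩
    induction hx with
    | refl => exact .refl
    | tail hx hstep ih => exact ih.tail ⟨_, _, ReachableState.le hx, hstep, rfl, rfl⟩

section Search

variable {seen queue parent : ℕ → ℕ} {size head : ℕ} {done : ℕ → Prop}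

theorem Search.exists_states (h : Search (CodeStep G r N) (code (N + 1) (t, (0 : Fin σ → ℕ))) seen
    queue parent size head done) :
    ∃ x : ℕ → Fin n × (Fin σ → ℕ), ∀ k < size,
      ReachableState G r N t (x k) ∧ code (N + 1) (x k) = queue k := by
  have : Nonempty (Fin n × (Fin σ → ℕ)) := ⟨t, 0⟩
  choose! x hx using fun k (hk : k < size) => reflTransGen_codeStep_iff.1 (h.reachable hk)
  exact ⟨x, hx⟩

theorem Search.queue_lt (h : Search (CodeStep G r N) (code (N + 1) (t, (0 : Fin σ → ℕ))) seen
    queue parent size head done) {k : ℕ} (hk : k < size) : queue k < n * (N + 1) ^ σ := by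
  obtain ⟨x, hx⟩ := h.exists_states
  rw [← (hx k hk).2]
  exact code_lt fun l => Nat.lt_succ_of_le ((hx k hk).1.le l)

theorem Search.size_le_of_codeStep (h : Search (CodeStep G r N)
    (code (N + 1) (t, (0 : Fin σ → ℕ))) seen queue parent size head done) :
    size ≤ n * (N + 1) ^ σ := by
  refine (h.size_le_card (s := Finset.range (n * (N + 1) ^ σ)) fun c hc => ?_).trans_eq
    (Finset.card_range _)
  obtain ⟨x, hx, rfl⟩ := reflTransGen_codeStep_iff.1 hc
  exact Finset.mem_range.2 (code_lt fun k => Nat.lt_succ_of_le (hx.le k))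

/-- The vertex where the search has reached its `k`-th state is `queue k / (N + 1) ^ σ`. -/
theorem Search.exists_isPath_of_next (h : Search (CodeStep G r N)
    (code (N + 1) (t, (0 : Fin σ → ℕ))) seen queue parent size head done) {s : Fin n}
    {g : Fin σ → ℕ} {b L : ℕ} (hb : b < size) (hg : ∀ l, g l ≤ N)
    (hcode : queue b = code (N + 1) (s, g)) (hpos : ∀ i < L, parent^[i] b ≠ 0)
    (hL : parent^[L] b = 0) {next : ℕ → ℕ}
    (hnext : FollowsLast (fun i => queue (parent^[i] b) / (N + 1) ^ σ) (fun v w => next v = w) L) :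
    ∃ P : G.Walk s t, P.IsPath ∧ (∀ k < P.length, next (P.getVert k) = P.getVert (k + 1)) ∧
      ∀ u, weight (inScenario r u) P ≤ g (u s) := by
  obtain ⟨x, hx⟩ : ∃ x : ℕ → Fin n × (Fin σ → ℕ), ∀ i ≤ L,
      (∀ l, (x i).2 l < N + 1) ∧ code (N + 1) (x i) = queue (parent^[i] b) := by
    obtain ⟨x, hx⟩ := h.exists_states
    refine ⟨fun i => x (parent^[i] b), fun i hi => ?_⟩
    obtain ⟨hreach, hxc⟩ := hx _ (h.iterate_parent_lt hb hpos hi)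
    exact ⟨fun l => Nat.lt_succ_of_le (hreach.le l), hxc⟩
  have hstart : x 0 = (s, g) := code_injective (hx 0 L.zero_le).1
    (fun l => Nat.lt_succ_of_le (hg l)) ((hx 0 L.zero_le).2.trans hcode)
  have hend : x L = (t, 0) := code_injective (hx L le_rfl).1 (fun _ => N.succ_pos)
    ((hx L le_rfl).2.trans (by rw [hL, h.start]))
  have hvertex : ∀ i ≤ L, queue (parent^[i] b) / (N + 1) ^ σ = (x i).1 := fun i hi => by
    rw [← (hx i hi).2, code_div (hx i hi).1]
  have hstep : ∀ i < L, Step G r N (x (i + 1)) (x i) := fun i hi => by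
    have hR := (h.step _ (h.iterate_parent_lt hb hpos hi.le) (hpos i hi)).2
    rw [← Function.iterate_succ_apply' parent, ← (hx (i + 1) hi).2, ← (hx i hi.le).2,
      codeStep_code_iff fun l => Nat.le_of_lt_succ ((hx (i + 1) hi).1 l)] at hR
    obtain ⟨y, hy, hyx⟩ := hR
    rwa [code_injective (fun l => Nat.lt_succ_of_le (hy.2.2 l)) (hx i hi.le).1 hyx] at hy
  have key := exists_isPath_of_step (x := x) (next := fun v w => next v = w) hstep
    fun i hi hlast => by
      simp only [← hvertex i hi.le, ← hvertex (i + 1) hi]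
      exact hnext i hi fun j hj hij => by
        simp only [hvertex i hi.le, hvertex j hj.le]
        exact fun e => hlast j hj hij (Fin.ext e)
  rwa [hstart, hend] at key

end Search

end Codes

/-! # Shortest walks -/

section BellmanFord

variable {V : Type*} {G : SimpleGraph V} {t : V} {w : V → V → ℝ} {b b' : V → WithTop ℝ} {r : ℕ}
  {done done' : V → V → Prop}

/-- The invariant of the algorithm of Bellman and Ford in round `r + 1`, when the pairs in `done`
have been processed: `b v` is the weight of some walk from `v` to `t`, or `⊤`, and at most the
weight of every such walk of length at most `r`; walks of length `r + 1` are taken into account if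
their first edge has been processed. -/
structure Relaxed (G : SimpleGraph V) (t : V) (w : V → V → ℝ) (b : V → WithTop ℝ) (r : ℕ)
    (done : V → V → Prop) : Prop where
  sound : ∀ v, b v ≠ ⊤ → ∃ P : G.Walk v t, b v = weight w P
  le_weight : ∀ v (P : G.Walk v t), P.length ≤ r → b v ≤ weight w P
  le_cons : ∀ v v', G.Adj v v' → done v v' → ∀ P : G.Walk v' t, P.length ≤ r →
    b v ≤ w v v' + weight w P

namespace Relaxed

theorem init [DecidableEq V] :
    Relaxed G t w (Function.update (fun _ => ⊤) t 0) 0 fun _ _ => False where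
  sound v hv := by
    obtain rfl : v = t := by_contra fun h => hv (by simp [h])
    exact ⟨.nil, by simp⟩
  le_weight v P hP := by
    cases P with
    | nil => simp
    | cons hadj P => simp at hP
  le_cons _ _ _ := False.elim

theorem mono_done (h : Relaxed G t w b r done)
    (hdone : ∀ v v', G.Adj v v' → done' v v' → done v v') :
    Relaxed G t w b r done' where
  sound := h.sound
  le_weight := h.le_weight
  le_cons v v' hadj hd := h.le_cons v v' hadj (hdone v v' hadj hd)

theorem relax [DecidableEq V] (h : Relaxed G t w b r done) {v v' : V} (hadj : G.Adj v v')
    (hdone : ∀ x x', done' x x' → done x x' ∨ x = v ∧ x' = v') :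
    Relaxed G t w (Function.update b v (min (b v) (w v v' + b v'))) r done' := by
  have hle : ∀ x, Function.update b v (min (b v) (w v v' + b v')) x ≤ b x :=
    update_le_iff.2 ⟨min_le_left _ _, fun _ _ => le_rfl⟩
  refine ⟨fun x hx => ?_, fun x P hP => (hle x).trans (h.le_weight x P hP),
    fun x x' hxx' hd P hP => ?_⟩
  · by_cases hnew : x = v ∧ w v v' + b v' ≤ b v
    · obtain ⟨rfl, hmin⟩ := hnew
      rw [Function.update_self, min_eq_right hmin] at hx ⊢
      obtain ⟨P, hP⟩ := h.sound v' fun htop => hx (by rw [htop, WithTop.add_top])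
      exact ⟨.cons hadj P, by rw [hP, weight_cons, WithTop.coe_add]⟩
    · have hold : Function.update b v (min (b v) (w v v' + b v')) x = b x := by
        rcases eq_or_ne x v with rfl | hxv
        · rw [Function.update_self, min_eq_left (le_of_not_ge fun hge => hnew ⟨rfl, hge⟩)]
        · exact Function.update_of_ne hxv _ _
      rw [hold] at hx ⊢
      exact h.sound x hx
  · rcases hdone x x' hd with hd | ⟨rfl, rfl⟩
    · exact (hle x).trans (h.le_cons x x' hxx' hd P hP)
    · rw [Function.update_self]
      exact (min_le_right _ _).trans (add_le_add_right (h.le_weight x' P hP) _)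

theorem next (h : Relaxed G t w b r done) (hdone : ∀ v v', G.Adj v v' → done v v') :
    Relaxed G t w b (r + 1) fun _ _ => False where
  sound := h.sound
  le_weight v P hP := by
    cases P with
    | nil => exact h.le_weight _ .nil (Nat.zero_le r)
    | cons hadj P =>
      rw [weight_cons, WithTop.coe_add]
      exact h.le_cons _ _ hadj (hdone _ _ hadj) P (by simpa using hP)
  le_cons _ _ _ := False.elim

/-- Since the weights are nonnegative, only walks without repetition matter, and these have fewer
than `card V` edges. -/
theorem exists_isLeast [Fintype V] (h : Relaxed G t w b r done) (hr : Fintype.card V ≤ r)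
    (hw : ∀ v v', 0 ≤ w v v') {s : V} (hs : G.Reachable s t) :
    ∃ D : ℝ, b s = D ∧ IsLeast (Set.range fun P : G.Walk s t => weight w P) D := by
  classical
  have hle : ∀ Q : G.Walk s t, b s ≤ weight w Q := fun Q =>
    (h.le_weight s Q.bypass (Q.bypass_isPath.length_lt.le.trans hr)).trans
      (WithTop.coe_le_coe.2 (weight_bypass_le hw Q))
  obtain ⟨Q⟩ := hs
  obtain ⟨P, hP⟩ := h.sound s ((hle Q).trans_lt (WithTop.coe_lt_top _)).ne
  exact ⟨weight w P, hP, ⟨P, rfl⟩, Set.forall_mem_range.2 fun Q =>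
    WithTop.coe_le_coe.1 (hP ▸ hle Q)⟩

end Relaxed

end BellmanFord

section MaxWeight

variable {V K : Type*} [Fintype K] {G : SimpleGraph V} {a : V → K → V → K → ℝ}

/-- The largest weight of the pair of vertices `v`, `w` in any scenario, or `0` if this is
larger. -/
def maxWeight (a : V → K → V → K → ℝ) (v w : V) : ℝ :=
  Finset.univ.fold max 0 fun p : K × K => a v p.1 w p.2

theorem maxWeight_le_iff {v w : V} {c : ℝ} :
    maxWeight a v w ≤ c ↔ 0 ≤ c ∧ ∀ k l, a v k w l ≤ c := by
  simp [maxWeight, Finset.fold_max_le]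

theorem maxWeight_nonneg (v w : V) : 0 ≤ maxWeight a v w := (maxWeight_le_iff.1 le_rfl).1

theorem weight_inScenario_le_weight_maxWeight (u : V → K) {v w : V} (P : G.Walk v w) :
    weight (inScenario a u) P ≤ weight (maxWeight a) P :=
  weight_mono (fun _ _ => (maxWeight_le_iff.1 le_rfl).2 _ _) P

theorem weight_maxWeight_le (ha : ∀ v k w l, 0 ≤ a v k w l) {c : ℝ} (hc : 0 ≤ c)
    {v w : V} (P : G.Walk v w) (h : ∀ u, weight (inScenario a u) P ≤ c) :
    weight (maxWeight a) P ≤ P.length * c := by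
  classical
  have hdart : ∀ e ∈ P.darts, maxWeight a e.fst e.snd ≤ c := fun e he =>
    maxWeight_le_iff.2 ⟨hc, fun k l => by
      let u := Function.update (fun _ => k) e.snd l
      calc a e.fst k e.snd l = inScenario a u e.fst e.snd := by
            simp [inScenario, u]
        _ ≤ weight (inScenario a u) P :=
            List.single_le_sum (List.forall_mem_map.2 fun _ _ => ha _ _ _ _) _
              (List.mem_map_of_mem he)
        _ ≤ c := h u⟩
  simpa [weight] using List.sum_le_card_nsmul (P.darts.map fun e => maxWeight a e.fst e.snd) c
    (by simpa using hdart)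

end MaxWeight

/-! # Instances -/

/-- The entries of a matrix that is stored row by row. -/
def entry {α : Type*} {n σ : ℕ} (a : ℕ → α) (v : Fin n) (k : Fin σ) (w : Fin n) (l : Fin σ) : α :=
  a (place n σ v k w l)

namespace Instance

variable {M : Type*} [MetricSpace M] (I : Instance M)

theorem size_le_sigma (i : Fin I.n) : I.size i ≤ I.sigma :=
  Finset.le_sup (f := I.size) (Finset.mem_univ i)

theorem n_pos : 0 < I.n := I.s.pos

theorem sigma_pos : 0 < I.sigma := (I.size_pos I.s).trans_le (I.size_le_sigma I.s)

theorem n_mul_n_le : I.n * I.n ≤ I.n * I.sigma * (I.n * I.sigma) :=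
  Nat.mul_le_mul (Nat.le_mul_of_pos_right _ I.sigma_pos) (Nat.le_mul_of_pos_right _ I.sigma_pos)

theorem n_le : I.n ≤ I.n * I.sigma * (I.n * I.sigma) := (Nat.le_mul_self _).trans I.n_mul_n_le

theorem sigma_mul_sigma_le : I.sigma * I.sigma ≤ I.n * I.sigma * (I.n * I.sigma) :=
  Nat.mul_le_mul (Nat.le_mul_of_pos_left _ I.n_pos) (Nat.le_mul_of_pos_left _ I.n_pos)

instance : NeZero I.sigma := ⟨I.sigma_pos.ne'⟩

theorem adjArr_ne_zero_iff (i j : Fin I.n) : I.adjArr (i * I.n + j) ≠ 0 ↔ I.G.Adj i j := by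
  have hinj : ∀ i' j' : Fin I.n, (i : ℕ) * I.n + j = i' * I.n + j' ↔ i = i' ∧ j = j' :=
    fun i' j' => by
      simpa [finProdFinEquiv, Fin.ext_iff, add_comm, mul_comm] using
        (finProdFinEquiv (m := I.n) (n := I.n)).injective.eq_iff (a := (i, j)) (b := (i', j'))
  simp [adjArr, hinj]

theorem adjArr_le_one (p : ℕ) : I.adjArr p ≤ 1 := by
  unfold adjArr
  split_ifs <;> simp

theorem pointAt_mul_add (i : Fin I.n) (k : Fin I.sigma) :
    I.pointAt (i * I.sigma + k) =
      if hk : (k : ℕ) < I.size i then some (I.loc i ⟨k, hk⟩) else none := by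
  have hdiv : ((i : ℕ) * I.sigma + k) / I.sigma = i := by
    rw [mul_comm, Nat.mul_add_div I.sigma_pos, Nat.div_eq_of_lt k.isLt, add_zero]
  have hmod : ((i : ℕ) * I.sigma + k) % I.sigma = k := by
    rw [mul_comm, Nat.mul_add_mod, Nat.mod_eq_of_lt k.isLt]
  unfold pointAt
  generalize ((i : ℕ) * I.sigma + k) / I.sigma = i' at hdiv
  generalize ((i : ℕ) * I.sigma + k) % I.sigma = k' at hmod
  subst hdiv hmod
  simp

theorem distArr_nonneg (p : ℕ) : 0 ≤ I.distArr p := by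
  unfold distArr
  split
  · exact dist_nonneg
  · exact le_rfl

/-- The distances between positions, for all `σ` potential positions of each vertex; `0` if there
is no such position. -/
noncomputable def gap : Fin I.n → Fin I.sigma → Fin I.n → Fin I.sigma → ℝ := entry I.distArr

theorem gap_nonneg (v : Fin I.n) (k : Fin I.sigma) (w : Fin I.n) (l : Fin I.sigma) :
    0 ≤ I.gap v k w l :=
  I.distArr_nonneg _

theorem gap_eq (v w : Fin I.n) (k l : Fin I.sigma) :
    I.gap v k w l =
      if h : (k : ℕ) < I.size v ∧ (l : ℕ) < I.size w then
        dist (I.loc v ⟨k, h.1⟩) (I.loc w ⟨l, h.2⟩) else 0 := by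
  have hlt : (w : ℕ) * I.sigma + l < I.n * I.sigma := mul_add_lt_mul w.isLt l.isLt
  have hrow : place I.n I.sigma v k w l / (I.n * I.sigma) = v * I.sigma + k := by
    rw [place, mul_comm, Nat.mul_add_div (by omega), Nat.div_eq_of_lt hlt, add_zero]
  have hcolumn : place I.n I.sigma v k w l % (I.n * I.sigma) = w * I.sigma + l := by
    rw [place, mul_comm, Nat.mul_add_mod, Nat.mod_eq_of_lt hlt]
  by_cases hk : (k : ℕ) < I.size v <;> by_cases hl : (l : ℕ) < I.size w <;>
    simp [gap, entry, distArr, hrow, hcolumn, pointAt_mul_add, hk, hl]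

theorem costIn_eq_weight (u : I.Scenario) {v w : Fin I.n} (P : I.G.Walk v w) :
    I.costIn u P = weight (fun v w => dist (I.loc v (u v)) (I.loc w (u w))) P := by
  rw [costIn, weight, SimpleGraph.Walk.edges, List.map_map]
  rfl

theorem costIn_le_cost (u : I.Scenario) {v w : Fin I.n} (P : I.G.Walk v w) :
    I.costIn u P ≤ I.cost P :=
  Finset.le_sup' (fun u : I.Scenario => I.costIn u P) (Finset.mem_univ u)

theorem weight_gap_le_cost (u : Fin I.n → Fin I.sigma) {v w : Fin I.n} (P : I.G.Walk v w) :
    weight (inScenario I.gap u) P ≤ I.cost P := by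
  let u' : I.Scenario := fun v => if h : (u v : ℕ) < I.size v then ⟨u v, h⟩ else ⟨0, I.size_pos v⟩
  refine le_trans ?_ (I.costIn_le_cost u' P)
  rw [costIn_eq_weight]
  refine weight_mono (fun v w => ?_) P
  rw [inScenario, gap_eq]
  split_ifs with h
  · simp [u', h.1, h.2]
  · exact dist_nonneg

theorem exists_weight_gap_eq_cost {v w : Fin I.n} (P : I.G.Walk v w) :
    ∃ u : Fin I.n → Fin I.sigma, weight (inScenario I.gap u) P = I.cost P := by
  obtain ⟨u, -, hu⟩ := Finset.exists_mem_eq_sup' Finset.univ_nonempty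
    (fun u : I.Scenario => I.costIn u P)
  refine ⟨fun v => Fin.castLE (I.size_le_sigma v) (u v), ?_⟩
  rw [cost, hu, costIn_eq_weight]
  congr 1
  funext v w
  simp [inScenario, gap_eq]

theorem cost_nonneg {v w : Fin I.n} (P : I.G.Walk v w) : 0 ≤ I.cost P :=
  (weight_nonneg (fun _ _ => I.gap_nonneg _ _ _ _) P).trans (I.weight_gap_le_cost 0 P)

/-! # Correctness -/

/-- The number `D` is the length of a shortest path if each edge has its largest possible length.
It estimates the optimum up to a factor of `n`. -/
def IsEstimate (D : ℝ) : Prop :=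
  IsLeast (Set.range fun P : I.G.Walk I.s I.t => weight (maxWeight I.gap) P) D

variable {I} {N : ℕ} {D ε : ℝ} {r : Fin I.n → Fin I.sigma → Fin I.n → Fin I.sigma → ℕ}

theorem IsEstimate.nonneg (hD : I.IsEstimate D) : 0 ≤ D := by
  obtain ⟨P, rfl⟩ := hD.1
  exact weight_nonneg maxWeight_nonneg P

theorem IsEstimate.exists_cost_le (hD : I.IsEstimate D) :
    ∃ P : I.G.Walk I.s I.t, P.IsPath ∧ I.cost P ≤ D := by
  obtain ⟨P, rfl⟩ := hD.1
  obtain ⟨u, hu⟩ := I.exists_weight_gap_eq_cost P.bypass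
  exact ⟨P.bypass, P.bypass_isPath, hu.symm.trans_le
    ((weight_inScenario_le_weight_maxWeight u _).trans (weight_bypass_le maxWeight_nonneg P))⟩

theorem IsEstimate.le_mul_cost (hD : I.IsEstimate D) {P : I.G.Walk I.s I.t} (hP : P.IsPath) :
    D ≤ I.n * I.cost P := by
  have hlen : (P.length : ℝ) ≤ I.n := by exact_mod_cast by simpa using hP.length_lt.le
  calc D ≤ weight (maxWeight I.gap) P := hD.2 ⟨P, rfl⟩
    _ ≤ P.length * I.cost P := weight_maxWeight_le (I.gap_nonneg)
        (I.cost_nonneg P) P fun u => I.weight_gap_le_cost u P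
    _ ≤ I.n * I.cost P := mul_le_mul_of_nonneg_right hlen (I.cost_nonneg P)

theorem exists_reachableState_of_cost_le (hD : 0 ≤ D)
    (hr : ∀ v k w l, Rounded D N (I.gap v k w l) (r v k w l)) {Q : I.G.Walk I.s I.t}
    (hQ : Q.IsPath) (hQD : I.cost Q ≤ D) :
    ∃ g, ReachableState I.G r N I.t (I.s, g) ∧
      ∃ u, weight (inScenario r u) Q = Finset.univ.sup g := by
  obtain ⟨g, hg, hattained⟩ := exists_reachableState_of_isPath Q hQ fun u =>
    weight_le_of_rounded (w := inScenario I.gap u) hD (fun _ _ => I.gap_nonneg _ _ _ _)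
      (fun _ _ => hr _ _ _ _) Q ((I.weight_gap_le_cost u Q).trans hQD)
  obtain ⟨l, -, hl⟩ := Finset.exists_mem_eq_sup Finset.univ Finset.univ_nonempty g
  obtain ⟨u, -, hu⟩ := hattained l
  exact ⟨g, hg, u, hu.trans hl.symm⟩

theorem isApprox_of_best (hD : I.IsEstimate D) (hN : 0 < N) (hε : 0 < ε)
    (hNε : (I.n : ℝ) ^ 2 ≤ N * ε)
    (hr : ∀ v k w l, Rounded D N (I.gap v k w l) (r v k w l))
    {g : Fin I.sigma → ℕ} (hg : ∀ l, g l ≤ N)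
    (hbest : ∀ g', ReachableState I.G r N I.t (I.s, g') → Finset.univ.sup g ≤ Finset.univ.sup g')
    {P : I.G.Walk I.s I.t} (hP : P.IsPath) (hPg : ∀ u, weight (inScenario r u) P ≤ g (u I.s)) :
    I.IsApprox (1 + ε) P := by
  have hcheap : ∀ Q : I.G.Walk I.s I.t, Q.IsPath → I.cost Q ≤ D →
      I.cost P ≤ (1 + ε) * I.cost Q := fun Q hQ hQD => by
    obtain ⟨g', hg', u', hu'⟩ := exists_reachableState_of_cost_le hD.nonneg hr hQ hQD
    obtain ⟨u, hu⟩ := I.exists_weight_gap_eq_cost P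
    have hround : ∀ (u : Fin I.n → Fin I.sigma) v w,
        Rounded D N (inScenario I.gap u v w) (inScenario r u v w) := fun u v w => hr _ _ _ _
    rw [← hu]
    refine weight_le_mul_of_rounded (hround u) (hround u') hD.nonneg hN hNε (I.cost_nonneg Q)
      (hD.le_mul_cost hQ) (by simpa using hP.length_lt.le)
      ((hPg u).trans (hg _)) ?_ (I.weight_gap_le_cost u' Q)
    calc weight (inScenario r u) P ≤ g (u I.s) := hPg u
      _ ≤ Finset.univ.sup g := Finset.le_sup (Finset.mem_univ _)
      _ ≤ Finset.univ.sup g' := hbest g' hg'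
      _ = weight (inScenario r u') Q := hu'.symm
  refine ⟨hP, fun Q hQ => ?_⟩
  rcases le_total (I.cost Q) D with hQD | hDQ
  · exact hcheap Q hQ hQD
  · obtain ⟨P₀, hP₀, hP₀D⟩ := hD.exists_cost_le
    exact (hcheap P₀ hP₀ hP₀D).trans
      (mul_le_mul_of_nonneg_left (hP₀D.trans hDQ) (by linarith))

end Instance

/-! # Verification of programs -/

/-- A part of the memory: a register or a whole array. -/
inductive Loc : Type
  | word (x : ℕ)
  | wordArr (a : ℕ)
  | real (x : ℕ)
  | realArr (a : ℕ)
  deriving DecidableEq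

/-- The memories `m` and `m'` have the same content at `l`. -/
def AgreeAt (m m' : Store) : Loc → Prop
  | .word x => m'.word x = m.word x
  | .wordArr a => m'.wordArr a = m.wordArr a
  | .real x => m'.real x = m.real x
  | .realArr a => m'.realArr a = m.realArr a

theorem AgreeAt.refl (m : Store) (l : Loc) : AgreeAt m m l := by
  cases l <;> rfl

theorem AgreeAt.trans {m₁ m₂ m₃ : Store} {l : Loc} (h : AgreeAt m₁ m₂ l)
    (h' : AgreeAt m₂ m₃ l) : AgreeAt m₁ m₃ l := by
  cases l <;> exact Eq.trans h' h

/-- The registers and arrays that occur in an expression. -/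
def WExpr.reads : WExpr → List Loc
  | const _ => []
  | reg x => [.word x]
  | arr a e => .wordArr a :: e.reads
  | add e f | sub e f | mul e f | div e f | mod e f => e.reads ++ f.reads

theorem WExpr.eval_congr {m m' : Store} {e : WExpr} (h : ∀ l ∈ e.reads, AgreeAt m m' l) :
    e.eval m' = e.eval m := by
  induction e with
  | const c => rfl
  | reg x => exact h (.word x) (by simp [reads])
  | arr a e ih =>
    have ha : m'.wordArr a = m.wordArr a := h (.wordArr a) (by simp [reads])
    simp only [eval, ha, ih fun l hl => h l (by simp [reads, hl])]
  | _ e f ihe ihf =>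
    simp only [eval, ihe fun l hl => h l (by simp [reads, hl]),
      ihf fun l hl => h l (by simp [reads, hl])]

theorem WExpr.fits_congr {W : ℕ} {m m' : Store} {e : WExpr}
    (h : ∀ l ∈ e.reads, AgreeAt m m' l) : e.Fits W m' ↔ e.Fits W m := by
  induction e with
  | const c => rfl
  | reg x => simpa only [Fits] using iff_of_eq (congrArg (· ≤ W) (h (.word x) (by simp [reads])))
  | arr a e ih =>
    have ha : m'.wordArr a = m.wordArr a := h (.wordArr a) (by simp [reads])
    have he : ∀ l ∈ e.reads, AgreeAt m m' l := fun l hl => h l (by simp [reads, hl])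
    simp only [Fits, ha, eval_congr he, ih he]
  | _ e f ihe ihf =>
    have he : ∀ l ∈ e.reads, AgreeAt m m' l := fun l hl => h l (by simp [reads, hl])
    have hf : ∀ l ∈ f.reads, AgreeAt m m' l := fun l hl => h l (by simp [reads, hl])
    simp only [Fits, eval_congr he, eval_congr hf, ihe he, ihf hf]

/-- In the memory `m`, the expression `e` can be evaluated on a machine with words of size at most
`W`, and its value is `v`. -/
structure WExpr.Yields (W : ℕ) (m : Store) (e : WExpr) (v : ℕ) : Prop where
  fits : e.Fits W m
  eval : e.eval m = v

namespace WExpr.Yields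

variable {W a x i v w : ℕ} {m m' : Store} {e f : WExpr}

theorem reg (h : m.word x = v) (hv : v ≤ W) : (reg x).Yields W m v :=
  ⟨h.trans_le hv, h⟩

theorem arr (he : e.Yields W m i) (h : m.wordArr a i = v) (hv : v ≤ W) :
    (arr a e).Yields W m v := by
  obtain ⟨he, rfl⟩ := he
  exact ⟨⟨he, h.trans_le hv⟩, h⟩

theorem add (he : e.Yields W m v) (hf : f.Yields W m w) (h : v + w ≤ W) :
    (add e f).Yields W m (v + w) := by
  obtain ⟨rfl, rfl⟩ := And.intro he.eval hf.eval
  exact ⟨⟨he.fits, hf.fits, h⟩, rfl⟩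

theorem mul (he : e.Yields W m v) (hf : f.Yields W m w) (h : v * w ≤ W) :
    (mul e f).Yields W m (v * w) := by
  obtain ⟨rfl, rfl⟩ := And.intro he.eval hf.eval
  exact ⟨⟨he.fits, hf.fits, h⟩, rfl⟩

theorem div (he : e.Yields W m v) (hf : f.Yields W m w) : (div e f).Yields W m (v / w) := by
  obtain ⟨rfl, rfl⟩ := And.intro he.eval hf.eval
  exact ⟨⟨he.fits, hf.fits⟩, rfl⟩

theorem mod (he : e.Yields W m v) (hf : f.Yields W m w) : (mod e f).Yields W m (v % w) := by
  obtain ⟨rfl, rfl⟩ := And.intro he.eval hf.eval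
  exact ⟨⟨he.fits, hf.fits⟩, rfl⟩

theorem congr (h : e.Yields W m v) (hm : ∀ l ∈ e.reads, AgreeAt m m' l) : e.Yields W m' v :=
  ⟨(fits_congr hm).2 h.fits, (eval_congr hm).trans h.eval⟩

theorem le (h : e.Yields W m v) : v ≤ W := by
  obtain ⟨h, rfl⟩ := h
  induction e with
  | const | reg => exact h
  | arr => exact h.2
  | add | mul => exact h.2.2
  | sub e f ihe => exact (Nat.sub_le _ _).trans (ihe h.1)
  | div e f ihe => exact (Nat.div_le_self _ _).trans (ihe h.1)
  | mod e f ihe => exact (Nat.mod_le _ _).trans (ihe h.1)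

end WExpr.Yields

/-- The registers and arrays to which a program assigns. -/
def Program.writes : Program → List Loc
  | skip => []
  | setWord x _ => [.word x]
  | setWordArr a _ _ => [.wordArr a]
  | setReal x _ => [.real x]
  | setRealArr a _ _ => [.realArr a]
  | seq p q | ite _ p q => p.writes ++ q.writes
  | loop _ p => p.writes

/-- The memories `m` and `m'` differ at most at registers and arrays to which `p` assigns. -/
def Frame (p : Program) (m m' : Store) : Prop :=
  ∀ l ∉ p.writes, AgreeAt m m' l

namespace Frame

variable {p q : Program} {m m₁ m₂ : Store}

theorem refl (p : Program) (m : Store) : Frame p m m := fun l _ => .refl m l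

theorem trans (h : Frame p m m₁) (h' : Frame p m₁ m₂) : Frame p m m₂ :=
  fun l hl => (h l hl).trans (h' l hl)

theorem mono (h : Frame p m m₁) (hpq : p.writes ⊆ q.writes) : Frame q m m₁ :=
  fun l hl => h l fun hp => hl (hpq hp)

theorem seq_left (h : Frame p m m₁) : Frame (.seq p q) m m₁ :=
  h.mono (List.subset_append_left _ _)

theorem seq_right (h : Frame q m m₁) : Frame (.seq p q) m m₁ :=
  h.mono (List.subset_append_right _ _)

theorem word (h : Frame p m m₁) (x : ℕ) (hx : .word x ∉ p.writes := by decide) :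
    m₁.word x = m.word x := h (.word x) hx

theorem wordArr (h : Frame p m m₁) (a : ℕ) (ha : .wordArr a ∉ p.writes := by decide) :
    m₁.wordArr a = m.wordArr a := h (.wordArr a) ha

theorem real (h : Frame p m m₁) (x : ℕ) (hx : .real x ∉ p.writes := by decide) :
    m₁.real x = m.real x := h (.real x) hx

theorem realArr (h : Frame p m m₁) (a : ℕ) (ha : .realArr a ∉ p.writes := by decide) :
    m₁.realArr a = m.realArr a := h (.realArr a) ha

end Frame

theorem Exec.frame {W T : ℕ} {p : Program} {m m' : Store} (h : Exec W p m T m') :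
    Frame p m m' := by
  induction h with
  | skip => exact .refl _ _
  | setWord | setWordArr | setReal | setRealArr =>
    rintro (_ | _ | _ | _) hl <;> simp_all [Program.writes, AgreeAt]
  | seq _ _ _ _ _ _ _ _ _ ih₁ ih₂ => exact ih₁.seq_left.trans ih₂.seq_right
  | iteTrue _ _ _ _ _ _ _ _ _ ih => exact ih.mono (List.subset_append_left _ _)
  | iteFalse _ _ _ _ _ _ _ _ _ ih => exact ih.mono (List.subset_append_right _ _)
  | loopTrue _ _ _ _ _ _ _ _ _ _ _ ih₁ ih₂ => exact Frame.trans ih₁ ih₂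
  | loopFalse => exact .refl _ _

/-- Started with memory `m`, the program `p` terminates within `t` time units with a memory
satisfying `Q`. -/
def Runs (W : ℕ) (p : Program) (m : Store) (t : ℕ) (Q : Store → Prop) : Prop :=
  ∃ T m', Exec W p m T m' ∧ T ≤ t ∧ Q m'

namespace Runs

variable {W : ℕ} {p q : Program} {b : Test} {m : Store} {t t₁ t₂ : ℕ} {Q R : Store → Prop}

theorem mono (h : Runs W p m t₁ R) (ht : t₁ ≤ t₂) (hQ : ∀ m', Frame p m m' → R m' → Q m') :
    Runs W p m t₂ Q := by
  obtain ⟨T, m', he, hT, hR⟩ := h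
  exact ⟨T, m', he, hT.trans ht, hQ m' he.frame hR⟩

theorem mono_time (h : Runs W p m t₁ Q) (ht : t₁ ≤ t₂) : Runs W p m t₂ Q :=
  h.mono ht fun _ _ hQ => hQ

theorem seq (h₁ : Runs W p m t₁ R)
    (h₂ : ∀ m', Frame p m m' → R m' → Runs W q m' t₂ Q) : Runs W (.seq p q) m (t₁ + t₂) Q := by
  obtain ⟨T₁, m₁, he₁, hT₁, hR⟩ := h₁
  obtain ⟨T₂, m₂, he₂, hT₂, hQ⟩ := h₂ m₁ he₁.frame hR
  exact ⟨_, _, .seq _ _ _ _ _ _ _ he₁ he₂, by omega, hQ⟩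

theorem ite (hf : b.Fits W m) (h₁ : b.Holds m → Runs W p m t Q)
    (h₂ : ¬ b.Holds m → Runs W q m t Q) : Runs W (.ite b p q) m (b.time + t + 1) Q := by
  by_cases hb : b.Holds m
  · obtain ⟨T, m', he, hT, hQ⟩ := h₁ hb
    exact ⟨_, _, .iteTrue _ _ _ _ _ _ hf hb he, by omega, hQ⟩
  · obtain ⟨T, m', he, hT, hQ⟩ := h₂ hb
    exact ⟨_, _, .iteFalse _ _ _ _ _ _ hf hb he, by omega, hQ⟩

theorem loop (Inv : ℕ → Store → Prop) (K c : ℕ) (h0 : Inv 0 m)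
    (hf : ∀ k m', k ≤ K → Frame p m m' → Inv k m' → b.Fits W m')
    (hs : ∀ k m', k ≤ K → Frame p m m' → Inv k m' → b.Holds m' →
      k < K ∧ Runs W p m' c (Inv (k + 1))) :
    Runs W (.loop b p) m (K * (b.time + c + 1) + (b.time + 1))
      (fun m' => ∃ k ≤ K, Inv k m' ∧ ¬ b.Holds m') := by
  suffices H : ∀ r k m', k + r = K → Frame p m m' → Inv k m' →
      Runs W (.loop b p) m' (r * (b.time + c + 1) + (b.time + 1))
        (fun m' => ∃ k ≤ K, Inv k m' ∧ ¬ b.Holds m') from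
    H K 0 m (by omega) (.refl _ _) h0
  intro r
  induction r with
  | zero =>
    intro k m' hk hF hI
    have hb : ¬ b.Holds m' := fun hb => absurd (hs k m' (by omega) hF hI hb).1 (by omega)
    exact ⟨_, _, .loopFalse _ _ _ (hf k m' (by omega) hF hI) hb, by simp, k, by omega, hI, hb⟩
  | succ r ih =>
    intro k m' hk hF hI
    have hfits := hf k m' (by omega) hF hI
    by_cases hb : b.Holds m'
    · obtain ⟨-, T₁, m₁, he₁, hT₁, hI₁⟩ := hs k m' (by omega) hF hI hb
      obtain ⟨T₂, m₂, he₂, hT₂, hQ⟩ := ih (k + 1) m₁ (by omega) (hF.trans he₁.frame) hI₁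
      exact ⟨_, _, .loopTrue _ _ _ _ _ _ _ hfits hb he₁ he₂, by rw [add_mul]; omega, hQ⟩
    · exact ⟨_, _, .loopFalse _ _ _ hfits hb, by simp, k, by omega, hI, hb⟩

end Runs

/-- The weakest precondition of a program without loops. -/
def Program.wp (W : ℕ) : Program → (Store → Prop) → Store → Prop
  | skip, Q, m => Q m
  | setWord x e, Q, m => e.Fits W m ∧
      Q { m with word := Function.update m.word x (e.eval m) }
  | setWordArr a i e, Q, m => i.Fits W m ∧ e.Fits W m ∧
      Q { m with wordArr := Function.update m.wordArr a
                   (Function.update (m.wordArr a) (i.eval m) (e.eval m)) }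
  | setReal x e, Q, m => e.Fits W m ∧
      Q { m with real := Function.update m.real x (e.eval m) }
  | setRealArr a i e, Q, m => i.Fits W m ∧ e.Fits W m ∧
      Q { m with realArr := Function.update m.realArr a
                   (Function.update (m.realArr a) (i.eval m) (e.eval m)) }
  | seq p q, Q, m => p.wp W (q.wp W Q) m
  | ite b p q, Q, m => b.Fits W m ∧ (b.Holds m → p.wp W Q m) ∧ (¬ b.Holds m → q.wp W Q m)
  | loop _ _, _, _ => False

/-- The worst-case running time of a program without loops. -/
def Program.straightTime : Program → ℕ
  | skip => 1
  | setWord _ e => e.time + 1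
  | setWordArr _ i e => i.time + e.time + 1
  | setReal _ e => e.time + 1
  | setRealArr _ i e => i.time + e.time + 1
  | seq p q => p.straightTime + q.straightTime
  | ite b p q => b.time + max p.straightTime q.straightTime + 1
  | loop _ _ => 0

theorem Runs.of_wp {W : ℕ} {p : Program} {m : Store} {Q : Store → Prop} (h : p.wp W Q m) :
    Runs W p m p.straightTime Q := by
  induction p generalizing m Q with
  | skip => exact ⟨_, _, .skip _, le_rfl, h⟩
  | setWord x e => exact ⟨_, _, .setWord _ _ _ h.1, le_rfl, h.2⟩
  | setWordArr a i e => exact ⟨_, _, .setWordArr _ _ _ _ h.1 h.2.1, le_rfl, h.2.2⟩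
  | setReal x e => exact ⟨_, _, .setReal _ _ _ h.1, le_rfl, h.2⟩
  | setRealArr a i e => exact ⟨_, _, .setRealArr _ _ _ _ h.1 h.2.1, le_rfl, h.2.2⟩
  | seq p q ihp ihq => exact (ihp h).seq fun m' _ h' => ihq h'
  | ite b p q ihp ihq =>
    exact Runs.ite h.1 (fun hb => (ihp (h.2.1 hb)).mono_time (le_max_left _ _))
      (fun hb => (ihq (h.2.2 hb)).mono_time (le_max_right _ _))
  | loop => exact h.elim

attribute [local simp] Program.wp WExpr.eval WExpr.Fits RExpr.eval RExpr.Fits Test.Holds Test.Fits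

/-- `for x = 0, …, e - 1 do p`, where `p` must not change `x` and `e`. -/
def Program.forLoop (x : ℕ) (e : WExpr) (p : Program) : Program :=
  .seq (.setWord x (.const 0))
    (.loop (.not (.le e (.reg x))) (.seq p (.setWord x (.add (.reg x) (.const 1)))))

theorem Runs.forLoop {W x : ℕ} {e : WExpr} {p : Program} {m : Store}
    (Inv : ℕ → Store → Prop) (c K B : ℕ) (hK₀ : 0 < K) (hB : 0 < B)
    (hK : e.Yields W m K) (h0 : Inv 0 m)
    (hs : ∀ k m', k < K → Frame (.forLoop x e p) m m' → m'.word x = k → Inv k m' →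
      Runs W p m' (c * B) (Inv (k + 1)))
    (hx : .word x ∉ p.writes := by decide)
    (he : ∀ l ∈ e.reads, l ∉ (Program.forLoop x e p).writes := by decide)
    (hloc : ∀ k m v, Inv k m → Inv k { m with word := Function.update m.word x v } := by
      intro _ _ _ h; simpa using h) :
    Runs W (.forLoop x e p) m ((c + 2 * e.time + 14) * (K * B)) (Inv K) := by
  have hK' : ∀ m', Frame (.forLoop x e p) m m' → e.Yields W m' K :=
    fun m' hF => hK.congr fun l hl => hF l (he l hl)
  have hKW := hK.le
  have init : Runs W (.setWord x (.const 0)) m 2 fun m' => m'.word x = 0 ∧ Inv 0 m' :=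
    .of_wp (by simpa using hloc _ _ _ h0)
  have time_le : 2 + (K * ((e.time + 3) + (c * B + 4) + 1) + (e.time + 4)) ≤
      (c + 2 * e.time + 14) * (K * B) := by
    have hKB : K ≤ K * B := Nat.le_mul_of_pos_right K hB
    have hte : e.time * K ≤ e.time * (K * B) := Nat.mul_le_mul_left _ hKB
    have ht : e.time ≤ e.time * K := Nat.le_mul_of_pos_right _ hK₀
    linarith
  refine (init.seq fun m₁ hF₁ ⟨hx₁, hI₁⟩ => ?_).mono_time time_le
  have hF : ∀ m', Frame (.seq p (.setWord x (.add (.reg x) (.const 1)))) m₁ m' →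
      Frame (.forLoop x e p) m m' := fun m' hF =>
    hF₁.seq_left.trans hF.seq_right
  refine (Runs.loop (fun k m' => m'.word x = k ∧ Inv k m') K (c * B + 4) ⟨hx₁, hI₁⟩
    ?fits ?step).mono le_rfl ?exit
  case fits =>
    rintro k m' hk hF' ⟨hxk, -⟩
    exact ⟨(hK' m' (hF m' hF')).fits, by simp only [WExpr.Fits, hxk]; omega⟩
  case step =>
    rintro k m' - hF' ⟨hxk, hI⟩ hb
    have hkK : k < K := by simpa [(hK' m' (hF m' hF')).eval, hxk] using hb
    refine ⟨hkK, (hs k m' hkK (hF m' hF') hxk hI).seq (t₂ := 4) fun m₂ hF₂ hI₂ => .of_wp ?_⟩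
    have hx₂ : m₂.word x = k := (hF₂.word x hx).trans hxk
    simpa [hx₂] using And.intro (by omega) (hloc _ _ _ hI₂)
  case exit =>
    rintro m' hF' ⟨k, hk, ⟨hxk, hI⟩, hb⟩
    have hKk : K ≤ k := by simpa [(hK' m' (hF m' hF')).eval, hxk] using hb
    exact le_antisymm hk hKk ▸ hI

/-- `acc := max {e | x = 0, …, b - 1}`, and `acc := 0` if `b = 0`. -/
def Program.maxLoop (acc x : ℕ) (b e : WExpr) : Program :=
  .seq (.setWord acc (.const 0))
    (.forLoop x b (.ite (.le e (.reg acc)) .skip (.setWord acc e)))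

theorem Runs.maxLoop {W acc x K : ℕ} {b e : WExpr} {m : Store} (f : ℕ → ℕ) (hK₀ : 0 < K)
    (hK : b.Yields W m K)
    (hf : ∀ k m', k < K → Frame (.maxLoop acc x b e) m m' → m'.word x = k →
      e.Yields W m' (f k))
    (hne : x ≠ acc := by decide)
    (hb : ∀ l ∈ b.reads, l ∉ (Program.maxLoop acc x b e).writes := by decide) :
    Runs W (.maxLoop acc x b e) m ((2 * e.time + 2 * b.time + 20) * K)
      fun m' => m'.word acc = (Finset.range K).sup f := by
  have init : Runs W (.setWord acc (.const 0)) m 2 fun m' => m'.word acc = 0 := .of_wp (by simp)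
  refine (init.seq (t₂ := (2 * e.time + 4 + 2 * b.time + 14) * (K * 1))
    fun m₁ hF₁ hacc => ?_).mono_time (by rw [mul_one]; linarith)
  have hb₁ : ∀ l ∈ b.reads, AgreeAt m m₁ l := fun l hl =>
    hF₁.seq_left l (hb l hl)
  have hwrites : ∀ l ∈ b.reads,
      l ∉ (Program.forLoop x b (.ite (.le e (.reg acc)) .skip (.setWord acc e))).writes :=
    fun l hl h => hb l hl (List.mem_append_right _ h)
  refine (Runs.forLoop (fun k m' => m'.word acc = (Finset.range k).sup f ∧ m'.word acc ≤ W)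
    _ K 1 hK₀ one_pos (hK.congr hb₁) (by simp [hacc])
    (fun k m' hk hF hx ⟨hsup, hle⟩ => ?_) (by simp [Program.writes, hne]) hwrites
    (by simp [hne.symm])).mono le_rfl fun _ _ h => h.1
  have hfk := hf k m' hk (hF₁.seq_left.trans hF.seq_right) hx
  refine Runs.mono_time (.of_wp ?_) (t₁ := (e.time + 1 + 1) + max 1 (e.time + 1) + 1) (by omega)
  rw [hsup] at hle
  simp only [Program.wp, Test.Fits, Test.Holds, WExpr.Fits, WExpr.eval, hfk.eval, hsup,
    Function.update_self, Finset.range_add_one, Finset.sup_insert]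
  exact ⟨⟨hfk.fits, hle⟩, fun h => ⟨(sup_eq_right.2 h).symm, hle⟩,
    fun h => ⟨hfk.fits, (sup_eq_left.2 (not_le.1 h).le).symm, hfk.le⟩⟩

/-! # The memory of the algorithm -/

local notation:65 a:65 " ⊞ " b:66 => WExpr.add a b
local notation:70 a:70 " ⊠ " b:71 => WExpr.mul a b
local notation:70 a:70 " ⊘ " b:71 => WExpr.div a b
local notation:70 a:70 " ⊘ᵣ " b:71 => WExpr.mod a b
local infix:45 " ≔ " => Program.setWord
local notation:40 p:41 " ;; " q:40 => Program.seq p q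

instance : Coe ℕ WExpr := ⟨.reg⟩

instance : Coe ℕ RExpr := ⟨.reg⟩

namespace Reg

@[simp] abbrev n : ℕ := 0
@[simp] abbrev s : ℕ := 1
@[simp] abbrev t : ℕ := 2
@[simp] abbrev σ : ℕ := 3
@[simp] abbrev levels : ℕ := 4
@[simp] abbrev codes : ℕ := 5
@[simp] abbrev i : ℕ := 6
@[simp] abbrev j : ℕ := 7
@[simp] abbrev k : ℕ := 8
@[simp] abbrev l : ℕ := 9
@[simp] abbrev value : ℕ := 10
@[simp] abbrev code : ℕ := 11
@[simp] abbrev ok : ℕ := 12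
@[simp] abbrev head : ℕ := 13
@[simp] abbrev size : ℕ := 14
@[simp] abbrev best : ℕ := 15
@[simp] abbrev bestValue : ℕ := 16

end Reg

namespace Arr

@[simp] abbrev adj : ℕ := 0
@[simp] abbrev reached : ℕ := 2
@[simp] abbrev table : ℕ := 3
@[simp] abbrev seen : ℕ := 4
@[simp] abbrev queue : ℕ := 5
@[simp] abbrev parent : ℕ := 6
@[simp] abbrev next : ℕ := 7
@[simp] abbrev power : ℕ := 8

end Arr

namespace RealReg

@[simp] abbrev ε : ℕ := 0
@[simp] abbrev x : ℕ := 1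
@[simp] abbrev y : ℕ := 2
@[simp] abbrev farthest : ℕ := 3
@[simp] abbrev unit : ℕ := 4

end RealReg

namespace RealArr

@[simp] abbrev dist : ℕ := 0
@[simp] abbrev tentative : ℕ := 1

end RealArr

attribute [local simp] Program.wp WExpr.eval WExpr.Fits RExpr.eval RExpr.Fits Test.Holds Test.Fits

/-- The number of levels to which distances are rounded. -/
noncomputable def levels (n : ℕ) (ε : ℝ) : ℕ := max 1 ⌈(n : ℝ) ^ 2 / ε⌉₊

theorem levels_pos (n : ℕ) (ε : ℝ) : 0 < levels n ε := lt_max_of_lt_left one_pos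

theorem levels_le_iff {n k : ℕ} {ε : ℝ} (hε : 0 < ε) (hk : 0 < k) :
    levels n ε ≤ k ↔ (n : ℝ) ^ 2 ≤ k * ε := by
  rw [levels, max_le_iff, Nat.ceil_le, div_le_iff₀ hε]
  exact and_iff_right hk

def squareProg : Program :=
  .setReal RealReg.x .zero ;;
  .forLoop Reg.i (Reg.n ⊠ Reg.n) (.setReal RealReg.x (.add RealReg.x .one))

theorem runs_squareProg {W n : ℕ} {m : Store} (hn : m.word Reg.n = n) (hn₀ : 0 < n)
    (hW : n * n ≤ W) :
    Runs W squareProg m (26 * (n * n)) fun m' => m'.real RealReg.x = (n : ℝ) ^ 2 := by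
  have hnn : n ≤ n * n := Nat.le_mul_self n
  refine (Runs.seq (t₁ := 2) (t₂ := 24 * (n * n * 1)) (R := fun m' => m'.real RealReg.x = 0)
    (.of_wp (by simp)) fun m₁ hF hx => ?_).mono_time (by nlinarith)
  have hn₁ : m₁.word 0 = n := (hF.word Reg.n).trans hn
  refine (Runs.forLoop (fun k m' => m'.real RealReg.x = k) 4 (n * n) 1 (by positivity) one_pos
    ⟨by simp [hn₁]; omega, by simp [hn₁]⟩ (by simpa using hx) fun k m' _ _ _ hx' =>
      Runs.mono_time (.of_wp (by simp [hx'])) (by decide)).mono le_rfl fun m' _ hx' => ?_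
  rw [hx', Nat.cast_mul, sq]

def countLevelsProg : Program :=
  (Reg.levels ≔ .const 1 ;; .setReal RealReg.y RealReg.ε) ;;
  .loop (.not (.rle RealReg.x RealReg.y))
    (Reg.levels ≔ Reg.levels ⊞ .const 1 ;;
     .setReal RealReg.y (.add RealReg.y RealReg.ε))

theorem runs_countLevelsProg {W n : ℕ} {ε : ℝ} {m : Store} (hx : m.real RealReg.x = (n : ℝ) ^ 2)
    (hε : m.real RealReg.ε = ε) (hε₀ : 0 < ε) (hlevels : levels n ε ≤ W) :
    Runs W countLevelsProg m (22 * levels n ε) fun m' => m'.word Reg.levels = levels n ε := by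
  have hN : 1 ≤ levels n ε := levels_pos n ε
  refine (Runs.seq (t₁ := 4) (t₂ := levels n ε * (4 + 8 + 1) + (4 + 1))
    (R := fun m' => m'.word Reg.levels = 1 ∧ m'.real RealReg.y = ε)
    (.of_wp (by simpa [hε] using hN.trans hlevels))
    fun m₁ hF₁ ⟨hlevels₁, hy₁⟩ => ?loop).mono_time (by linarith)
  refine (Runs.loop (fun k m' => m'.word Reg.levels = k + 1 ∧ m'.real RealReg.y = (k + 1 : ℕ) * ε ∧
    k + 1 ≤ levels n ε) (levels n ε) 8 (by simpa [hlevels₁, hy₁] using hN)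
    (fun _ _ _ _ _ => by simp) fun k m' _ hF ⟨hk, hy, _⟩ hxy => ?step).mono le_rfl ?exit
  case step =>
    have hε' : m'.real 0 = ε := by rw [hF.real RealReg.ε, hF₁.real RealReg.ε, hε]
    have hx' : m'.real 1 = (n : ℝ) ^ 2 := by rw [hF.real RealReg.x, hF₁.real RealReg.x, hx]
    have hlt : k + 1 < levels n ε := by
      rw [← not_le, levels_le_iff hε₀ k.succ_pos, ← hy, ← hx']
      exact hxy
    refine ⟨by omega, .of_wp ?_⟩
    simpa [hk, hε', hy] using ⟨by omega, by ring, by omega⟩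
  case exit =>
    rintro m' hF ⟨k, -, ⟨hk, hy, hle⟩, hxy⟩
    have hx' : m'.real 1 = (n : ℝ) ^ 2 := by rw [hF.real RealReg.x, hF₁.real RealReg.x, hx]
    rw [hk]
    refine le_antisymm hle ((levels_le_iff hε₀ k.succ_pos).2 ?_)
    rw [← hy, ← hx']
    exact not_not.1 hxy

/-- The program for `levels`; the quotient is found by repeated addition. -/
def levelsProg : Program :=
  squareProg ;; countLevelsProg

theorem runs_levelsProg {W n : ℕ} {ε : ℝ} {m : Store} (hn : m.word Reg.n = n)
    (hε : m.real RealReg.ε = ε) (hn₀ : 0 < n) (hε₀ : 0 < ε) (hW : n * n ≤ W)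
    (hlevels : levels n ε ≤ W) :
    Runs W levelsProg m (26 * (n * n) + 22 * levels n ε) fun m' =>
      m'.word Reg.levels = levels n ε :=
  (runs_squareProg hn hn₀ hW).seq fun _ hF hx =>
    runs_countLevelsProg hx ((hF.real RealReg.ε).trans hε) hε₀ hlevels

/-- The part of the memory that contains the instance. -/
abbrev instanceLocs : List Loc :=
  [.word Reg.n, .word Reg.s, .word Reg.t, .word Reg.σ, .wordArr Arr.adj, .realArr RealArr.dist]

/-- The memory `m` contains the instance `I`. -/
structure Instance.Loaded {M : Type*} [MetricSpace M] (I : Instance M) (m : Store) : Prop where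
  n : m.word Reg.n = I.n
  s : m.word Reg.s = I.s
  t : m.word Reg.t = I.t
  σ : m.word Reg.σ = I.sigma
  adj : m.wordArr Arr.adj = I.adjArr
  dist : m.realArr RealArr.dist = I.distArr

section

variable {M : Type*} [MetricSpace M] {I : Instance M} {W : ℕ} {m m' : Store}

theorem Instance.Loaded.of_frame {p : Program} (h : I.Loaded m) (hF : Frame p m m')
    (hp : ∀ l ∈ instanceLocs, l ∉ p.writes := by decide) : I.Loaded m' where
  n := (hF.word _ (hp _ (by decide))).trans h.n
  s := (hF.word _ (hp _ (by decide))).trans h.s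
  t := (hF.word _ (hp _ (by decide))).trans h.t
  σ := (hF.word _ (hp _ (by decide))).trans h.σ
  adj := (hF.wordArr _ (hp _ (by decide))).trans h.adj
  dist := (hF.realArr _ (hp _ (by decide))).trans h.dist

def placeExpr (i k j l : WExpr) : WExpr :=
  (i ⊠ Reg.σ ⊞ k) ⊠ (Reg.n ⊠ Reg.σ) ⊞ (j ⊠ Reg.σ ⊞ l)

theorem Instance.Loaded.yields_placeExpr (h : I.Loaded m)
    (hW : I.n * I.sigma * (I.n * I.sigma) ≤ W) {i k j l : WExpr} {a b c d : ℕ}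
    (hi : i.Yields W m a) (hk : k.Yields W m b) (hj : j.Yields W m c) (hl : l.Yields W m d)
    (ha : a < I.n) (hb : b < I.sigma) (hc : c < I.n) (hd : d < I.sigma) :
    (placeExpr i k j l).Yields W m (place I.n I.sigma a b c d) := by
  have hrow := mul_add_lt_mul ha hb
  have hcolumn := mul_add_lt_mul hc hd
  have hplace := place_lt ha hb hc hd
  have hsq := Nat.le_mul_self (I.n * I.sigma)
  have hnW := I.n_le
  have hσW := (Nat.le_mul_self _).trans I.sigma_mul_sigma_le
  unfold place at hplace ⊢
  have n : WExpr.Yields W m Reg.n I.n := .reg h.n (by omega)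
  have σ : WExpr.Yields W m Reg.σ I.sigma := .reg h.σ (by omega)
  exact (((hi.mul σ (by omega)).add hk (by omega)).mul (n.mul σ (by omega)) (by omega)).add
    ((hj.mul σ (by omega)).add hl (by omega)) (by omega)

def adjExpr (i j : WExpr) : WExpr := .arr Arr.adj (i ⊠ Reg.n ⊞ j)

theorem Instance.Loaded.yields_adjExpr (h : I.Loaded m) (hW : I.n * I.n ≤ W) {i j : WExpr}
    {a b : Fin I.n} (hi : i.Yields W m a) (hj : j.Yields W m b) :
    (adjExpr i j).Yields W m (I.adjArr (a * I.n + b)) := by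
  have hindex := mul_add_lt_mul a.isLt b.isLt
  have hsq := Nat.le_mul_self I.n
  have n : WExpr.Yields W m Reg.n I.n := .reg h.n (by omega)
  exact ((hi.mul n (by omega)).add hj (by omega)).arr (by rw [h.adj])
    ((I.adjArr_le_one _).trans (I.n_pos.trans_le (by omega)))

end

section ShortestPath

variable {M : Type*} [MetricSpace M] {I : Instance M} {W : ℕ} {m : Store} {i j : Fin I.n}

def maxDistProg : Program :=
  .setReal RealReg.farthest .zero ;;
  .forLoop Reg.k (Reg.σ ⊠ Reg.σ)
    (.setReal RealReg.x (.arr RealArr.dist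
      (placeExpr Reg.i (Reg.k ⊘ Reg.σ) Reg.j (Reg.k ⊘ᵣ Reg.σ))) ;;
    .ite (.rle RealReg.x RealReg.farthest) .skip (.setReal RealReg.farthest RealReg.x))

theorem fold_max_eq_maxWeight {n σ : ℕ} (a : ℕ → ℝ) (v w : Fin n) :
    ((Finset.range (σ * σ)).fold max 0 fun p => a (place n σ v (p / σ) w (p % σ))) =
      maxWeight (entry (σ := σ) a) v w := by
  refine eq_of_forall_ge_iff fun c => ?_
  rw [Finset.fold_max_le, maxWeight_le_iff]
  refine and_congr_right fun _ => ⟨fun h k l => ?_, fun h p hp => ?_⟩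
  · have hσ : 0 < σ := k.pos
    have := h (k * σ + l) (Finset.mem_range.2 (mul_add_lt_mul k.isLt l.isLt))
    rwa [mul_comm (k : ℕ), Nat.mul_add_div hσ, Nat.mul_add_mod, Nat.div_eq_of_lt l.isLt,
      Nat.mod_eq_of_lt l.isLt, add_zero] at this
  · have hp : p < σ * σ := Finset.mem_range.1 hp
    have hσ : 0 < σ := Nat.pos_of_mul_pos_left (Nat.zero_lt_of_lt hp)
    exact h ⟨p / σ, Nat.div_lt_of_lt_mul hp⟩ ⟨p % σ, Nat.mod_lt _ hσ⟩

theorem runs_maxDistProg (hI : I.Loaded m) (hW : I.n * I.sigma * (I.n * I.sigma) ≤ W)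
    (hi : m.word Reg.i = i) (hj : m.word Reg.j = j) :
    Runs W maxDistProg m (60 * (I.sigma * I.sigma)) fun m' =>
      m'.real RealReg.farthest = maxWeight I.gap i j := by
  have hσ := I.sigma_pos
  have hσσ : I.sigma * I.sigma ≤ W := I.sigma_mul_sigma_le.trans hW
  have hnW : I.n ≤ W := I.n_le.trans hW
  have hσW : I.sigma ≤ W := (Nat.le_mul_self _).trans hσσ
  let a p := I.distArr (place I.n I.sigma i (p / I.sigma) j (p % I.sigma))
  refine (Runs.seq (t₁ := 2) (t₂ := 50 * (I.sigma * I.sigma * 1))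
    (R := fun m' => m'.real RealReg.farthest = 0)
    (.of_wp (by simp)) fun m₁ hF₁ h0 => ?_).mono_time (by nlinarith)
  have hI₁ := hI.of_frame hF₁
  have hσ₁ : WExpr.Yields W m₁ Reg.σ I.sigma := .reg hI₁.σ hσW
  refine (Runs.forLoop (fun k m' => m'.real RealReg.farthest = (Finset.range k).fold max 0 a)
    30 (I.sigma * I.sigma) 1 (by positivity) one_pos (hσ₁.mul hσ₁ hσσ) (by simpa using h0)
    fun k m' hk hF hkm hfold => ?_).mono le_rfl
    fun m' _ h => h.trans (fold_max_eq_maxWeight I.distArr i j)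
  have hI' := hI₁.of_frame hF
  have hk' : WExpr.Yields W m' Reg.k k := .reg hkm (by omega)
  have hσ' : WExpr.Yields W m' Reg.σ I.sigma := .reg hI'.σ hσW
  have hi' : WExpr.Yields W m' Reg.i i :=
    .reg (((hF.word Reg.i).trans (hF₁.word Reg.i)).trans hi) (by omega)
  have hj' : WExpr.Yields W m' Reg.j j :=
    .reg (((hF.word Reg.j).trans (hF₁.word Reg.j)).trans hj) (by omega)
  have hplace := hI'.yields_placeExpr hW hi' (hk'.div hσ') hj' (hk'.mod hσ') i.isLt
    (Nat.div_lt_of_lt_mul hk) j.isLt (Nat.mod_lt k hσ)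
  refine Runs.mono_time (.of_wp ?_) (by decide)
  simp +contextual [hplace.fits, hplace.eval, hfold, hI'.dist, Finset.range_add_one, a,
    max_eq_left_of_lt]

/-- The lengths found so far; a vertex to which no walk is known is marked in `reached`, as the
machine does not have infinite numbers. -/
def tentative {n : ℕ} (reached : ℕ → ℕ) (d : ℕ → ℝ) (v : Fin n) : WithTop ℝ :=
  if reached v = 0 then ⊤ else d v

theorem tentative_update {n : ℕ} (reached : ℕ → ℕ) (d : ℕ → ℝ) (v : Fin n) (x : ℝ) :
    tentative (n := n) (Function.update reached v 1) (Function.update d v x) =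
      Function.update (tentative reached d) v (x : WithTop ℝ) := by
  funext w
  rcases eq_or_ne w v with rfl | hw
  · simp [tentative]
  · simp [tentative, hw, Fin.val_ne_of_ne hw]

theorem update_tentative {n : ℕ} {reached : ℕ → ℕ} (d : ℕ → ℝ) {i j : Fin n} (x : ℝ)
    (hj : reached j ≠ 0) :
    Function.update (tentative reached d) i
        (min (tentative reached d i) (x + tentative reached d j)) =
      if 1 ≤ reached i ∧ d i ≤ x + d j then tentative reached d
      else tentative (Function.update reached i 1) (Function.update d i (x + d j)) := by
  have hbj : x + tentative reached d j = ((x + d j : ℝ) : WithTop ℝ) := by simp [tentative, hj]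
  rw [hbj]
  split_ifs with h
  · rw [Function.update_eq_self_iff, min_eq_left]
    simpa only [tentative, Nat.one_le_iff_ne_zero.1 h.1, if_false] using WithTop.coe_le_coe.2 h.2
  · rw [tentative_update, min_eq_right]
    by_cases hi : reached i = 0
    · simp [tentative, hi]
    · simpa only [tentative, hi, if_false] using WithTop.coe_le_coe.2
        (le_of_not_ge fun hle => h ⟨Nat.one_le_iff_ne_zero.2 hi, hle⟩)

def relaxProg : Program :=
  .ite (.and (.le (.const 1) (adjExpr Reg.i Reg.j)) (.le (.const 1) (.arr Arr.reached Reg.j)))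
    (maxDistProg ;;
     .setReal RealReg.x (.add RealReg.farthest (.arr RealArr.tentative Reg.j)) ;;
     .ite (.and (.le (.const 1) (.arr Arr.reached Reg.i))
         (.rle (.arr RealArr.tentative Reg.i) RealReg.x))
       .skip
       (.setWordArr Arr.reached Reg.i (.const 1) ;;
        .setRealArr RealArr.tentative Reg.i RealReg.x))
    .skip

open Classical in
theorem runs_relaxProg (hI : I.Loaded m) (hW : I.n * I.sigma * (I.n * I.sigma) ≤ W)
    (hi : m.word Reg.i = i) (hj : m.word Reg.j = j) (hreached : ∀ v, m.wordArr Arr.reached v ≤ 1) :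
    Runs W relaxProg m (100 * (I.sigma * I.sigma)) fun m' =>
      (∀ v, m'.wordArr Arr.reached v ≤ 1) ∧
        let b := tentative (m.wordArr Arr.reached) (m.realArr RealArr.tentative)
        tentative (m'.wordArr Arr.reached) (m'.realArr RealArr.tentative) =
          if I.G.Adj i j then Function.update b i (min (b i) (maxWeight I.gap i j + b j))
          else b := by
  have hσ := I.sigma_pos
  have hnW : I.n ≤ W := I.n_le.trans hW
  have hnnW : I.n * I.n ≤ W := I.n_mul_n_le.trans hW
  have hn := I.n_pos
  have hadj := hI.yields_adjExpr hnnW (a := i) (b := j) (.reg hi (by omega)) (.reg hj (by omega))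
  have hreachedW : ∀ v, m.wordArr 2 v ≤ W := fun v => (hreached v).trans (by omega)
  have hbranch : (Test.and (.le (.const 1) (adjExpr Reg.i Reg.j))
      (.le (.const 1) (.arr Arr.reached Reg.j))).Holds m ↔
      I.G.Adj i j ∧ m.wordArr Arr.reached j ≠ 0 := by
    simp [hadj.eval, hj, Nat.one_le_iff_ne_zero, ← I.adjArr_ne_zero_iff]
  refine (Runs.ite (t := 60 * (I.sigma * I.sigma) + 24) ?fits (fun hb => ?_) fun hb => ?_).mono_time
    (show 13 + (60 * (I.sigma * I.sigma) + 24) + 1 ≤ _ by nlinarith)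
  case fits =>
    simpa [hadj.fits, hj, hreachedW] using ⟨by omega, by omega⟩
  · obtain ⟨hij, hjr⟩ := hbranch.1 hb
    refine (runs_maxDistProg hI hW hi hj).seq fun m₁ hF hx => .mono_time (.of_wp ?_) (by decide)
    have hi₁ : m₁.word 6 = i := (hF.word Reg.i).trans hi
    have hj₁ : m₁.word 7 = j := (hF.word Reg.j).trans hj
    have hreached' : ∀ v, Function.update (m.wordArr 2) i 1 v ≤ 1 :=
      update_le_iff.2 ⟨le_rfl, fun v _ => hreached v⟩
    simpa [hi₁, hj₁, hx, hF.wordArr Arr.reached, hF.realArr RealArr.tentative, hij, hreachedW,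
      update_tentative _ _ hjr] using ⟨by omega, ⟨by omega, by omega⟩,
        fun hir hle => ⟨hreached, fun h => (h hir).not_ge hle |>.elim⟩,
        fun h => ⟨by omega, by omega, by omega, hreached',
          fun hir hle => ((h hir).not_ge hle).elim⟩⟩
  · rw [hbranch, not_and, not_not] at hb
    refine .mono_time (.of_wp ⟨hreached, ?_⟩) (by simp [Program.straightTime])
    split_ifs with hij
    · simp [tentative, hb hij]
    · rfl

/-- The memory `m` satisfies the invariant `Relaxed` of round `r + 1`. -/
abbrev RelaxedIn (I : Instance M) (r : ℕ) (done : Fin I.n → Fin I.n → Prop) (m : Store) : Prop :=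
  (∀ v, m.wordArr Arr.reached v ≤ 1) ∧ Relaxed I.G I.t (maxWeight I.gap)
    (tentative (m.wordArr Arr.reached) (m.realArr RealArr.tentative)) r done

theorem runs_relaxProg_of_relaxedIn {r : ℕ} {done done' : Fin I.n → Fin I.n → Prop}
    (hI : I.Loaded m) (hW : I.n * I.sigma * (I.n * I.sigma) ≤ W) (hi : m.word Reg.i = i)
    (hj : m.word Reg.j = j) (h : RelaxedIn I r done m)
    (hdone : ∀ v v', done' v v' → done v v' ∨ v = i ∧ v' = j) :
    Runs W relaxProg m (100 * (I.sigma * I.sigma)) (RelaxedIn I r done') := by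
  refine (runs_relaxProg hI hW hi hj h.1).mono le_rfl fun m' _ ⟨hreached, hb⟩ => ⟨hreached, ?_⟩
  rw [hb]
  split_ifs with hij
  · exact h.2.relax hij hdone
  · refine h.2.mono_done fun v v' hadj hd => (hdone v v' hd).resolve_right ?_
    rintro ⟨rfl, rfl⟩
    exact hij hadj

def roundProg : Program :=
  .forLoop Reg.i Reg.n (.forLoop Reg.j Reg.n relaxProg)

theorem runs_roundProg {r : ℕ} (hI : I.Loaded m) (hW : I.n * I.sigma * (I.n * I.sigma) ≤ W)
    (h : RelaxedIn I r (fun _ _ => False) m) :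
    Runs W roundProg m (132 * (I.n * (I.n * (I.sigma * I.sigma))))
      (RelaxedIn I (r + 1) fun _ _ => False) := by
  have hσ := I.sigma_pos
  have hn := I.n_pos
  have hnW : I.n ≤ W := I.n_le.trans hW
  refine (Runs.forLoop (fun i => RelaxedIn I r fun v _ => (v : ℕ) < i) 116 I.n
    (I.n * (I.sigma * I.sigma)) hn (by positivity) (.reg hI.n hnW) (by simpa using h)
    fun i m₁ hi hF₁ hi₁ h₁ => ?_).mono le_rfl fun m' _ h' => ⟨h'.1, h'.2.next fun v _ _ => v.isLt⟩
  have hI₁ := hI.of_frame hF₁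
  refine (Runs.forLoop (fun j => RelaxedIn I r fun v v' => (v : ℕ) < i ∨ (v : ℕ) = i ∧ (v' : ℕ) < j)
    100 I.n (I.sigma * I.sigma) hn (by positivity) (.reg hI₁.n hnW) (by simpa using h₁)
    fun j m₂ hj hF₂ hj₂ h₂ => ?_).mono le_rfl fun m' _ h' => ?_
  · exact runs_relaxProg_of_relaxedIn (i := ⟨i, hi⟩) (j := ⟨j, hj⟩) (hI₁.of_frame hF₂) hW
      ((hF₂.word Reg.i).trans hi₁) hj₂ h₂ fun v v' hd => by simp only [Fin.ext_iff]; omega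
  · exact ⟨h'.1, h'.2.mono_done fun v v' _ hv => (Nat.lt_succ_iff_lt_or_eq.1 hv).imp_right
      fun h => ⟨h, v'.isLt⟩⟩

/-- The algorithm of Bellman and Ford, which finds the number `D` of `Instance.IsEstimate`. -/
def shortestProg : Program :=
  (.setWordArr Arr.reached Reg.t (.const 1) ;; .setRealArr RealArr.tentative Reg.t .zero) ;;
  .forLoop Reg.l Reg.n roundProg ;;
  .setReal RealReg.unit (.arr RealArr.tentative Reg.s)

theorem runs_shortestProg (hI : I.Loaded m) (hW : I.n * I.sigma * (I.n * I.sigma) ≤ W)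
    (hreached : m.wordArr Arr.reached = 0) (hst : I.G.Reachable I.s I.t) :
    Runs W shortestProg m (160 * (I.n * (I.n * (I.n * (I.sigma * I.sigma)))))
      fun m' => I.IsEstimate (m'.real RealReg.unit) := by
  have hσ := I.sigma_pos
  have hn := I.n_pos
  have hnW : I.n ≤ W := I.n_le.trans hW
  have htime : 0 < I.n * (I.n * (I.n * (I.sigma * I.sigma))) := by positivity
  have init : Runs W (.setWordArr Arr.reached Reg.t (.const 1) ;;
      .setRealArr RealArr.tentative Reg.t .zero) m 6 (RelaxedIn I 0 fun _ _ => False) := by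
    have hempty : tentative (n := I.n) (0 : ℕ → ℕ) (m.realArr 1) = fun _ => ⊤ := by
      funext v
      simp [tentative]
    have hreached' : ∀ v, Function.update (0 : ℕ → ℕ) I.t 1 v ≤ 1 :=
      update_le_iff.2 ⟨le_rfl, fun _ _ => zero_le_one⟩
    refine .of_wp ?_
    simpa [RelaxedIn, hI.t, hreached, tentative_update, hempty] using
      ⟨by omega, by omega, by omega, hreached', Relaxed.init⟩
  refine (init.seq fun m₁ hF₁ h₁ => Runs.seq (Runs.forLoop
    (fun r => RelaxedIn I r fun _ _ => False) 132 I.n _ hn (by positivity)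
    (.reg (hI.of_frame hF₁).n hnW) h₁ fun r m₂ _ hF₂ _ h₂ =>
      runs_roundProg ((hI.of_frame hF₁).of_frame hF₂) hW h₂)
    fun m₂ hF₂ h₂ => Runs.mono_time (t₁ := 3) (.of_wp ?_) le_rfl).mono_time
    (show 6 + (148 * _ + 3) ≤ _ by omega)
  have hs : m₂.word 1 = I.s := ((hI.of_frame hF₁).of_frame hF₂).s
  obtain ⟨D, hD, hleast⟩ := h₂.2.exists_isLeast (Fintype.card_fin _).le maxWeight_nonneg hst
  have hDs : m₂.realArr 1 I.s = D := by
    rw [tentative] at hD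
    split_ifs at hD with h0
    · exact (WithTop.coe_ne_top hD.symm).elim
    · exact WithTop.coe_injective hD
  simpa [hs, hDs] using ⟨by omega, hleast⟩

end ShortestPath

section Rounding

variable {W N p : ℕ} {D x : ℝ} {m : Store}

def scaleProg : Program :=
  .setReal RealReg.x .zero ;;
  .forLoop Reg.k Reg.levels
    (.setReal RealReg.x (.add RealReg.x (.arr RealArr.dist Reg.i)))

theorem runs_scaleProg (hi : m.word Reg.i = p) (hlevels : m.word Reg.levels = N)
    (hdist : m.realArr RealArr.dist p = x) (hN : 0 < N) (hNW : N ≤ W) (hp : p ≤ W) :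
    Runs W scaleProg m (23 * N) fun m' => m'.real RealReg.x = N * x := by
  refine (Runs.seq (t₁ := 2) (t₂ := 21 * (N * 1)) (R := fun m' => m'.real RealReg.x = 0)
    (.of_wp (by simp)) fun m₁ hF₁ h0 => ?_).mono_time (by linarith)
  refine Runs.forLoop (fun k m' => m'.real RealReg.x = k * x) 5 N 1 hN one_pos
    (.reg ((hF₁.word Reg.levels).trans hlevels) hNW) (by simpa using h0)
    fun k m' _ hF _ hx => Runs.mono_time (.of_wp ?_) le_rfl
  have hi' : m'.word 6 = p := by rw [hF.word Reg.i, hF₁.word Reg.i, hi]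
  have hdist' : m'.realArr 0 p = x := by
    rw [hF.realArr RealArr.dist, hF₁.realArr RealArr.dist, hdist]
  simp [hi', hdist', hx, hp, add_mul]

def countUnitsProg : Program :=
  (Reg.k ≔ .const 0 ;; .setReal RealReg.y RealReg.unit) ;;
  .loop (.and (.le Reg.k Reg.levels)
      (.and (.rle RealReg.y RealReg.x) (.not (.rle RealReg.x .zero))))
    (Reg.k ≔ Reg.k ⊞ .const 1 ;; .setReal RealReg.y (.add RealReg.y RealReg.unit))

theorem runs_countUnitsProg (hlevels : m.word Reg.levels = N) (hunit : m.real RealReg.unit = D)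
    (hNx : m.real RealReg.x = N * x) (hx : 0 ≤ x) (hD : 0 ≤ D) (hNW : N + 1 ≤ W) :
    Runs W countUnitsProg m (38 * (N + 1)) fun m' => Rounded D N x (m'.word Reg.k) := by
  have hNx₀ : 0 ≤ N * x := mul_nonneg N.cast_nonneg hx
  refine (Runs.seq (t₁ := 4) (t₂ := (N + 1) * (12 + 8 + 1) + (12 + 1))
    (R := fun m' => m'.word Reg.k = 0 ∧ m'.real RealReg.y = D) (.of_wp (by simp [hunit]))
    fun m₁ hF₁ ⟨hk₁, hy₁⟩ => ?loop).mono_time (by omega)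
  have test_iff : ∀ {k : ℕ} {m'}, Frame countUnitsProg m m' → m'.word Reg.k = k →
      m'.real RealReg.y = D * (k + 1) →
      ((Test.and (.le Reg.k Reg.levels)
        (.and (.rle RealReg.y RealReg.x) (.not (.rle RealReg.x .zero)))).Holds m' ↔
        k ≤ N ∧ D * (k + 1) ≤ N * x ∧ 0 < N * x) := fun {k m'} hF hk hy => by
    have hlevels' : m'.word 4 = N := (hF.word Reg.levels).trans hlevels
    have hx' : m'.real 1 = N * x := (hF.real RealReg.x).trans hNx
    simp only [Test.Holds, WExpr.eval, RExpr.eval, hk, hy, hlevels', hx', not_le]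
  refine (Runs.loop (fun k m' => m'.word Reg.k = k ∧ m'.real RealReg.y = D * (k + 1) ∧
      D * k ≤ N * x ∧ (x = 0 → k = 0)) (N + 1) 8 (by simp [hk₁, hy₁, hNx₀]) ?fits
    fun k m' _ hF ⟨hk, hy, _, _⟩ hb => ?step).mono le_rfl ?exit
  case fits =>
    rintro k m' hkN hF ⟨hk, -⟩
    have hlevels' : m'.word 4 = N := by rw [hF.word Reg.levels, hF₁.word Reg.levels, hlevels]
    simpa [hk, hlevels'] using ⟨by omega, by omega⟩
  case step =>
    have hF' : Frame countUnitsProg m m' := hF₁.seq_left.trans hF.seq_right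
    have hunit' : m'.real 4 = D := (hF'.real RealReg.unit).trans hunit
    obtain ⟨hkN, hle, hpos⟩ := (test_iff hF' hk hy).1 hb
    refine ⟨by omega, .of_wp ?_⟩
    simpa [hk, hy, hunit'] using
      ⟨⟨by omega, by omega⟩, by ring, hle, (pos_of_mul_pos_right hpos N.cast_nonneg).ne'⟩
  case exit =>
    rintro m' hF ⟨k, hk', ⟨hk, hy, hlower, hzero⟩, hb⟩
    rw [test_iff (hF₁.seq_left.trans hF.seq_right) hk hy] at hb
    rw [hk]
    refine ⟨hlower, fun hkN => ?_, hzero, hk'⟩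
    by_contra! hlt
    exact hb ⟨hkN, hlt.le, lt_of_le_of_lt (by positivity) hlt⟩

def roundEntryProg : Program :=
  scaleProg ;; countUnitsProg ;; .setWordArr Arr.table Reg.i Reg.k

theorem runs_roundEntryProg (hi : m.word Reg.i = p) (hlevels : m.word Reg.levels = N)
    (hunit : m.real RealReg.unit = D) (hdist : m.realArr RealArr.dist p = x) (hx : 0 ≤ x)
    (hD : 0 ≤ D) (hN : 0 < N) (hNW : N + 1 ≤ W) (hp : p ≤ W) :
    Runs W roundEntryProg m (64 * (N + 1)) fun m' => ∃ k, Rounded D N x k ∧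
      m'.wordArr Arr.table = Function.update (m.wordArr Arr.table) p k := by
  refine ((runs_scaleProg hi hlevels hdist hN (by omega) hp).seq fun m₁ hF₁ hx₁ =>
    (runs_countUnitsProg ((hF₁.word Reg.levels).trans hlevels)
      ((hF₁.real RealReg.unit).trans hunit) hx₁ hx hD hNW).seq (t₂ := 3)
      fun m₂ hF₂ hk => .of_wp ?_).mono_time (by omega)
  have hi₂ : m₂.word 6 = p := by rw [hF₂.word Reg.i, hF₁.word Reg.i, hi]
  have htable : m₂.wordArr 3 = m.wordArr 3 := by
    rw [hF₂.wordArr Arr.table, hF₁.wordArr Arr.table]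
  have hkN : m₂.word 8 ≤ N + 1 := hk.le
  simpa [hi₂, htable] using ⟨hp, by omega, _, hk, rfl⟩

def roundDistProg : Program :=
  .forLoop Reg.i ((Reg.n ⊠ Reg.σ) ⊠ (Reg.n ⊠ Reg.σ)) roundEntryProg

theorem runs_roundDistProg {M : Type*} [MetricSpace M] {I : Instance M} (hI : I.Loaded m)
    (hlevels : m.word Reg.levels = N) (hunit : m.real RealReg.unit = D) (hD : 0 ≤ D) (hN : 0 < N)
    (hW : I.n * I.sigma * (I.n * I.sigma) ≤ W) (hNW : N + 1 ≤ W) :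
    Runs W roundDistProg m (92 * (I.n * I.sigma * (I.n * I.sigma) * (N + 1))) fun m' =>
      ∀ v k w l, Rounded D N (I.gap v k w l) (entry (m'.wordArr Arr.table) v k w l) := by
  have hn := I.n_pos
  have hσ := I.sigma_pos
  have hnσ : I.n * I.sigma ≤ W := (Nat.le_mul_self _).trans hW
  have hyields := (WExpr.Yields.reg hI.n (I.n_le.trans hW)).mul
    (.reg hI.σ ((Nat.le_mul_of_pos_left _ hn).trans hnσ)) hnσ
  refine (Runs.forLoop (fun p m' => ∀ q < p, Rounded D N (I.distArr q) (m'.wordArr Arr.table q))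
    64 _ (N + 1) (by positivity) N.succ_pos (hyields.mul hyields hW) (by simp)
    fun p m' hp hF hpm hround => ?_).mono le_rfl
    fun m' _ h v k w l => h _ (place_lt v.isLt k.isLt w.isLt l.isLt)
  refine (runs_roundEntryProg hpm ((hF.word Reg.levels).trans hlevels)
    ((hF.real RealReg.unit).trans hunit) (congrFun (hI.of_frame hF).dist p) (I.distArr_nonneg p) hD
    hN hNW (by omega)).mono le_rfl fun m'' _ ⟨k, hk, htable⟩ q hq => ?_
  rw [htable]
  rcases Nat.lt_succ_iff_lt_or_eq.1 hq with hq | rfl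
  · rw [Function.update_of_ne hq.ne]
    exact hround q hq
  · rwa [Function.update_self]

end Rounding

/-- Words of size `W` suffice for costs up to `2 * N + 1` and for the codes of all states. -/
structure Instance.WordSize {M : Type*} [MetricSpace M] (I : Instance M) (N W : ℕ) : Prop where
  places : I.n * I.sigma * (I.n * I.sigma) ≤ W
  codes : I.n * (N + 1) ^ I.sigma ≤ W
  costs : 2 * (N + 1) ≤ W

/-- The part of the memory that is constant during the search. -/
abbrev searchLocs : List Loc :=
  [.word Reg.levels, .word Reg.codes, .wordArr Arr.power, .wordArr Arr.table] ++ instanceLocs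

/-- The memory `m` contains what the dynamic program needs: the instance `I`, the number of levels
`N`, the rounded distances `r`, and the powers of `N + 1`. -/
structure Instance.Prepared {M : Type*} [MetricSpace M] (I : Instance M) (N : ℕ)
    (r : Fin I.n → Fin I.sigma → Fin I.n → Fin I.sigma → ℕ) (m : Store) : Prop
    extends I.Loaded m where
  levels : m.word Reg.levels = N
  codes : m.word Reg.codes = (N + 1) ^ I.sigma
  power : ∀ l < I.sigma, m.wordArr Arr.power l = (N + 1) ^ l
  table : entry (m.wordArr Arr.table) = r

section Encode

variable {M : Type*} [MetricSpace M] {I : Instance M} {N W : ℕ} {m m' : Store}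
  {r : Fin I.n → Fin I.sigma → Fin I.n → Fin I.sigma → ℕ}

theorem Instance.WordSize.pow_le (hW : I.WordSize N W) {l : ℕ} (hl : l ≤ I.sigma) :
    (N + 1) ^ l ≤ W :=
  (Nat.pow_le_pow_right N.succ_pos hl).trans
    ((Nat.le_mul_of_pos_left _ I.n_pos).trans hW.codes)

theorem Instance.WordSize.sigma_le (hW : I.WordSize N W) : I.sigma ≤ W :=
  (Nat.le_mul_self _).trans (I.sigma_mul_sigma_le.trans hW.places)

theorem Instance.Prepared.of_frame {p : Program} (h : I.Prepared N r m) (hF : Frame p m m')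
    (hp : ∀ l ∈ searchLocs, l ∉ p.writes := by decide) : I.Prepared N r m' where
  toLoaded := h.toLoaded.of_frame hF fun l hl => hp l (List.mem_append_right _ hl)
  levels := (hF.word _ (hp _ (by decide))).trans h.levels
  codes := (hF.word _ (hp _ (by decide))).trans h.codes
  power l hl := (congrFun (hF.wordArr _ (hp _ (by decide))) l).trans (h.power l hl)
  table := (congrArg entry (hF.wordArr _ (hp _ (by decide)))).trans h.table

def powersProg : Program :=
  Reg.codes ≔ .const 1 ;;
  .forLoop Reg.l Reg.σ
    (.setWordArr Arr.power Reg.l Reg.codes ;; Reg.codes ≔ Reg.codes ⊠ (Reg.levels ⊞ .const 1))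

theorem runs_powersProg (hI : I.Loaded m) (hlevels : m.word Reg.levels = N)
    (hW : I.WordSize N W) :
    Runs W powersProg m (27 * I.sigma) fun m' =>
      m'.word Reg.codes = (N + 1) ^ I.sigma ∧
        ∀ l < I.sigma, m'.wordArr Arr.power l = (N + 1) ^ l := by
  have hσ := I.sigma_pos
  have hσW := hW.sigma_le
  have hNW := hW.costs
  refine (Runs.seq (t₁ := 2) (t₂ := 25 * (I.sigma * 1)) (R := fun m' => m'.word Reg.codes = 1)
    (.of_wp (by simpa using (by omega))) fun m₁ hF₁ h₁ => ?_).mono_time (by omega)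
  refine Runs.forLoop (fun l m' => m'.word Reg.codes = (N + 1) ^ l ∧
    ∀ k < l, m'.wordArr Arr.power k = (N + 1) ^ k) 9 I.sigma 1 hσ one_pos
    (.reg (hI.of_frame hF₁).σ hσW) (by simpa using h₁)
    fun l m' hl hF hlm ⟨hcodes, hpower⟩ => Runs.mono_time (.of_wp ?_) le_rfl
  have hlevels' : m'.word 4 = N := by rw [hF.word Reg.levels, hF₁.word Reg.levels, hlevels]
  have hpow := hW.pow_le hl.le
  have hpow' := hW.pow_le hl
  have hpower' : ∀ k ≤ l,
      Function.update (m'.wordArr 8) l ((N + 1) ^ l) k = (N + 1) ^ k := fun k hk => by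
    rcases hk.lt_or_eq with hk | rfl
    · rw [Function.update_of_ne hk.ne, hpower k hk]
    · rw [Function.update_self]
  simpa [hlm, hcodes, hlevels', hpow, ← pow_succ] using
    ⟨by omega, ⟨⟨by omega, by omega, by omega⟩, hpow'⟩, hpower'⟩

/-- The expression for the `k`-th cost of the state at the head of the queue. -/
def digitExpr (k : WExpr) : WExpr :=
  .arr Arr.queue Reg.head ⊘ .arr Arr.power k ⊘ᵣ (Reg.levels ⊞ .const 1)

theorem Instance.Prepared.yields_digitExpr (hm : I.Prepared N r m) (hW : I.WordSize N W)
    {x : Fin I.n × (Fin I.sigma → ℕ)} (hx : ∀ k, x.2 k ≤ N)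
    (hhead : WExpr.Yields W m (.arr Arr.queue Reg.head) (code (N + 1) x)) {k : WExpr}
    {a : Fin I.sigma} (hk : k.Yields W m a) : (digitExpr k).Yields W m (x.2 a) := by
  have hNW := hW.costs
  have one : WExpr.Yields W m (.const 1) 1 := ⟨show 1 ≤ W by omega, rfl⟩
  rw [← code_digit (fun k => Nat.lt_succ_of_le (hx k)) a]
  exact (hhead.div (hk.arr (hm.power a a.isLt) (hW.pow_le a.isLt.le))).mod
    ((WExpr.Yields.reg hm.levels (by omega)).add one (by omega))

theorem sup_range_eq_sup_univ {n : ℕ} {f : ℕ → ℕ} {g : Fin n → ℕ} (h : ∀ k : Fin n, f k = g k) :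
    (Finset.range n).sup f = Finset.univ.sup g := by
  rw [← Nat.Iio_eq_range, ← Fin.map_valEmbedding_univ, Finset.sup_map]
  exact congrArg _ (funext h)

def valueProg : Program :=
  .maxLoop Reg.value Reg.k Reg.σ
    (.arr Arr.table (placeExpr Reg.j Reg.l Reg.i Reg.k) ⊞ digitExpr Reg.k)

theorem runs_valueProg (hm : I.Prepared N r m) (hW : I.WordSize N W)
    (hr : ∀ v k w l, r v k w l ≤ N + 1) {x : Fin I.n × (Fin I.sigma → ℕ)} (hx : ∀ k, x.2 k ≤ N)
    {w : Fin I.n} {l : Fin I.sigma} (hheadW : m.word Reg.head ≤ W)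
    (hhead : m.wordArr Arr.queue (m.word Reg.head) = code (N + 1) x)
    (hi : m.word Reg.i = x.1) (hj : m.word Reg.j = w) (hl : m.word Reg.l = l) :
    Runs W valueProg m (74 * I.sigma) fun m' =>
      m'.word Reg.value = extendValue r x.1 x.2 w l := by
  have hnW := I.n_le.trans hW.places
  have hσW := hW.sigma_le
  have hNW := hW.costs
  have hcode : code (N + 1) x ≤ W :=
    (code_lt fun k => Nat.lt_succ_of_le (hx k)).le.trans hW.codes
  let f k := if h : k < I.sigma then r w l x.1 ⟨k, h⟩ + x.2 ⟨k, h⟩ else 0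
  refine (Runs.maxLoop f I.sigma_pos (.reg hm.σ hσW) fun k m' hk hF hkm => ?_).mono le_rfl
    fun m' _ h => h.trans (sup_range_eq_sup_univ fun k => by simp [f])
  have hm' := hm.of_frame hF
  have hk' : WExpr.Yields W m' Reg.k k := .reg hkm (by omega)
  have hhead' : WExpr.Yields W m' (.arr Arr.queue Reg.head) (code (N + 1) x) :=
    (WExpr.Yields.reg (hF.word Reg.head) hheadW).arr (by rw [hF.wordArr Arr.queue, hhead]) hcode
  have hplace := hm'.yields_placeExpr hW.places (.reg ((hF.word Reg.j).trans hj) (by omega))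
    (.reg ((hF.word Reg.l).trans hl) (by omega)) (.reg ((hF.word Reg.i).trans hi) (by omega)) hk'
    w.isLt l.isLt x.1.isLt hk
  have htable : m'.wordArr Arr.table (place I.n I.sigma w l x.1 k) = r w l x.1 ⟨k, hk⟩ := by
    rw [← hm'.table]
    rfl
  have hr' := hr w l x.1 ⟨k, hk⟩
  have hxk := hx ⟨k, hk⟩
  simp only [f, dif_pos hk]
  exact (hplace.arr htable (by omega)).add (hm'.yields_digitExpr hW hx hhead' (a := ⟨k, hk⟩) hk')
    (by omega)

/-- The values at places below `l`, with `0` for the values above `N`. -/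
def truncate {σ : ℕ} (N : ℕ) (g : Fin σ → ℕ) (l : ℕ) (k : Fin σ) : ℕ :=
  if (k : ℕ) < l ∧ g k ≤ N then g k else 0

theorem truncate_le {σ : ℕ} (g : Fin σ → ℕ) (l : ℕ) (k : Fin σ) : truncate N g l k ≤ N := by
  unfold truncate
  split_ifs with h
  · exact h.2
  · exact N.zero_le

theorem truncate_zero {σ : ℕ} (g : Fin σ → ℕ) : truncate N g 0 = 0 := by
  funext k
  simp [truncate]

theorem truncate_eq_self {σ : ℕ} {g : Fin σ → ℕ} (hg : ∀ k, g k ≤ N) : truncate N g σ = g := by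
  funext k
  simp [truncate, hg]

theorem truncate_succ {σ : ℕ} (g : Fin σ → ℕ) (l : Fin σ) :
    truncate N g (l + 1) = truncate N g l + Pi.single l (if g l ≤ N then g l else 0) := by
  funext k
  rcases eq_or_ne k l with rfl | hk
  · simp [truncate]
  · have : (k : ℕ) < l + 1 ↔ (k : ℕ) < l := by
      have := Fin.val_ne_of_ne hk
      omega
    simp [truncate, hk, this]

theorem extendValue_le (hr : ∀ v k w l, r v k w l ≤ N + 1)
    {x : Fin I.n × (Fin I.sigma → ℕ)} (hx : ∀ k, x.2 k ≤ N) {w : Fin I.n} {l : Fin I.sigma} :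
    extendValue r x.1 x.2 w l ≤ 2 * (N + 1) :=
  Finset.sup_le fun k _ => by linarith [hr w l x.1 k, hx k]

def encodeDigitProg : Program :=
  valueProg ;;
  .ite (.le Reg.value Reg.levels)
    (Reg.code ≔ Reg.code ⊞ Reg.value ⊠ .arr Arr.power Reg.l)
    (Reg.ok ≔ .const 0)

theorem runs_encodeDigitProg (hm : I.Prepared N r m) (hW : I.WordSize N W)
    (hr : ∀ v k w l, r v k w l ≤ N + 1) {x : Fin I.n × (Fin I.sigma → ℕ)} (hx : ∀ k, x.2 k ≤ N)
    {w : Fin I.n} {l : Fin I.sigma} {g : ℕ} (hg : extendValue r x.1 x.2 w l = g)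
    (hheadW : m.word Reg.head ≤ W)
    (hhead : m.wordArr Arr.queue (m.word Reg.head) = code (N + 1) x)
    (hi : m.word Reg.i = x.1) (hj : m.word Reg.j = w) (hl : m.word Reg.l = l)
    (hcodeW : g ≤ N → m.word Reg.code + g * (N + 1) ^ (l : ℕ) ≤ W) :
    Runs W encodeDigitProg m (85 * I.sigma) fun m' =>
      m'.word Reg.ok = (if g ≤ N then m.word Reg.ok else 0) ∧
      m'.word Reg.code = m.word Reg.code + if g ≤ N then g * (N + 1) ^ (l : ℕ) else 0 := by
  have hσ := I.sigma_pos
  have hσW := hW.sigma_le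
  have hNW := hW.costs
  have hgW : g ≤ W := hg ▸ (extendValue_le hr hx).trans hNW
  refine ((runs_valueProg hm hW hr hx hheadW hhead hi hj hl).seq (t₂ := 11)
    fun m₁ hF hvalue => .of_wp ?_).mono_time (by omega)
  have hm₁ := hm.of_frame hF
  have hok : m₁.word 12 = m.word 12 := hF.word Reg.ok
  have hcode : m₁.word 11 = m.word 11 := hF.word Reg.code
  have hlevels : m₁.word 4 = N := hm₁.levels
  have hl₁ : m₁.word 9 = l := (hF.word Reg.l).trans hl
  have hpower : m₁.wordArr 8 l = (N + 1) ^ (l : ℕ) := hm₁.power l l.isLt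
  have hvalue : m₁.word 10 = g := hvalue.trans hg
  by_cases hgN : g ≤ N
  · have hsum : m.word 11 + g * (N + 1) ^ (l : ℕ) ≤ W := hcodeW hgN
    simpa [hvalue, hlevels, hok, hcode, hl₁, hpower, hgN] using
      ⟨⟨by omega, by omega⟩, by omega, ⟨by omega, ⟨by omega, hW.pow_le l.isLt.le⟩, by omega⟩,
        hsum⟩
  · simpa [hvalue, hlevels, hok, hcode, hl₁, hpower, hgN] using ⟨by omega, by omega⟩

/-- The register `ok` remains `1` unless a cost of the new state exceeds `N`; the code is meaningful
only in the first case. -/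
def encodeProg : Program :=
  (Reg.code ≔ Reg.j ⊠ Reg.codes ;; Reg.ok ≔ .const 1) ;; .forLoop Reg.l Reg.σ encodeDigitProg

theorem runs_encodeProg (hm : I.Prepared N r m) (hW : I.WordSize N W)
    (hr : ∀ v k w l, r v k w l ≤ N + 1) {x : Fin I.n × (Fin I.sigma → ℕ)} (hx : ∀ k, x.2 k ≤ N)
    {w : Fin I.n} (hheadW : m.word Reg.head ≤ W)
    (hhead : m.wordArr Arr.queue (m.word Reg.head) = code (N + 1) x)
    (hi : m.word Reg.i = x.1) (hj : m.word Reg.j = w) :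
    Runs W encodeProg m (107 * (I.sigma * I.sigma)) fun m' =>
      m'.word Reg.ok ≤ 1 ∧ m'.word Reg.code ≤ W ∧
      (m'.word Reg.ok ≠ 0 ↔ ∀ l, extendValue r x.1 x.2 w l ≤ N) ∧
      (m'.word Reg.ok ≠ 0 → m'.word Reg.code = code (N + 1) (w, extendValue r x.1 x.2 w)) := by
  have hσ := I.sigma_pos
  have hσW := hW.sigma_le
  have hNW := hW.costs
  have hnW := I.n_le.trans hW.places
  have hwW : w * (N + 1) ^ I.sigma ≤ W := (Nat.mul_le_mul_right _ w.isLt.le).trans hW.codes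
  let g := extendValue r x.1 x.2 w
  have hcodeW : ∀ l, code (N + 1) (w, truncate N g l) ≤ W := fun l =>
    (code_lt fun k => Nat.lt_succ_of_le (truncate_le g l k)).le.trans hW.codes
  refine (Runs.seq (t₁ := 6) (t₂ := 101 * (I.sigma * I.sigma))
    (R := fun m' => m'.word Reg.code = w * (N + 1) ^ I.sigma ∧ m'.word Reg.ok = 1)
    (.of_wp (by simpa [hj, hm.codes] using ⟨⟨by omega, hW.pow_le le_rfl, hwW⟩, by omega⟩))
    fun m₁ hF₁ ⟨hcode₁, hok₁⟩ => ?_).mono_time (by nlinarith)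
  refine (Runs.forLoop (fun l m' => m'.word Reg.ok ≤ 1 ∧
    (m'.word Reg.ok ≠ 0 ↔ ∀ k : Fin I.sigma, (k : ℕ) < l → g k ≤ N) ∧
    m'.word Reg.code = code (N + 1) (w, truncate N g l)) 85 I.sigma I.sigma hσ hσ
    (.reg (hm.of_frame hF₁).σ hσW) (by simp [hok₁, hcode₁, truncate_zero, code_zero])
    fun l m₂ hl hF₂ hlm ⟨hok, hiff, hcode⟩ => ?step).mono le_rfl
    fun m' _ ⟨hok, hiff, hcode⟩ => ⟨hok, hcode ▸ hcodeW _, by simpa using hiff, fun h => by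
      rw [hcode, truncate_eq_self fun k => hiff.1 h k k.isLt]⟩
  have hF : Frame encodeProg m m₂ := hF₁.seq_left.trans hF₂.seq_right
  have hsucc : code (N + 1) (w, truncate N g (l + 1)) = code (N + 1) (w, truncate N g l) +
      (if g ⟨l, hl⟩ ≤ N then g ⟨l, hl⟩ else 0) * (N + 1) ^ l := by
    rw [truncate_succ g ⟨l, hl⟩]
    exact code_add_single (w, truncate N g l) _ _
  have hcodeW' : g ⟨l, hl⟩ ≤ N → m₂.word Reg.code + g ⟨l, hl⟩ * (N + 1) ^ l ≤ W := fun hg => by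
    simpa [hcode, hsucc, hg] using hcodeW (l + 1)
  refine (runs_encodeDigitProg ((hm.of_frame hF₁).of_frame hF₂) hW hr hx (l := ⟨l, hl⟩) rfl
    ((hF.word Reg.head).trans_le hheadW)
    (by rw [hF.wordArr Arr.queue, hF.word Reg.head, hhead]) ((hF.word Reg.i).trans hi)
    ((hF.word Reg.j).trans hj) hlm hcodeW').mono le_rfl fun m' _ ⟨hok', hcode'⟩ => ?_
  have hall : (∀ k : Fin I.sigma, (k : ℕ) < l + 1 → g k ≤ N) ↔
      g ⟨l, hl⟩ ≤ N ∧ ∀ k : Fin I.sigma, (k : ℕ) < l → g k ≤ N :=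
    ⟨fun h => ⟨h ⟨l, hl⟩ l.lt_succ_self, fun k hk => h k (hk.trans l.lt_succ_self)⟩,
      fun h k hk => (Nat.lt_succ_iff_lt_or_eq.1 hk).elim (h.2 k) fun hk =>
        (Fin.ext hk : k = ⟨l, hl⟩) ▸ h.1⟩
  rw [hok', hcode', hall, hsucc, hcode]
  split_ifs with hg
  · exact ⟨hok, by rw [hiff]; tauto, rfl⟩
  · exact ⟨zero_le_one, by tauto, by simp⟩

end Encode

/-- The memory `m` contains a search through the codes of the states. -/
abbrev Instance.Searching {M : Type*} [MetricSpace M] (I : Instance M) (N : ℕ)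
    (r : Fin I.n → Fin I.sigma → Fin I.n → Fin I.sigma → ℕ) (done : ℕ → Prop) (m : Store) : Prop :=
  Search (CodeStep I.G r N) (code (N + 1) (I.t, (0 : Fin I.sigma → ℕ))) (m.wordArr Arr.seen)
    (m.wordArr Arr.queue) (m.wordArr Arr.parent) (m.word Reg.size) (m.word Reg.head) done

/-- The memory `m` contains a complete search through the codes of the states. -/
abbrev Instance.Explored {M : Type*} [MetricSpace M] (I : Instance M) (N : ℕ)
    (r : Fin I.n → Fin I.sigma → Fin I.n → Fin I.sigma → ℕ) (m : Store) : Prop :=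
  Search (CodeStep I.G r N) (code (N + 1) (I.t, (0 : Fin I.sigma → ℕ))) (m.wordArr Arr.seen)
    (m.wordArr Arr.queue) (m.wordArr Arr.parent) (m.word Reg.size) (m.word Reg.size) fun _ => False

/-- The memory `m` contains a search that has reached the state `x` and has already found the
successors of `x` at the vertices below `j`. -/
structure Instance.Expanding {M : Type*} [MetricSpace M] (I : Instance M) (N : ℕ)
    (r : Fin I.n → Fin I.sigma → Fin I.n → Fin I.sigma → ℕ) (x : Fin I.n × (Fin I.sigma → ℕ))
    (j : ℕ) (m : Store) : Prop where
  searching : I.Searching N r (fun c => c / (N + 1) ^ I.sigma < j) m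
  head_lt : m.word Reg.head < m.word Reg.size
  head_eq : m.wordArr Arr.queue (m.word Reg.head) = code (N + 1) x

/-- The part of the memory that contains the search. -/
abbrev queueLocs : List Loc :=
  [.wordArr Arr.seen, .wordArr Arr.queue, .wordArr Arr.parent, .word Reg.size, .word Reg.head]

section Searching

variable {M : Type*} [MetricSpace M] {I : Instance M} {N W : ℕ} {m m' : Store}
  {r : Fin I.n → Fin I.sigma → Fin I.n → Fin I.sigma → ℕ} {done : ℕ → Prop}
  {x : Fin I.n × (Fin I.sigma → ℕ)} {w : Fin I.n}

theorem Instance.Searching.of_frame {p : Program} (h : I.Searching N r done m)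
    (hF : Frame p m m') (hp : ∀ l ∈ queueLocs, l ∉ p.writes := by decide) :
    I.Searching N r done m' := by
  rwa [Instance.Searching, hF.wordArr _ (hp (.wordArr Arr.seen) (by decide)),
    hF.wordArr _ (hp (.wordArr Arr.queue) (by decide)),
    hF.wordArr _ (hp (.wordArr Arr.parent) (by decide)),
    hF.word _ (hp (.word Reg.size) (by decide)), hF.word _ (hp (.word Reg.head) (by decide))]

theorem Instance.Expanding.of_frame {p : Program} {j : ℕ} (h : I.Expanding N r x j m)
    (hF : Frame p m m') (hp : ∀ l ∈ queueLocs, l ∉ p.writes := by decide) :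
    I.Expanding N r x j m' where
  searching := h.searching.of_frame hF hp
  head_lt := by
    rw [hF.word _ (hp (.word Reg.size) (by decide)), hF.word _ (hp (.word Reg.head) (by decide))]
    exact h.head_lt
  head_eq := by
    rw [hF.wordArr _ (hp (.wordArr Arr.queue) (by decide)),
      hF.word _ (hp (.word Reg.head) (by decide))]
    exact h.head_eq

theorem Instance.Expanding.skip (h : I.Expanding N r x w m) (hx : ∀ k, x.2 k ≤ N)
    (hskip : I.G.Adj w x.1 → (∀ l, extendValue r x.1 x.2 w l ≤ N) →
      m.wordArr Arr.seen (code (N + 1) (w, extendValue r x.1 x.2 w)) ≠ 0) :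
    I.Expanding N r x (w + 1) m where
  searching := h.searching.skip fun c hstep hc => by
    rcases Nat.lt_succ_iff_lt_or_eq.1 hc with hc | hc
    · exact .inl hc
    · rw [h.head_eq] at hstep
      obtain ⟨hadj, hle, rfl⟩ := (codeStep_and_div_eq_iff hx).1 ⟨hstep, hc⟩
      exact .inr (hskip hadj hle)
  head_lt := h.head_lt
  head_eq := h.head_eq

def pushProg : Program :=
  .setWordArr Arr.seen Reg.code (.const 1) ;;
  .setWordArr Arr.queue Reg.size Reg.code ;;
  .setWordArr Arr.parent Reg.size Reg.head ;;
  Reg.size ≔ Reg.size ⊞ .const 1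

theorem runs_pushProg (h : I.Expanding N r x w m) (hW : I.n * (N + 1) ^ I.sigma ≤ W)
    (hx : ∀ k, x.2 k ≤ N) (hadj : I.G.Adj w x.1) (hle : ∀ l, extendValue r x.1 x.2 w l ≤ N)
    (hcode : m.word Reg.code = code (N + 1) (w, extendValue r x.1 x.2 w))
    (hnew : m.wordArr Arr.seen (m.word Reg.code) = 0) :
    Runs W pushProg m 13 (I.Expanding N r x (w + 1)) := by
  have hstep := (codeStep_and_div_eq_iff hx).2 ⟨hadj, hle, hcode.symm⟩
  rw [← h.head_eq] at hstep
  have hpush := h.searching.push h.head_lt hstep.1 hnew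
    (done' := fun c => c / (N + 1) ^ I.sigma < w + 1) fun c hc hcw =>
      (Nat.lt_succ_iff_lt_or_eq.1 hcw).imp_right fun hcw => by
        rw [h.head_eq] at hc
        exact ((codeStep_and_div_eq_iff hx).1 ⟨hc, hcw⟩).2.2.symm.trans hcode.symm
  have hsizeW : m.word 14 + 1 ≤ W := hpush.size_le_of_codeStep.trans hW
  have hcodeW : m.word 11 ≤ W :=
    (hcode.trans_lt (code_lt fun l => Nat.lt_succ_of_le (hle l))).le.trans hW
  have hhead : m.word 13 < m.word 14 := h.head_lt
  have hexpanding : m.word 13 < m.word 14 + 1 ∧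
      Function.update (m.wordArr 5) (m.word 14) (m.word 11) (m.word 13) = code (N + 1) x :=
    ⟨by omega, (Function.update_of_ne hhead.ne _ _).trans h.head_eq⟩
  refine .of_wp ?_
  simpa [pushProg, hcodeW] using ⟨by omega, by omega, by omega, ⟨by omega, by omega, by omega⟩,
    ⟨hpush, hexpanding.1, hexpanding.2⟩⟩

def visitProg : Program :=
  .ite (.le (.const 1) (adjExpr Reg.j Reg.i))
    (encodeProg ;;
     .ite (.and (.le (.const 1) Reg.ok) (.not (.le (.const 1) (.arr Arr.seen Reg.code))))
       pushProg .skip)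
    .skip

theorem runs_visitProg (hm : I.Prepared N r m) (hW : I.WordSize N W)
    (hr : ∀ v k w l, r v k w l ≤ N + 1) (hx : ∀ k, x.2 k ≤ N) (hi : m.word Reg.i = x.1)
    (hj : m.word Reg.j = w) (h : I.Expanding N r x w m) :
    Runs W visitProg m (139 * (I.sigma * I.sigma)) (I.Expanding N r x (w + 1)) := by
  have hσ : 0 < I.sigma * I.sigma := Nat.mul_pos I.sigma_pos I.sigma_pos
  have hnW := I.n_le.trans hW.places
  have hNW := hW.costs
  have hi' : WExpr.Yields W m Reg.i x.1 := .reg hi (by omega)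
  have hj' : WExpr.Yields W m Reg.j w := .reg hj (by omega)
  have hadj := hm.yields_adjExpr (I.n_mul_n_le.trans hW.places) hj' hi'
  have test_iff : (Test.le (.const 1) (adjExpr Reg.j Reg.i)).Holds m ↔ I.G.Adj w x.1 := by
    rw [← I.adjArr_ne_zero_iff, ← Nat.one_le_iff_ne_zero, ← hadj.eval]
    rfl
  have hfits : (Test.le (.const 1) (adjExpr Reg.j Reg.i)).Fits W m :=
    ⟨show 1 ≤ W by omega, hadj.fits⟩
  have hheadW : m.word Reg.head ≤ W :=
    h.head_lt.le.trans (h.searching.size_le_of_codeStep.trans hW.codes)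
  refine (Runs.ite (t := 107 * (I.sigma * I.sigma) + 23)
    hfits (fun hb => ?_) fun hb => ?_).mono_time
    (show 8 + (107 * (I.sigma * I.sigma) + 23) + 1 ≤ _ by omega)
  · refine (runs_encodeProg hm hW hr hx hheadW h.head_eq hi hj).seq
      fun m₁ hF ⟨hok, hcodeW, hiff, hcode⟩ => ?_
    have h₁ := h.of_frame hF
    have hokW : m₁.word 12 ≤ W := hok.trans (by omega)
    have hseen : m₁.wordArr 4 (m₁.word 11) ≤ 1 := h₁.searching.seen_le _
    refine Runs.ite (t := 13) (by simpa using ⟨⟨by omega, hokW⟩, by omega, hcodeW, by omega⟩)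
      (fun ⟨hok₁, hnew⟩ => ?_) fun hb₁ => .mono_time (.of_wp (h₁.skip hx fun _ hle hnew => ?_))
        (Nat.le_add_left _ _)
    · have hok₁ := Nat.one_le_iff_ne_zero.1 hok₁
      exact runs_pushProg h₁ hW.codes hx (test_iff.1 hb) (hiff.1 hok₁) (hcode hok₁)
        (not_not.1 fun h0 => hnew (Nat.one_le_iff_ne_zero.2 h0))
    · rw [← hcode (hiff.2 hle)] at hnew
      exact hb₁ ⟨Nat.one_le_iff_ne_zero.2 (hiff.2 hle), by simpa using hnew⟩
  · exact .mono_time (.of_wp (h.skip hx fun hadj => absurd (test_iff.2 hadj) hb))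
      (show 1 ≤ _ by omega)

def expandProg : Program :=
  Reg.i ≔ .arr Arr.queue Reg.head ⊘ Reg.codes ;;
  .forLoop Reg.j Reg.n visitProg ;;
  Reg.head ≔ Reg.head ⊞ .const 1

theorem runs_expandProg (hm : I.Prepared N r m) (hW : I.WordSize N W)
    (hr : ∀ v k w l, r v k w l ≤ N + 1) (h : I.Searching N r (fun _ => False) m)
    (hhead : m.word Reg.head < m.word Reg.size) :
    Runs W expandProg m (170 * (I.n * (I.sigma * I.sigma))) fun m' =>
      I.Searching N r (fun _ => False) m' ∧ m'.word Reg.head = m.word Reg.head + 1 := by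
  obtain ⟨states, hstates⟩ := h.exists_states
  obtain ⟨hx, hcode⟩ := hstates _ hhead
  set x := states (m.word Reg.head)
  have hσ : 0 < I.sigma * I.sigma := Nat.mul_pos I.sigma_pos I.sigma_pos
  have hn := I.n_pos
  have hnW := I.n_le.trans hW.places
  have hsizeW := h.size_le_of_codeStep.trans hW.codes
  refine (Runs.seq (t₁ := 5)
    (t₂ := 160 * (I.n * (I.sigma * I.sigma)) + 4) (R := fun m' => m'.word Reg.i = x.1)
    (.of_wp ?_) fun m₁ hF₁ hi => ?_).mono_time (by nlinarith)
  · have hhead' : m.word 13 < m.word 14 := hhead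
    have hsizeW' : m.word 14 ≤ W := hsizeW
    have hcode' : m.wordArr 5 (m.word 13) = code (N + 1) x := hcode.symm
    have hcodes : m.word 5 = (N + 1) ^ I.sigma := hm.codes
    have hcodeW := (code_lt fun k => Nat.lt_succ_of_le (hx.le k)).le.trans hW.codes
    simpa [hcode', hcodes, code_div fun k => Nat.lt_succ_of_le (hx.le k)] using
      ⟨⟨by omega, hcodeW⟩, hW.pow_le le_rfl⟩
  have h₀ : I.Expanding N r x 0 m :=
    ⟨h.skip fun _ _ hc => absurd hc (Nat.not_lt_zero _), hhead, hcode.symm⟩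
  have loop : Runs W (.forLoop Reg.j Reg.n visitProg) m₁ (155 * (I.n * (I.sigma * I.sigma)))
      (I.Expanding N r x I.n) :=
    Runs.forLoop (I.Expanding N r x) 139 I.n (I.sigma * I.sigma) hn hσ
      (.reg (hm.of_frame hF₁).n hnW) (h₀.of_frame hF₁) (fun j m₂ hj hF₂ hjm h₂ =>
        runs_visitProg (w := ⟨j, hj⟩) ((hm.of_frame hF₁).of_frame hF₂) hW hr hx.le
          ((hF₂.word Reg.i).trans hi) hjm h₂)
      (hloc := fun _ _ _ h => ⟨h.searching, h.head_lt, h.head_eq⟩)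
  refine (loop.seq (t₂ := 4) fun m₂ hF₂ h₂ => .of_wp ?_).mono_time (by omega)
  have hnext := h₂.searching.next h₂.head_lt fun c => CodeStep.div_lt
  have hhead₂ : m₂.word 13 = m.word 13 := by rw [hF₂.word Reg.head, hF₁.word Reg.head]
  have hhead' : m.word 13 < m.word 14 := hhead
  have hsizeW' : m.word 14 ≤ W := hsizeW
  simpa [hhead₂] using ⟨⟨by omega, by omega, by omega⟩, by rwa [← hhead₂]⟩

def startProg : Program :=
  Reg.code ≔ Reg.t ⊠ Reg.codes ;;
  .setWordArr Arr.seen Reg.code (.const 1) ;;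
  .setWordArr Arr.queue (.const 0) Reg.code ;;
  Reg.head ≔ .const 0 ;;
  Reg.size ≔ .const 1

theorem runs_startProg (hm : I.Prepared N r m) (hW : I.WordSize N W)
    (hseen : m.wordArr Arr.seen = 0) :
    Runs W startProg m 14 fun m' =>
      I.Searching N r (fun _ => False) m' ∧ m'.word Reg.head = 0 := by
  have hcode : Function.update (m.wordArr Arr.queue) 0 (I.t * (N + 1) ^ I.sigma) 0 =
      code (N + 1) (I.t, (0 : Fin I.sigma → ℕ)) := by simp [code_zero]
  have h₀ := Search.init (R := CodeStep I.G r N) (parent := m.wordArr Arr.parent) hcode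
  rw [code_zero] at h₀
  have hcodes : m.word 5 = (N + 1) ^ I.sigma := hm.codes
  have ht : m.word 2 = I.t := hm.t
  have hseen' : m.wordArr 4 = fun _ => 0 := hseen
  have hpowW := hW.pow_le le_rfl
  have htn := I.t.isLt
  have hnW := I.n_le.trans hW.places
  have htW : I.t * (N + 1) ^ I.sigma ≤ W := (Nat.mul_le_mul_right _ htn.le).trans hW.codes
  refine .of_wp ?_
  simpa [startProg, ht, hcodes, hseen', htW, hpowW] using
    ⟨by omega, by omega, by rwa [Instance.Searching, code_zero]⟩

def searchProg : Program :=
  startProg ;; .loop (.not (.le Reg.size Reg.head)) expandProg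

theorem runs_searchProg (hm : I.Prepared N r m) (hW : I.WordSize N W)
    (hr : ∀ v k w l, r v k w l ≤ N + 1) (hseen : m.wordArr Arr.seen = 0) :
    Runs W searchProg m (200 * (I.n * (N + 1) ^ I.sigma * (I.n * (I.sigma * I.sigma))))
      (I.Explored N r) := by
  have hB : 0 < I.n * (I.sigma * I.sigma) :=
    Nat.mul_pos I.n_pos (Nat.mul_pos I.sigma_pos I.sigma_pos)
  have hpow : 0 < I.n * (N + 1) ^ I.sigma := Nat.mul_pos I.n_pos (Nat.pow_pos N.succ_pos)
  refine ((runs_startProg hm hW hseen).seq (t₂ := I.n * (N + 1) ^ I.sigma *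
    (4 + 170 * (I.n * (I.sigma * I.sigma)) + 1) + (4 + 1))
    fun m₁ hF₁ ⟨h₁, hhead₁⟩ => ?_).mono_time
    (by linarith [Nat.mul_pos hpow hB, Nat.le_mul_of_pos_right (I.n * (N + 1) ^ I.sigma) hB])
  refine (Runs.loop (fun k m' => I.Searching N r (fun _ => False) m' ∧ m'.word Reg.head = k) _ _
    ⟨h₁, hhead₁⟩ (fun _ m' _ _ ⟨h, _⟩ => ?_) fun _ m' _ hF ⟨h, hhead⟩ hb => ?_).mono le_rfl
    fun m' _ ⟨_, _, ⟨h, _⟩, hb⟩ => ?_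
  · have hsizeW : m'.word 14 ≤ W := h.size_le_of_codeStep.trans hW.codes
    simpa using ⟨hsizeW, h.head_le.trans hsizeW⟩
  · have hlt : m'.word Reg.head < m'.word Reg.size := not_le.1 hb
    refine ⟨?_, (runs_expandProg ((hm.of_frame hF₁).of_frame hF) hW hr h hlt).mono le_rfl
      fun m'' _ ⟨h', hhead'⟩ => ⟨h', hhead'.trans (congrArg (· + 1) hhead)⟩⟩
    exact hhead ▸ hlt.trans_le h.size_le_of_codeStep
  · have hhead : m'.word Reg.head = m'.word Reg.size := h.head_le.antisymm (not_not.1 hb)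
    rwa [Instance.Searching, hhead] at h

end Searching

/-- The part of the memory that contains the complete search. -/
abbrev exploredLocs : List Loc :=
  [.wordArr Arr.seen, .wordArr Arr.queue, .wordArr Arr.parent, .word Reg.size]

def Test.eq (e f : WExpr) : Test := .and (.le e f) (.le f e)

section Best

variable {M : Type*} [MetricSpace M] {I : Instance M} {N W : ℕ} {m m' : Store}
  {r : Fin I.n → Fin I.sigma → Fin I.n → Fin I.sigma → ℕ}

theorem Test.holds_eq_iff {e f : WExpr} {a b : ℕ} (he : e.Yields W m a) (hf : f.Yields W m b) :
    (Test.eq e f).Holds m ↔ a = b := by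
  rw [← he.eval, ← hf.eval]
  exact le_antisymm_iff.symm

theorem Test.fits_eq {e f : WExpr} {a b : ℕ} (he : e.Yields W m a) (hf : f.Yields W m b) :
    (Test.eq e f).Fits W m :=
  ⟨⟨he.fits, hf.fits⟩, hf.fits, he.fits⟩

theorem Instance.Explored.of_frame {p : Program} (h : I.Explored N r m) (hF : Frame p m m')
    (hp : ∀ l ∈ exploredLocs, l ∉ p.writes := by decide) : I.Explored N r m' := by
  rwa [Instance.Explored, hF.wordArr _ (hp (.wordArr Arr.seen) (by decide)),
    hF.wordArr _ (hp (.wordArr Arr.queue) (by decide)),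
    hF.wordArr _ (hp (.wordArr Arr.parent) (by decide)),
    hF.word _ (hp (.word Reg.size) (by decide))]

def compareProg : Program :=
  .ite (.eq (.arr Arr.queue Reg.head ⊘ Reg.codes) Reg.s)
    (.maxLoop Reg.value Reg.k Reg.σ (digitExpr Reg.k) ;;
     .ite (.le (Reg.value ⊞ .const 1) Reg.bestValue)
       (Reg.bestValue ≔ Reg.value ;; Reg.best ≔ Reg.head) .skip)
    .skip

theorem runs_compareProg (hm : I.Prepared N r m) (hW : I.WordSize N W)
    {x : ℕ → Fin I.n × (Fin I.sigma → ℕ)} {k : ℕ} (hx : ∀ l, (x k).2 l ≤ N)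
    (hhead : m.word Reg.head = k) (hkW : k ≤ W)
    (hcode : m.wordArr Arr.queue k = code (N + 1) (x k))
    (h : MinSearch (fun k => (x k).1 = I.s) (fun k => Finset.univ.sup (x k).2) N k
      (m.word Reg.bestValue) (m.word Reg.best)) :
    Runs W compareProg m (90 * I.sigma) fun m' =>
      MinSearch (fun k => (x k).1 = I.s) (fun k => Finset.univ.sup (x k).2) N (k + 1)
        (m'.word Reg.bestValue) (m'.word Reg.best) := by
  have hσ := I.sigma_pos
  have hσW := hW.sigma_le
  have hNW := hW.costs
  have hnW := I.n_le.trans hW.places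
  have hcodeW := (code_lt fun k => Nat.lt_succ_of_le (hx k)).le.trans hW.codes
  have hqueue : WExpr.Yields W m (.arr Arr.queue Reg.head) (code (N + 1) (x k)) :=
    (WExpr.Yields.reg hhead hkW).arr hcode hcodeW
  have hvertex := hqueue.div (.reg hm.codes (hW.pow_le le_rfl))
  rw [code_div fun k => Nat.lt_succ_of_le (hx k)] at hvertex
  have hs : WExpr.Yields W m Reg.s I.s := .reg hm.s (by omega)
  refine (Runs.ite (t := 70 * I.sigma) (Test.fits_eq hvertex hs) (fun hb => ?_)
    fun hb => ?_).mono_time (show 13 + 70 * I.sigma + 1 ≤ 90 * I.sigma by omega)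
  · have hk : (x k).1 = I.s := Fin.ext ((Test.holds_eq_iff hvertex hs).1 hb)
    let f l := if h : l < I.sigma then (x k).2 ⟨l, h⟩ else 0
    refine ((Runs.maxLoop f I.sigma_pos (.reg hm.σ hσW) fun l m' hl hF hlm => ?_).seq (t₂ := 10)
      fun m₁ hF hvalue => .of_wp ?_).mono_time (show 40 * I.sigma + 10 ≤ 70 * I.sigma by omega)
    · have hqueue' := hqueue.congr fun a ha => hF a (by revert a; decide)
      simp only [f, dif_pos hl]
      exact (hm.of_frame hF).yields_digitExpr hW hx hqueue' (a := ⟨l, hl⟩) (.reg hlm (by omega))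
    · have hvalue : m₁.word 10 = Finset.univ.sup (x k).2 :=
        hvalue.trans (sup_range_eq_sup_univ fun l => by simp [f])
      have hbest : m₁.word 15 = m.word 15 := hF.word Reg.best
      have hbestValue : m₁.word 16 = m.word 16 := hF.word Reg.bestValue
      have hhead₁ : m₁.word 13 = k := (hF.word Reg.head).trans hhead
      have hN : Finset.univ.sup (x k).2 ≤ N := Finset.sup_le fun l _ => hx l
      have hle : m.word 16 ≤ N + 1 := h.value_le
      by_cases hlt : Finset.univ.sup (x k).2 < m.word 16
      · simpa [hvalue, hbest, hbestValue, hhead₁, hlt, -Finset.sup_le_iff] using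
          ⟨by omega, by omega, by omega, h.update hk hlt⟩
      · simpa [hvalue, hbest, hbestValue, hhead₁, hlt, -Finset.sup_le_iff] using
          ⟨by omega, h.skip fun _ => not_lt.1 hlt⟩
  · have hk : (x k).1 ≠ I.s := fun e => hb ((Test.holds_eq_iff hvertex hs).2 (congrArg Fin.val e))
    exact Runs.mono_time (.of_wp (h.skip fun e => (hk e).elim)) (show 1 ≤ 70 * I.sigma by omega)

def bestProg : Program :=
  Reg.bestValue ≔ Reg.levels ⊞ .const 1 ;; .forLoop Reg.head Reg.size compareProg

theorem runs_bestProg (hm : I.Prepared N r m) (hW : I.WordSize N W) (hE : I.Explored N r m)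
    (hs : ∃ g, ReachableState I.G r N I.t (I.s, g)) :
    Runs W bestProg m (110 * (I.n * (N + 1) ^ I.sigma * I.sigma)) fun m' =>
      ∃ g : Fin I.sigma → ℕ, (∀ l, g l ≤ N) ∧ m'.word Reg.best < m.word Reg.size ∧
        m.wordArr Arr.queue (m'.word Reg.best) = code (N + 1) (I.s, g) ∧
        ∀ g', ReachableState I.G r N I.t (I.s, g') → Finset.univ.sup g ≤ Finset.univ.sup g' := by
  have hσ := I.sigma_pos
  have hNW := hW.costs
  have hlevels : m.word 4 = N := hm.levels
  have hsizeW := hE.size_le_of_codeStep.trans hW.codes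
  have hstates : m.word Reg.size * I.sigma ≤ I.n * (N + 1) ^ I.sigma * I.sigma :=
    Nat.mul_le_mul_right _ hE.size_le_of_codeStep
  have hpos := Nat.mul_pos hE.size_pos hσ
  obtain ⟨x, hx⟩ := hE.exists_states
  have hxN k (hk : k < m.word Reg.size) l : (x k).2 l ≤ N := (hx k hk).1.le l
  refine (Runs.seq (t₁ := 4) (t₂ := 106 * (m.word Reg.size * I.sigma))
    (R := fun m' => m'.word Reg.bestValue = N + 1)
    (.of_wp (by simpa [hlevels] using (by omega))) fun m₁ hF₁ h₁ => ?_).mono_time (by omega)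
  refine (Runs.forLoop (fun k m' => MinSearch (fun k => (x k).1 = I.s)
    (fun k => Finset.univ.sup (x k).2) N k (m'.word Reg.bestValue) (m'.word Reg.best)) 90
    (m.word Reg.size) I.sigma hE.size_pos hσ (.reg (hF₁.word Reg.size) hsizeW)
    (by rw [h₁]; exact .init _ _ _ _) fun k m' hk hF hkm h => ?_).mono le_rfl fun m' _ h => ?_
  · have hqueue : m'.wordArr Arr.queue = m.wordArr Arr.queue :=
      (hF.wordArr Arr.queue).trans (hF₁.wordArr Arr.queue)
    exact runs_compareProg ((hm.of_frame hF₁).of_frame hF) hW (hxN k hk) hkm (by omega)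
      (by rw [hqueue, (hx k hk).2]) h
  · have hfind {g} (hg : ReachableState I.G r N I.t (I.s, g)) :
        ∃ k < m.word Reg.size, x k = (I.s, g) := by
      obtain ⟨k, hk, hqueue⟩ := hE.exists_of_reachable (reflTransGen_codeStep_iff.2 ⟨_, hg, rfl⟩)
      exact ⟨k, hk, code_injective (fun l => Nat.lt_succ_of_le (hxN k hk l))
        (fun l => Nat.lt_succ_of_le (hg.le l)) ((hx k hk).2.trans hqueue)⟩
    obtain ⟨g₀, hg₀⟩ := hs
    obtain ⟨k₀, hk₀, hxk₀⟩ := hfind hg₀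
    obtain ⟨hbest, hbests, hmin⟩ := h.best_spec hk₀ (congrArg Prod.fst hxk₀)
      (Finset.sup_le fun l _ => hxN k₀ hk₀ l)
    refine ⟨(x (m'.word Reg.best)).2, hxN _ hbest, hbest, ?_, fun g' hg' => ?_⟩
    · rw [← (hx _ hbest).2, ← hbests]
    · obtain ⟨k, hk, hxk⟩ := hfind hg'
      simpa [hxk] using hmin k hk (congrArg Prod.fst hxk)

end Best

section Output

variable {M : Type*} [MetricSpace M] {I : Instance M} {N W : ℕ} {m : Store}
  {r : Fin I.n → Fin I.sigma → Fin I.n → Fin I.sigma → ℕ}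

def followProg : Program :=
  .setWordArr Arr.next (.arr Arr.queue Reg.i ⊘ Reg.codes)
    (.arr Arr.queue (.arr Arr.parent Reg.i) ⊘ Reg.codes) ;;
  Reg.i ≔ .arr Arr.parent Reg.i

theorem runs_followProg (hcodes : m.word Reg.codes = (N + 1) ^ I.sigma) (hW : I.WordSize N W)
    (hE : I.Explored N r m) {k : ℕ} (hk : m.word Reg.i = k) (hk₀ : k ≠ 0)
    (hlt : k < m.word Reg.size) :
    Runs W followProg m 13 fun m' => m'.word Reg.i = m.wordArr Arr.parent k ∧
      m'.wordArr Arr.next = Function.update (m.wordArr Arr.next)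
        (m.wordArr Arr.queue k / (N + 1) ^ I.sigma)
        (m.wordArr Arr.queue (m.wordArr Arr.parent k) / (N + 1) ^ I.sigma) := by
  have hcodes : m.word 5 = (N + 1) ^ I.sigma := hcodes
  have hk : m.word 6 = k := hk
  have hparent : m.wordArr 6 k < k := (hE.step k hlt hk₀).1
  have hsizeW := hE.size_le_of_codeStep.trans hW.codes
  have hqueue : m.wordArr 5 k ≤ W := (hE.queue_lt hlt).le.trans hW.codes
  have hqueue' : m.wordArr 5 (m.wordArr 6 k) ≤ W :=
    (hE.queue_lt (hparent.trans hlt)).le.trans hW.codes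
  have hcodesW := hW.pow_le le_rfl
  refine Runs.mono_time (.of_wp ?_) le_rfl
  simpa [followProg, hk, hcodes] using ⟨by omega, by omega, by omega⟩

/-- Since later occurrences of a vertex overwrite earlier ones, `next` ends up with the successor of
its last occurrence. -/
def traceProg : Program :=
  Reg.i ≔ Reg.best ;; .loop (.le (.const 1) Reg.i) followProg

theorem runs_traceProg (hm : I.Prepared N r m) (hW : I.WordSize N W) (hE : I.Explored N r m)
    {g : Fin I.sigma → ℕ} (hg : ∀ l, g l ≤ N) (hb : m.word Reg.best < m.word Reg.size)
    (hcode : m.wordArr Arr.queue (m.word Reg.best) = code (N + 1) (I.s, g)) :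
    Runs W traceProg m (20 * (I.n * (N + 1) ^ I.sigma)) fun m' =>
      ∃ P : I.G.Walk I.s I.t, P.IsPath ∧
        (∀ k < P.length, m'.wordArr Arr.next (P.getVert k) = P.getVert (k + 1)) ∧
        ∀ u, weight (inScenario r u) P ≤ g (u I.s) := by
  have hNW := hW.costs
  have hsize := hE.size_le_of_codeStep
  have hsizeW := hsize.trans hW.codes
  generalize hb' : m.word Reg.best = b at hb hcode
  let place i := (m.wordArr Arr.parent)^[i] b
  have hplace (i : ℕ) : m.wordArr Arr.parent (place i) = place (i + 1) :=
    (Function.iterate_succ_apply' _ i b).symm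
  let v i := m.wordArr Arr.queue (place i) / (N + 1) ^ I.sigma
  refine (Runs.seq (t₁ := 2) (t₂ := b * 17 + 4) (R := fun m' => m'.word Reg.i = b)
    (.of_wp (by simpa [hb'] using (by omega))) fun m₁ hF₁ h₁ => ?_).mono_time (by omega)
  refine (Runs.loop (fun k m' => m'.word Reg.i = place k ∧ place k + k ≤ b ∧
    (∀ i < k, place i ≠ 0) ∧ FollowsLast v (fun a c => m'.wordArr Arr.next a = c) k) b 13
    ⟨h₁, le_rfl, by simp, by simp [FollowsLast]⟩ (fun _ _ _ _ ⟨_, _, _⟩ => ?_)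
    fun k m' _ hF ⟨hi, hk, hpos, hnext⟩ hnonzero => ?_).mono le_rfl
    fun m' _ ⟨L, _, ⟨hi, _, hpos, hnext⟩, hzero⟩ => ?_
  · exact ⟨show 1 ≤ W by omega, show _ ≤ W by omega⟩
  · have hnonzero : place k ≠ 0 := Nat.one_le_iff_ne_zero.1 (hi ▸ hnonzero)
    have hlt : place k < m.word Reg.size := hE.iterate_parent_lt hb hpos le_rfl
    have hdecr : m.wordArr Arr.parent (place k) < place k := (hE.step _ hlt hnonzero).1
    have hqueue : m'.wordArr Arr.queue = m.wordArr Arr.queue :=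
      (hF.wordArr Arr.queue).trans (hF₁.wordArr Arr.queue)
    have hparent : m'.wordArr Arr.parent = m.wordArr Arr.parent :=
      (hF.wordArr Arr.parent).trans (hF₁.wordArr Arr.parent)
    refine ⟨by omega, (runs_followProg ((hm.of_frame hF₁).of_frame hF).codes hW
      ((hE.of_frame hF₁).of_frame hF) hi hnonzero
      (by rwa [hF.word Reg.size, hF₁.word Reg.size])).mono le_rfl fun m'' _ ⟨hi', hnext'⟩ => ?_⟩
    rw [hparent, hplace] at hi' hnext'
    rw [hqueue] at hnext'
    refine ⟨hi', by rw [← hplace]; omega, fun i hik => ?_, hnext' ▸ hnext.update⟩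
    rcases Nat.lt_succ_iff_lt_or_eq.1 hik with hik | rfl
    exacts [hpos i hik, hnonzero]
  · have hzero : place L = 0 := by
      by_contra h
      exact hzero (show 1 ≤ m'.word Reg.i by rw [hi]; omega)
    exact hE.exists_isPath_of_next hb hg hcode hpos hzero hnext

def copyProg : Program :=
  .setWordArr 0 Reg.k Reg.j ;; Reg.j ≔ .arr Arr.next Reg.j ;; Reg.k ≔ Reg.k ⊞ .const 1

theorem runs_copyProg {k v w : ℕ} (hk : m.word Reg.k = k) (hv : m.word Reg.j = v)
    (hw : m.wordArr Arr.next v = w) (hkW : k < W) (hvW : v ≤ W) (hwW : w ≤ W) :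
    Runs W copyProg m 10 fun m' => m'.word Reg.k = k + 1 ∧ m'.word Reg.j = w ∧
      m'.wordArr 0 = Function.update (m.wordArr 0) k v := by
  have hk : m.word 8 = k := hk
  have hv : m.word 7 = v := hv
  have hw : m.wordArr 7 v = w := hw
  refine Runs.mono_time (.of_wp ?_) le_rfl
  simpa [copyProg, hk, hv, hw] using ⟨by omega, by omega, by omega⟩

def copyPathProg : Program := .loop (.not (Test.eq Reg.j Reg.t)) copyProg

theorem runs_copyPathProg (ht : m.word Reg.t = I.t) (hW : I.n ≤ W) {P : I.G.Walk I.s I.t}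
    (hP : P.IsPath)
    (hnext : ∀ k < P.length, m.wordArr Arr.next (P.getVert k) = P.getVert (k + 1))
    (hk : m.word Reg.k = 0) (hj : m.word Reg.j = I.s) :
    Runs W copyPathProg m (30 * I.n) fun m' => m'.word Reg.k = P.length ∧
      m'.word Reg.j = P.getVert P.length ∧ ∀ i < P.length, m'.wordArr 0 i = P.getVert i := by
  have hlength : P.length < I.n := by simpa using hP.length_lt
  have hvert k : P.getVert k ≤ W := (P.getVert k).isLt.le.trans hW
  let Inv k (m' : Store) : Prop := m'.word Reg.k = k ∧ m'.word Reg.j = P.getVert k ∧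
    ∀ i < k, m'.wordArr 0 i = P.getVert i
  have hyj {k m'} (h : Inv k m') : WExpr.Yields W m' Reg.j (P.getVert k) := .reg h.2.1 (hvert k)
  have hyt {m'} (hF : Frame copyProg m m') : WExpr.Yields W m' Reg.t I.t :=
    .reg ((hF.word Reg.t).trans ht) (I.t.isLt.le.trans hW)
  refine (Runs.loop (b := .not (Test.eq Reg.j Reg.t)) (p := copyProg) Inv P.length 10
    ⟨hk, by simpa using hj, by simp⟩ (fun k m' _ hF h => Test.fits_eq (hyj h) (hyt hF))
    fun k m' hk hF h hjt => ?step).mono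
    (show P.length * (8 + 10 + 1) + (8 + 1) ≤ 30 * I.n by omega) fun m' hF ⟨k, hk, h, hjt⟩ => ?exit
  case step =>
    have hkP : k < P.length := by
      refine hk.lt_of_ne fun hk => hjt ?_
      rw [Test.holds_eq_iff (hyj h) (hyt hF), hk, P.getVert_length]
    have hnext' : m'.wordArr Arr.next (P.getVert k) = P.getVert (k + 1) := by
      rw [hF.wordArr Arr.next, hnext k hkP]
    refine ⟨hkP, (runs_copyProg h.1 h.2.1 hnext' (by omega) (hvert k) (hvert _)).mono le_rfl
      fun m'' _ ⟨hk', hj', hcopy⟩ => ⟨hk', hj', fun i hi => ?_⟩⟩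
    rcases Nat.lt_succ_iff_lt_or_eq.1 hi with hik | rfl
    · rw [hcopy, Function.update_of_ne hik.ne, h.2.2 i hik]
    · rw [hcopy, Function.update_self]
  case exit =>
    have hkt := (Test.holds_eq_iff (hyj h) (hyt hF)).1 (not_not.1 hjt)
    obtain rfl := hP.getVert_injOn hk (show P.length ≤ P.length from le_rfl)
      ((Fin.ext hkt).trans P.getVert_length.symm)
    exact h

def outputProg : Program :=
  (Reg.j ≔ Reg.s ;; Reg.k ≔ .const 0) ;; copyPathProg ;;
  .setWordArr 0 Reg.k Reg.j ;; .setWord 0 Reg.k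

theorem runs_outputProg (hI : I.Loaded m) (hW : I.n ≤ W) {P : I.G.Walk I.s I.t}
    (hP : P.IsPath)
    (hnext : ∀ k < P.length, m.wordArr Arr.next (P.getVert k) = P.getVert (k + 1)) :
    Runs W outputProg m (40 * I.n) fun m' => I.IsOutput m' P := by
  have hlength : P.length < I.n := by simpa using hP.length_lt
  have hs : m.word 1 = I.s := hI.s
  have := I.s.isLt
  have := I.t.isLt
  refine (Runs.seq (t₁ := 4) (t₂ := 30 * I.n + 5)
    (R := fun m' => m'.word Reg.k = 0 ∧ m'.word Reg.j = I.s)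
    (.of_wp (by simpa [hs] using (by omega))) fun m₁ hF₁ ⟨hk, hj⟩ =>
    (runs_copyPathProg (hI.of_frame hF₁).t hW hP (by rwa [hF₁.wordArr Arr.next]) hk hj).seq
      (t₂ := 5) fun m₂ _ ⟨hk, hj, hcopy⟩ => .of_wp ?_).mono_time (by omega)
  have hk : m₂.word 8 = P.length := hk
  have hj : m₂.word 7 = P.getVert P.length := hj
  have hcopy' k (hk : k ≤ P.length) :
      Function.update (m₂.wordArr 0) P.length I.t k = P.getVert k := by
    obtain rfl | hkP := eq_or_ne k P.length
    · rw [Function.update_self, P.getVert_length]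
    · rw [Function.update_of_ne hkP, hcopy k (by omega)]
  simpa [hk, hj, Instance.IsOutput] using ⟨by omega, by omega, by omega, hcopy'⟩

end Output

/-- The running time of the scheme with `N` levels, up to a constant factor. -/
def Instance.work {M : Type*} [MetricSpace M] (I : Instance M) (N : ℕ) : ℕ :=
  I.n ^ 3 * I.sigma ^ 2 * (N + 1) ^ I.sigma

section Scheme

variable {M : Type*} [MetricSpace M] {I : Instance M} {N W : ℕ} {m : Store} {D ε : ℝ}
  {r : Fin I.n → Fin I.sigma → Fin I.n → Fin I.sigma → ℕ}

theorem Instance.le_work_of_eq (I : Instance M) {x : ℕ} (a b c : ℕ)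
    (hx : x = I.n ^ a * I.sigma ^ b * ((N + 1) ^ I.sigma) ^ c) (ha : a ≤ 3 := by decide)
    (hb : b ≤ 2 := by decide) (hc : c ≤ 1 := by decide) : x ≤ I.work N := by
  rw [hx, work, ← pow_one ((N + 1) ^ I.sigma)]
  exact Nat.mul_le_mul (Nat.mul_le_mul (Nat.pow_le_pow_right I.n_pos ha)
    (Nat.pow_le_pow_right I.sigma_pos hb)) (by simpa using Nat.pow_le_pow_right (by positivity) hc)

theorem Instance.succ_le_work (I : Instance M) (N : ℕ) : N + 1 ≤ I.work N :=
  (Nat.le_self_pow I.sigma_pos.ne' _).trans (I.le_work_of_eq 0 0 1 (by ring))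

theorem Instance.WordSize.of_work_le (hW : 2 * I.work N ≤ W) : I.WordSize N W where
  places := (I.le_work_of_eq 2 2 0 (by ring)).trans (by omega : I.work N ≤ W)
  codes := (I.le_work_of_eq 1 0 1 (by ring)).trans (by omega : I.work N ≤ W)
  costs := (Nat.mul_le_mul_left 2 (I.succ_le_work N)).trans hW

def prepareProg : Program := levelsProg ;; shortestProg ;; roundDistProg ;; powersProg

theorem runs_prepareProg (hI : I.Loaded m) (hε : m.real RealReg.ε = ε) (hε₀ : 0 < ε)
    (hN : levels I.n ε = N) (hreached : m.wordArr Arr.reached = 0)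
    (hst : I.G.Reachable I.s I.t) (hW : 2 * I.work N ≤ W) :
    Runs W prepareProg m (330 * I.work N) fun m' =>
      ∃ D r, I.IsEstimate D ∧ (∀ v k w l, Rounded D N (I.gap v k w l) (r v k w l)) ∧
        I.Prepared N r m' := by
  have hWS : I.WordSize N W := .of_work_le hW
  have hN₀ : 0 < N := hN ▸ levels_pos _ _
  have hNW := I.succ_le_work N
  have hsquare : I.n * I.n ≤ I.work N := I.le_work_of_eq 2 0 0 (by ring)
  have hrelax : I.n * (I.n * (I.n * (I.sigma * I.sigma))) ≤ I.work N :=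
    I.le_work_of_eq 3 2 0 (by ring)
  have hround : I.n * I.sigma * (I.n * I.sigma) * (N + 1) ≤ I.work N :=
    (Nat.mul_le_mul_left _ (Nat.le_self_pow I.sigma_pos.ne' _)).trans
      (I.le_work_of_eq 2 2 1 (by ring))
  have hpowers : I.sigma ≤ I.work N := I.le_work_of_eq 0 1 0 (by ring)
  have hlevels := runs_levelsProg (W := W) hI.n hε I.n_pos hε₀ (by omega) (by omega)
  rw [hN] at hlevels
  refine (hlevels.seq (t₂ := 160 * (I.n * (I.n * (I.n * (I.sigma * I.sigma)))) +
    (92 * (I.n * I.sigma * (I.n * I.sigma) * (N + 1)) + 27 * I.sigma))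
    fun m₁ hF₁ hlevels₁ => ?_).mono_time (by omega)
  have hI₁ := hI.of_frame hF₁
  refine (runs_shortestProg hI₁ hWS.places ((hF₁.wordArr Arr.reached).trans hreached) hst).seq
    fun m₂ hF₂ hD => ?_
  have hI₂ := hI₁.of_frame hF₂
  have hlevels₂ := (hF₂.word Reg.levels).trans hlevels₁
  refine (runs_roundDistProg hI₂ hlevels₂ rfl hD.nonneg hN₀ hWS.places (by omega)).seq
    fun m₃ hF₃ hr => ?_
  have hI₃ := hI₂.of_frame hF₃
  have hlevels₃ := (hF₃.word Reg.levels).trans hlevels₂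
  refine (runs_powersProg hI₃ hlevels₃ hWS).mono le_rfl fun m₄ hF₄ ⟨hcodes, hpower⟩ => ?_
  exact ⟨_, _, hD, hr, hI₃.of_frame hF₄, (hF₄.word Reg.levels).trans hlevels₃, hcodes, hpower,
    congrArg entry (hF₄.wordArr Arr.table)⟩

def solveProg : Program := searchProg ;; bestProg ;; traceProg ;; outputProg

theorem runs_solveProg (hm : I.Prepared N r m) (hseen : m.wordArr Arr.seen = 0)
    (hD : I.IsEstimate D) (hr : ∀ v k w l, Rounded D N (I.gap v k w l) (r v k w l))
    (hN₀ : 0 < N) (hε : 0 < ε) (hN : (I.n : ℝ) ^ 2 ≤ N * ε) (hW : 2 * I.work N ≤ W) :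
    Runs W solveProg m (370 * I.work N) fun m' =>
      ∃ P : I.G.Walk I.s I.t, I.IsOutput m' P ∧ I.IsApprox (1 + ε) P := by
  have hWS : I.WordSize N W := .of_work_le hW
  have hsearch : I.n * (N + 1) ^ I.sigma * (I.n * (I.sigma * I.sigma)) ≤ I.work N :=
    I.le_work_of_eq 2 2 1 (by ring)
  have hbest : I.n * (N + 1) ^ I.sigma * I.sigma ≤ I.work N := I.le_work_of_eq 1 1 1 (by ring)
  have htrace : I.n * (N + 1) ^ I.sigma ≤ I.work N := I.le_work_of_eq 1 0 1 (by ring)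
  have houtput : I.n ≤ I.work N := I.le_work_of_eq 1 0 0 (by ring)
  obtain ⟨Q, hQ, hQD⟩ := hD.exists_cost_le
  obtain ⟨g₀, hg₀, -⟩ := Instance.exists_reachableState_of_cost_le hD.nonneg hr hQ hQD
  refine ((runs_searchProg hm hWS (fun v k w l => (hr v k w l).le) hseen).seq
    (t₂ := 110 * (I.n * (N + 1) ^ I.sigma * I.sigma) + (20 * (I.n * (N + 1) ^ I.sigma) +
    40 * I.n)) fun m₁ hF₁ hE₁ => ?_).mono_time (by omega)
  have hm₁ := hm.of_frame hF₁
  refine (runs_bestProg hm₁ hWS hE₁ ⟨g₀, hg₀⟩).seq fun m₂ hF₂ ⟨g, hg, hb, hcode, hmin⟩ => ?_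
  have hm₂ := hm₁.of_frame hF₂
  refine (runs_traceProg hm₂ hWS (hE₁.of_frame hF₂) hg (by rwa [hF₂.word Reg.size])
    (by rwa [hF₂.wordArr Arr.queue])).seq fun m₃ hF₃ ⟨P, hP, hnext, hPg⟩ => ?_
  refine (runs_outputProg (hm₂.of_frame hF₃).toLoaded (by omega) hP hnext).mono le_rfl
    fun m₄ _ hP' => ⟨P, hP', Instance.isApprox_of_best hD hN₀ hε hN hr hg hmin hP hPg⟩

def schemeProg : Program := prepareProg ;; solveProg

theorem runs_schemeProg (I : Instance M) (hst : I.G.Reachable I.s I.t) (hε : 0 < ε)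
    (hW : 2 * I.work (levels I.n ε) ≤ W) :
    Runs W schemeProg (I.input ε) (700 * I.work (levels I.n ε)) fun m =>
      ∃ P : I.G.Walk I.s I.t, I.IsOutput m P ∧ I.IsApprox (1 + ε) P := by
  have hI : I.Loaded (I.input ε) := ⟨rfl, rfl, rfl, rfl, rfl, rfl⟩
  refine ((runs_prepareProg hI (ε := ε) rfl hε rfl rfl hst hW).seq
    (t₂ := 370 * I.work (levels I.n ε)) fun m hF ⟨D, r, hD, hr, hm⟩ => ?_).mono_time (by omega)
  exact runs_solveProg hm (hF.wordArr Arr.seen) hD hr (levels_pos _ _) hε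
    ((levels_le_iff hε (levels_pos _ _)).1 le_rfl) hW

theorem levels_add_one_le {n : ℕ} (hε : 0 < ε) :
    (levels n ε + 1 : ℝ) ≤ 3 * max 1 ((n : ℝ) ^ 2 / ε) := by
  have hratio : (0 : ℝ) ≤ (n : ℝ) ^ 2 / ε := by positivity
  have hceil := (Nat.ceil_lt_add_one hratio).le
  have hlevels : (levels n ε : ℝ) ≤ max 1 ((n : ℝ) ^ 2 / ε) + 1 := by
    rw [levels, Nat.cast_max, Nat.cast_one]
    exact max_le (by simp [hratio]) (hceil.trans (by gcongr; exact le_max_right _ _))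
  linarith [le_max_left 1 ((n : ℝ) ^ 2 / ε)]

theorem work_levels_le_bound (I : Instance M) (hε : 0 < ε) :
    (I.work (levels I.n ε) : ℝ) ≤ 3 ^ I.sigma * I.bound ε := by
  have hpow : ((levels I.n ε : ℝ) + 1) ^ I.sigma ≤
      3 ^ I.sigma * (max 1 ((I.n : ℝ) ^ 2 / ε)) ^ I.sigma := by
    rw [← mul_pow]
    exact pow_le_pow_left₀ (by positivity) (levels_add_one_le hε) _
  calc (I.work (levels I.n ε) : ℝ) = I.n ^ 3 * I.sigma ^ 2 * (levels I.n ε + 1) ^ I.sigma := by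
        simp only [Instance.work, Nat.cast_mul, Nat.cast_pow, Nat.cast_add, Nat.cast_one]
    _ ≤ I.n ^ 3 * I.sigma ^ 2 * (3 ^ I.sigma * (max 1 ((I.n : ℝ) ^ 2 / ε)) ^ I.sigma) := by gcongr
    _ = 3 ^ I.sigma * I.bound ε := by rw [Instance.bound]; ring

end Scheme

end RobustSP

theorem mainTheorem1 :
    ∃ A : RobustSP.Program, ∀ σ : ℕ, ∃ C : ℝ,
      ∀ (M : Type*) [MetricSpace M] (I : RobustSP.Instance M) (ε : ℝ),
        I.sigma = σ → I.G.Reachable I.s I.t → 0 < ε →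
          ∃ (T : ℕ) (m : RobustSP.Store) (P : I.G.Walk I.s I.t),
            RobustSP.Exec ⌊C * I.bound ε⌋₊ A (I.input ε) T m ∧
            (T : ℝ) ≤ C * I.bound ε ∧
            I.IsOutput m P ∧
            I.IsApprox (1 + ε) P := by
  refine ⟨RobustSP.schemeProg, fun σ => ⟨700 * 3 ^ σ, fun M _ I ε hσ hst hε => ?_⟩⟩
  have hwork : ((700 * I.work (RobustSP.levels I.n ε) : ℕ) : ℝ) ≤ 700 * 3 ^ σ * I.bound ε := by
    have := RobustSP.work_levels_le_bound I hε
    rw [← hσ]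
    push_cast
    linarith
  obtain ⟨T, m, hexec, hT, P, hout, happrox⟩ :=
    RobustSP.runs_schemeProg I hst hε (le_trans (by omega) (Nat.le_floor hwork))
  exact ⟨T, m, P, hexec, (Nat.cast_le.2 hT).trans hwork, hout, happrox⟩
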